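/- Let $\Sigma$ and $\widehat\Sigma$ be open (that is, connected and noncompact) Riemann surfaces, let $n\ge 1$, and let $m_1,\dots,m_n$ be positive integers. Let $g_1,\dots,g_n$ be holomorphic maps from $\Sigma$ to the Riemann sphere $\overline{\mathbf C}=\mathbf C\cup\{\infty\}$, and $\hat g_1,\dots,\hat g_n$ holomorphic maps from $\widehat\Sigma$ to $\overline{\mathbf C}$, none of them identically $\infty$. Let $\omega$ and $\hat\omega$ be holomorphic $1$-forms on $\Sigma$ and $\widehat\Sigma$, and suppose that $$ds^2=\prod_{i=1}^n(1+|g_i|^2)^{m_i}|\omega|^2\quad\text{and}\quad d\hat s^2=\prod_{i=1}^n(1+|\hat g_i|^2)^{m_i}|\hat\omega|^2$$ are conformal metrics on $\Sigma$ and $\widehat\Sigma$ respectively, i.e. they extend smoothly across the poles of the $g_i$ (resp. $\hat g_i$) and have the form $\lambda(z)^2|dz|^2$ with $\lambda>0$ smooth in each holomorphic coordinate $z$. Let $\Psi\colon\Sigma\to\widehat\Sigma$ be a conformal diffeomorphism (a biholomorphic map). Let $k\ge 1$ and $1\le i_1<\dots<i_k\le n$, and suppose that $g_{i_1},\dots,g_{i_k}$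 and $\hat g_{i_1},\dots,\hat g_{i_k}$ are nonconstant, while $g_i$ and $\hat g_i$ are constant for every other index $i$. Suppose that for each $l=1,\dots,k$ the maps $g_{i_l}$ and $\hat g_{i_l}\circ\Psi$ share $q_{i_l}>4$ distinct values, i.e. there are $q_{i_l}$ distinct points $\alpha\in\overline{\mathbf C}$ with $g_{i_l}^{-1}(\alpha)=(\hat g_{i_l}\circ\Psi)^{-1}(\alpha)$, and that $g_{i_l}\not\equiv\hat g_{i_l}\circ\Psi$. If $ds^2$ or $d\hat s^2$ is complete (every divergent curve has infinite length), then $$\sum_{l=1}^k\frac{m_{i_l}}{q_{i_l}-4}\ \ge\ 1.$$ -/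

import Mathlib

open scoped Manifold ContDiff Topology
open MeasureTheory

noncomputable section

/-- The coordinate vector field `∂/∂z` of the chart at `p₀`, at the point with coordinate `z`. -/
def coordVec {S : Type*} [TopologicalSpace S] [ChartedSpace ℂ S] (p₀ : S) (z : ℂ) :
    TangentSpace 𝓘(ℂ) ((chartAt ℂ p₀).symm z) :=
  mfderiv 𝓘(ℂ) 𝓘(ℂ) (chartAt ℂ p₀).symm z (1 : ℂ)

/-- Holomorphic 1-forms: `ℂ`-linear forms on the tangent spaces such that, in every chart,
`ω = h(z) dz` with `h` holomorphic. -/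
structure HolomorphicOneForm (S : Type*) [TopologicalSpace S] [ChartedSpace ℂ S] where
  /-- the linear form at each point -/
  toFun : (p : S) → TangentSpace 𝓘(ℂ) p →L[ℂ] ℂ
  holomorphic : ∀ p₀ : S, DifferentiableOn ℂ
    (fun z : ℂ => toFun ((chartAt ℂ p₀).symm z) (coordVec p₀ z)) (chartAt ℂ p₀).target

/-- Conformal metrics, given by their length element `ds` on tangent vectors: in every chart,
`ds = lam(z) |dz|` with `lam` smooth and positive. -/
structure ConformalMetric (S : Type*) [TopologicalSpace S] [ChartedSpace ℂ S] where
  /-- the length `ds(v)` of a tangent vector `v` at `p` -/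
  len : (p : S) → TangentSpace 𝓘(ℂ) p → ℝ
  len_smul : ∀ (p : S) (c : ℂ) (v : TangentSpace 𝓘(ℂ) p), len p (c • v) = ‖c‖ * len p v
  len_pos : ∀ (p : S) (v : TangentSpace 𝓘(ℂ) p), v ≠ 0 → 0 < len p v
  smooth : ∀ p₀ : S, ContDiffOn ℝ ∞
    (fun z : ℂ => len ((chartAt ℂ p₀).symm z) (coordVec p₀ z)) (chartAt ℂ p₀).target

/-- The length of the curve `γ : [0,1) → S` with respect to a conformal metric. -/
def ConformalMetric.curveLength {S : Type*} [TopologicalSpace S] [ChartedSpace ℂ S]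
    (ds : ConformalMetric S) (γ : ℝ → S) : ENNReal :=
  ∫⁻ t in Set.Ioo (0 : ℝ) 1, ENNReal.ofReal
    (ds.len (γ t) (mfderiv 𝓘(ℝ) 𝓘(ℝ, ℂ) γ t (1 : ℝ)))

/-- Completeness: every divergent curve (a `C¹` curve `[0,1) → S` which leaves every compact
set as `t → 1`) has infinite length. -/
def ConformalMetric.IsComplete {S : Type*} [TopologicalSpace S] [ChartedSpace ℂ S]
    (ds : ConformalMetric S) : Prop :=
  ∀ γ : ℝ → S, ContMDiffOn 𝓘(ℝ) 𝓘(ℝ, ℂ) 1 γ (Set.Ico 0 1) →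
    Filter.Tendsto γ (𝓝[<] 1) (Filter.cocompact S) → ds.curveLength γ = ⊤

/-- The parametrization `w ↦ 1/w` of the Riemann sphere `ℂ ∪ {∞}` minus `0`; it sends `0` to `∞`. -/
def sphereInv (w : ℂ) : OnePoint ℂ :=
  if w = 0 then OnePoint.infty else ((w⁻¹ : ℂ) : OnePoint ℂ)

/-- Holomorphic maps from a Riemann surface to the Riemann sphere `ℂ ∪ {∞}`: near each point, one
of the two standard coordinates `w`, `1/w` of the sphere is defined along `g` and is
a holomorphic function. -/
def IsHolomorphicToSphere {S : Type*} [TopologicalSpace S] [ChartedSpace ℂ S]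
    (g : S → OnePoint ℂ) : Prop :=
  ∀ p : S, ∃ f : S → ℂ, (∀ᶠ x in 𝓝 p, MDifferentiableAt 𝓘(ℂ) 𝓘(ℂ) f x) ∧
    ((∀ᶠ x in 𝓝 p, g x = (f x : OnePoint ℂ)) ∨ (∀ᶠ x in 𝓝 p, g x = sphereInv (f x)))

/-- `ds² = ∏ᵢ (1 + |gᵢ|²)^{mᵢ} |η|²`. No `gᵢ` is identically `∞`, the equality
holds wherever all `gᵢ` are finite, and at the (isolated) poles `ds` is the continuous extension,
which is part of `ds` being a conformal metric. -/
def ConformalMetric.IsGivenBy {S : Type*} [TopologicalSpace S] [ChartedSpace ℂ S] {n : ℕ}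
    (ds : ConformalMetric S) (g : Fin n → S → OnePoint ℂ) (m : Fin n → ℕ)
    (η : HolomorphicOneForm S) : Prop :=
  (∀ i, ∃ p, g i p ≠ OnePoint.infty) ∧
  ∀ (p : S) (z : Fin n → ℂ), (∀ i, g i p = (z i : OnePoint ℂ)) →
    ∀ v : TangentSpace 𝓘(ℂ) p,
      ds.len p v ^ 2 = (∏ i, (1 + ‖z i‖ ^ 2) ^ m i) * ‖η.toFun p v‖ ^ 2

/-- The map `g` is constant. -/
def IsConstantMap {S T : Type*} (g : S → T) : Prop := ∃ c, ∀ p, g p = c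

/-- `g` and `g'` share the value `α`, ignoring multiplicity. -/
def SharesValue {S T : Type*} (g g' : S → T) (α : T) : Prop := g ⁻¹' {α} = g' ⁻¹' {α}

end

/-!
The argument is by contradiction: if `∑ mᵢ / (qᵢ - 4) < 1`, then a metric `∏ (1 + |fᵢ|²)^{mᵢ} |η|²`
on a surface, whose maps `fᵢ` share values with a second family `gᵢ` on the same surface, is not
complete. A biholomorphic map carries the second family to the surface with the complete metric, so
the two cases of the theorem are instances of this (`one_le_sum_of_isComplete`).

For two maps `f ≠ g` from a disc to the sphere sharing the `q` values in `A`, write `|·,·|` for the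
chordal distance and `f*` for the spherical derivative, and consider the density
`ρ = |f,g| ∏ |f,α|^{-(1-e)(1-D)} ∏ |g,α|^{-(1-e)D} (f*)^{1-D} (g*)^D` (`dens`).
Because the values are shared, the factor `|f,g|` compensates the poles of the other factors, and `ρ`
is continuous (`Generic.logHol_or_hasOrd`). In homogeneous coordinates `F`, `G` it is the modulus of
a multivalued holomorphic function times `|F|^{2P} |G|^{2Q}`, with `P` and `Q` explicit functions
of `e`, `D` and `q` (`densExp`, `LiftAt.dens_eq`). If `P, Q ≥ 0`, the Ahlfors–Schwarz lemma
shows that `ρ` is at most a multiple of the Poincaré density (`exists_dens_le`). The parameters are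
taken such that `P = μ/2` and `Q = 0` with `μ < q - 4`; this is possible exactly because `q > 4`.

Let `X = ∏ ρᵢ^{kᵢ}` with `kᵢ μᵢ = mᵢ` and put `κ = ∑ kᵢ`; by assumption the `μᵢ < qᵢ - 4` can be
chosen such that `κ < 1`, with `κ` as close to `1` as needed (`exists_weight`). The factors
`(1 + |fᵢ|²)` cancel in `ds / X`, so the metric `ds^{1/(1-κ)} X^{-1/(1-κ)}` is flat where `X ≠ 0`. As
`κ` is close to `1`, the zeros of `X`, which are isolated, become points at infinite distance
(`SharingFamily.Admissible.isFlatOn`). On a disc that is mapped isometrically with respect to the flat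
metric, `ds = X |dz|`, so `ds` is at most a multiple of the `κ`-th power of the Poincaré density
(`SharingFamily.Admissible.exists_pull_le`). Evaluated at the centre, this bounds the radius of such
discs. A maximal one has a radius that is mapped to a divergent curve
(`IsFlatOn.exists_divergent_ray`), and its `ds`-length is at most a multiple of
`∫ (1 - t)^{-κ} dt < ∞`. Hence `ds` is not complete.
-/

noncomputable section

open Asymptotics Filter

/-! ### Second order expansions and the Ahlfors–Schwarz lemma -/

/-- Taylor expansion of order two, over `ℝ` or `ℂ`, for a function whose derivative is differentiable
at one point. -/
theorem isLittleO_taylor_two {𝕜 : Type*} [RCLike 𝕜] {θ θ' : 𝕜 → 𝕜} {x₀ t : 𝕜}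
    (h1 : ∀ᶠ x in 𝓝 x₀, HasDerivAt θ (θ' x) x) (h2 : HasDerivAt θ' t x₀) :
    (fun y => θ (x₀ + y) - (θ x₀ + θ' x₀ * y + t / 2 * y ^ 2)) =o[𝓝 0] fun y => ‖y‖ ^ 2 := by
  rw [isLittleO_iff]
  intro c hc
  have h2' := (hasDerivAt_iff_isLittleO_nhds_zero.1 h2)
  rw [isLittleO_iff] at h2'
  have h3 : Tendsto (fun y : 𝕜 => x₀ + y) (𝓝 0) (𝓝 x₀) := by
    have : Continuous (fun y : 𝕜 => x₀ + y) := by fun_prop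
    simpa using this.tendsto 0
  obtain ⟨r, hr, hball⟩ := Metric.eventually_nhds_iff_ball.1 ((h2' hc).and (h3.eventually h1))
  filter_upwards [Metric.ball_mem_nhds (0 : 𝕜) hr] with y hy
  let G : 𝕜 → 𝕜 := fun y => θ (x₀ + y) - (θ x₀ + θ' x₀ * y + t / 2 * y ^ 2)
  have key : ∀ x ∈ Metric.closedBall (0 : 𝕜) ‖y‖,
      HasDerivWithinAt G (θ' (x₀ + x) - θ' x₀ - x * t) (Metric.closedBall (0 : 𝕜) ‖y‖) x ∧
        ‖θ' (x₀ + x) - θ' x₀ - x * t‖ ≤ c * ‖y‖ := by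
    intro x hx
    have hx' : x ∈ Metric.ball (0 : 𝕜) r := by
      simp only [Metric.mem_closedBall, Metric.mem_ball, dist_zero_right] at *; linarith
    obtain ⟨ha, hb⟩ := hball x hx'
    refine ⟨?_, ?_⟩
    · apply HasDerivAt.hasDerivWithinAt
      have e1 : HasDerivAt (fun y => θ (x₀ + y)) (θ' (x₀ + x)) x :=
        hb.comp_const_add x₀ x
      have e2 : HasDerivAt (fun y : 𝕜 => θ x₀ + θ' x₀ * y + t / 2 * y ^ 2)
          (θ' x₀ * 1 + t / 2 * (2 * x)) x := by
        have := ((hasDerivAt_id x).const_mul (θ' x₀)).const_add (θ x₀)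
        have h' := ((hasDerivAt_id x).pow 2).const_mul (t / 2)
        exact (this.add h').congr_deriv (by simp)
      have e3 : HasDerivAt G (θ' (x₀ + x) - (θ' x₀ * 1 + t / 2 * (2 * x))) x := e1.sub e2
      refine e3.congr_deriv ?_
      field_simp
      ring
    · simp only [smul_eq_mul] at ha
      refine ha.trans ?_
      simp only [Metric.mem_closedBall, dist_zero_right] at hx
      gcongr
  have := Convex.norm_image_sub_le_of_norm_hasDerivWithin_le (fun x hx => (key x hx).1)
    (fun x hx => (key x hx).2) (convex_closedBall 0 ‖y‖) (x := 0) (y := y) (by simp) (by simp)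
  have hG0 : G 0 = 0 := by simp [G]
  rw [hG0] at this
  simp only [sub_zero] at this
  rw [norm_pow, norm_norm]
  calc _ = ‖G y‖ := rfl
    _ ≤ _ := this
    _ = _ := by ring

/-- Second order expansion `u(w + h) = u(w) + Re(b h + a h²) + ℓ |h|² + o(|h|²)` with some `a`: in
terms of Wirtinger derivatives `b = 2 ∂u` and `ℓ = ∂∂̄u`, a quarter of the Laplacian. -/
def HasExp2 (u : ℂ → ℝ) (w b : ℂ) (ℓ : ℝ) : Prop :=
  ∃ a : ℂ, (fun h : ℂ => u (w + h) - (u w + (b * h + a * h ^ 2).re + ℓ * ‖h‖ ^ 2)) =o[𝓝 0]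
    fun h => ‖h‖ ^ 2

namespace HasExp2

variable {u v : ℂ → ℝ} {w b b' : ℂ} {ℓ ℓ' : ℝ}

theorem congr (hu : HasExp2 u w b ℓ) (h : v =ᶠ[𝓝 w] u) : HasExp2 v w b ℓ := by
  obtain ⟨a, ha⟩ := hu
  refine ⟨a, ha.congr' ?_ .rfl⟩
  have h3 : Tendsto (fun y : ℂ => w + y) (𝓝 0) (𝓝 w) := by
    have : Continuous (fun y : ℂ => w + y) := by fun_prop
    simpa using this.tendsto 0
  filter_upwards [h3.eventually h] with y hy
  rw [hy, h.eq_of_nhds]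

theorem add (hu : HasExp2 u w b ℓ) (hv : HasExp2 v w b' ℓ') :
    HasExp2 (fun z => u z + v z) w (b + b') (ℓ + ℓ') := by
  obtain ⟨a, ha⟩ := hu
  obtain ⟨a', ha'⟩ := hv
  refine ⟨a + a', (ha.add ha').congr_left fun h => ?_⟩
  simp only [add_mul, Complex.add_re]
  ring

theorem const_mul (c : ℝ) (hu : HasExp2 u w b ℓ) :
    HasExp2 (fun z => c * u z) w (c * b) (c * ℓ) := by
  obtain ⟨a, ha⟩ := hu
  refine ⟨c * a, (ha.const_mul_left c).congr_left fun h => ?_⟩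
  have : ((c * b * h + c * a * h ^ 2 : ℂ)).re = c * (b * h + a * h ^ 2).re := by
    rw [← Complex.re_ofReal_mul]; ring_nf
  rw [this]; ring

theorem const (c : ℝ) : HasExp2 (fun _ => c) w 0 0 := ⟨0, by simp⟩

theorem sum {ι : Type*} (s : Finset ι) {u : ι → ℂ → ℝ} {b : ι → ℂ} {ℓ : ι → ℝ}
    (h : ∀ i ∈ s, HasExp2 (u i) w (b i) (ℓ i)) :
    HasExp2 (fun z => ∑ i ∈ s, u i z) w (∑ i ∈ s, b i) (∑ i ∈ s, ℓ i) := by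
  classical
  induction s using Finset.induction_on with
  | empty => simpa using const 0
  | insert i s hi ih =>
    simp only [Finset.sum_insert hi]
    exact (h i (by simp)).add (ih fun j hj => h j (by simp [hj]))

/-- The first order part of the expansion. -/
theorem sub_linear (hu : HasExp2 u w b ℓ) :
    (fun h => u (w + h) - u w - (b * h).re) =O[𝓝 0] fun h => ‖h‖ ^ 2 := by
  obtain ⟨a, ha⟩ := hu
  have h1 : (fun h : ℂ => (a * h ^ 2).re + ℓ * ‖h‖ ^ 2) =O[𝓝 0] fun h => ‖h‖ ^ 2 := by
    refine IsBigO.of_bound (‖a‖ + |ℓ|) (Eventually.of_forall fun h => ?_)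
    have : |(a * h ^ 2).re| ≤ ‖a‖ * ‖h‖ ^ 2 := by
      rw [← norm_pow, ← norm_mul]
      exact Complex.abs_re_le_norm (a * h ^ 2)
    calc ‖(a * h ^ 2).re + ℓ * ‖h‖ ^ 2‖ ≤ |(a * h ^ 2).re| + |ℓ * ‖h‖ ^ 2| := abs_add_le _ _
      _ ≤ ‖a‖ * ‖h‖ ^ 2 + |ℓ| * ‖h‖ ^ 2 := by
        rw [abs_mul, abs_of_nonneg (by positivity : 0 ≤ ‖h‖ ^ 2)]; gcongr
      _ = _ := by rw [norm_pow, norm_norm]; ring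
  refine (ha.isBigO.add h1).congr_left fun h => ?_
  simp only [Complex.add_re]; ring

theorem continuousAt (hu : HasExp2 u w b ℓ) : ContinuousAt u w := by
  have h0 : Tendsto (fun h : ℂ => ‖h‖ ^ 2) (𝓝 0) (𝓝 0) := by
    have : Continuous (fun h : ℂ => ‖h‖ ^ 2) := by fun_prop
    simpa using this.tendsto 0
  have h1 := hu.sub_linear.trans_tendsto h0
  have h2 : Tendsto (fun h : ℂ => u w + (b * h).re) (𝓝 0) (𝓝 (u w)) := by
    have : Continuous (fun h : ℂ => u w + (b * h).re) := by fun_prop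
    simpa using this.tendsto 0
  have h3 : Tendsto (fun h : ℂ => u (w + h)) (𝓝 0) (𝓝 (u w)) := by
    simpa using (h1.add h2).congr fun h => by ring
  have h4 : Tendsto (fun z : ℂ => z - w) (𝓝 w) (𝓝 0) := by
    have : Continuous (fun z : ℂ => z - w) := by fun_prop
    simpa using this.tendsto w
  exact (h3.comp h4).congr fun z => by simp

/-- Chain rule: `∂∂̄ θ(u) = θ'(u) ∂∂̄u + θ''(u) |∂u|²`. -/
theorem comp {θ θ' : ℝ → ℝ} {t : ℝ} (hu : HasExp2 u w b ℓ)
    (h1 : ∀ᶠ x in 𝓝 (u w), HasDerivAt θ (θ' x) x) (h2 : HasDerivAt θ' t (u w)) :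
    HasExp2 (fun z => θ (u z)) w (θ' (u w) * b) (θ' (u w) * ℓ + t * ‖b‖ ^ 2 / 4) := by
  have hlin := hu.sub_linear
  have hcont := hu.continuousAt
  obtain ⟨a, ha⟩ := hu
  refine ⟨θ' (u w) * a + t * b ^ 2 / 4, ?_⟩
  have hT := isLittleO_taylor_two h1 h2
  have h0 : Tendsto (fun h : ℂ => u (w + h) - u w) (𝓝 0) (𝓝 0) := by
    have h3 : Tendsto (fun y : ℂ => w + y) (𝓝 0) (𝓝 w) := by
      have : Continuous (fun y : ℂ => w + y) := by fun_prop
      simpa using this.tendsto 0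
    simpa using (hcont.tendsto.comp h3).sub_const (u w)
  have hT' := hT.comp_tendsto h0
  -- the increment of `u` is `O(h)`, and differs from its linear part by `O(h²)`
  have hre : (fun h : ℂ => (b * h).re) =O[𝓝 0] fun h => ‖h‖ := by
    refine IsBigO.of_bound ‖b‖ (Eventually.of_forall fun h => ?_)
    simpa using Complex.abs_re_le_norm (b * h)
  have hsq : (fun h : ℂ => ‖h‖ ^ 2) =o[𝓝 0] fun h => ‖h‖ := by
    have : (fun h : ℂ => ‖h‖ * ‖h‖) =o[𝓝 0] fun h => 1 * ‖h‖ := by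
      refine IsLittleO.mul_isBigO ?_ (isBigO_refl _ _)
      rw [isLittleO_one_iff]
      simpa using (continuous_norm (E := ℂ)).tendsto 0
    simpa [sq] using this
  have hd : (fun h : ℂ => u (w + h) - u w) =O[𝓝 0] fun h => ‖h‖ :=
    ((hlin.trans hsq.isBigO).add hre).congr_left fun h => by ring
  have hd2 : (fun h : ℂ => ‖u (w + h) - u w‖ ^ 2) =O[𝓝 0] fun h => ‖h‖ ^ 2 := hd.norm_left.pow 2
  have e1 := hT'.trans_isBigO hd2
  have e2 := ha.const_mul_left (θ' (u w))
  have e3 : (fun h : ℂ => (u (w + h) - u w - (b * h).re) * (u (w + h) - u w + (b * h).re))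
      =o[𝓝 0] fun h => ‖h‖ ^ 2 := by
    have : (fun h : ℂ => (u (w + h) - u w - (b * h).re) * (u (w + h) - u w + (b * h).re))
      =o[𝓝 0] fun h => ‖h‖ * ‖h‖ := (hlin.trans_isLittleO hsq).mul_isBigO (hd.add hre)
    simpa [sq] using this
  refine ((e1.add e2).add (e3.const_mul_left (t / 2))).congr_left fun h => ?_
  have hb : (b * h).re ^ 2 = ‖b‖ ^ 2 * ‖h‖ ^ 2 / 2 + (b ^ 2 * h ^ 2).re / 2 := by
    have : b ^ 2 * h ^ 2 = (b * h) * (b * h) := by ring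
    rw [this, ← mul_pow, ← norm_mul, ← Complex.normSq_eq_norm_sq, Complex.normSq_apply]
    simp only [Complex.mul_re (b * h) (b * h)]
    ring
  have hc : ((θ' (u w) * b * h + (θ' (u w) * a + t * b ^ 2 / 4) * h ^ 2 : ℂ)).re
      = θ' (u w) * (b * h).re + θ' (u w) * (a * h ^ 2).re + t / 4 * (b ^ 2 * h ^ 2).re := by
    rw [← Complex.re_ofReal_mul, ← Complex.re_ofReal_mul, ← Complex.re_ofReal_mul,
      ← Complex.add_re, ← Complex.add_re]
    push_cast
    ring_nf
  simp only [Function.comp, hc, Complex.add_re, add_sub_cancel]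
  linear_combination (-t / 2) * hb

theorem exp (hu : HasExp2 u w b ℓ) :
    HasExp2 (fun z => Real.exp (u z)) w (Real.exp (u w) * b)
      (Real.exp (u w) * (ℓ + ‖b‖ ^ 2 / 4)) := by
  convert hu.comp (θ := Real.exp) (θ' := Real.exp) (Eventually.of_forall Real.hasDerivAt_exp)
    (Real.hasDerivAt_exp _) using 1
  ring

theorem log (hu : HasExp2 u w b ℓ) (h0 : u w ≠ 0) :
    HasExp2 (fun z => Real.log (u z)) w ((u w)⁻¹ * b)
      (ℓ / u w - ‖b‖ ^ 2 / (4 * u w ^ 2)) := by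
  have h1 : ∀ᶠ x in 𝓝 (u w), HasDerivAt Real.log x⁻¹ x := by
    filter_upwards [isOpen_ne.mem_nhds h0] with x hx
    exact Real.hasDerivAt_log hx
  convert hu.comp h1 (hasDerivAt_inv h0) using 1
  field_simp
  ring

theorem re_analytic {k : ℂ → ℂ} (hk : AnalyticAt ℂ k w) :
    HasExp2 (fun z => (k z).re) w (deriv k w) 0 := by
  have h1 : ∀ᶠ x in 𝓝 w, HasDerivAt k (deriv k x) x := by
    filter_upwards [hk.eventually_analyticAt] with x hx
    exact hx.differentiableAt.hasDerivAt
  refine ⟨deriv (deriv k) w / 2, ?_⟩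
  have := isLittleO_taylor_two h1 hk.deriv.differentiableAt.hasDerivAt
  refine (IsBigO.trans_isLittleO ?_ this)
  refine IsBigO.of_bound 1 (Eventually.of_forall fun h => ?_)
  rw [one_mul]
  refine le_trans (le_of_eq ?_) (Complex.abs_re_le_norm _)
  simp only [Real.norm_eq_abs, Complex.sub_re, Complex.add_re]
  ring_nf

theorem norm_sq_analytic {k : ℂ → ℂ} (hk : AnalyticAt ℂ k w) :
    HasExp2 (fun z => ‖k z‖ ^ 2) w (2 * (starRingEnd ℂ (k w) * deriv k w)) (‖deriv k w‖ ^ 2) := by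
  -- `|k|² = (Re k)² + (Re (-i k))²`
  have h1 := (re_analytic hk).comp (θ := fun x => x ^ 2) (θ' := fun x => 2 * x) (t := 2)
    (Eventually.of_forall fun x => by simpa using hasDerivAt_pow 2 x)
    (by simpa using (hasDerivAt_id _).const_mul (2 : ℝ))
  have hk' : AnalyticAt ℂ (fun z => -Complex.I * k z) w := analyticAt_const.mul hk
  have h2 := (re_analytic hk').comp (θ := fun x => x ^ 2) (θ' := fun x => 2 * x) (t := 2)
    (Eventually.of_forall fun x => by simpa using hasDerivAt_pow 2 x)
    (by simpa using (hasDerivAt_id _).const_mul (2 : ℝ))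
  have hd : deriv (fun z => -Complex.I * k z) w = -Complex.I * deriv k w :=
    deriv_const_mul _ hk.differentiableAt
  rw [hd] at h2
  convert h1.add h2 using 1
  · funext z
    rw [← Complex.normSq_eq_norm_sq, Complex.normSq_apply]
    simp
    ring
  · apply Complex.ext <;> simp <;> ring
  · simp
    ring

/-- The expansion at a local maximum has `ℓ ≤ 0`. -/
theorem nonpos_of_isLocalMax (hu : HasExp2 u w b ℓ) (hmax : IsLocalMax u w) : ℓ ≤ 0 := by
  obtain ⟨a, ha⟩ := hu
  by_contra! hℓ
  rw [isLittleO_iff] at ha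
  have h3 : Tendsto (fun y : ℂ => w + y) (𝓝 0) (𝓝 w) := by
    have : Continuous (fun y : ℂ => w + y) := by fun_prop
    simpa using this.tendsto 0
  obtain ⟨r, hr, hball⟩ := Metric.eventually_nhds_iff_ball.1
    ((ha (half_pos hℓ)).and (h3.eventually hmax))
  -- averaging over `h, ih, -h, -ih` removes the terms in `h` and `h²`
  have key : ∀ h : ℂ, ‖h‖ = r / 2 → ℓ / 2 * ‖h‖ ^ 2 + (b * h + a * h ^ 2).re ≤ 0 := by
    intro h hh
    obtain ⟨hA, hB⟩ := hball h (by simp [hh]; linarith)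
    have := (abs_le.1 hA).1
    simp only [norm_pow, norm_norm] at this
    linarith
  set h : ℂ := ((r / 2 : ℝ) : ℂ) with hh
  have hn : ‖h‖ = r / 2 := by rw [hh, Complex.norm_real]; exact abs_of_pos (by linarith)
  have k1 := key h hn
  have k2 := key (-h) (by simpa using hn)
  have k3 := key (Complex.I * h) (by simpa using hn)
  have k4 := key (-(Complex.I * h)) (by simpa using hn)
  simp only [norm_neg, norm_mul, Complex.norm_I, one_mul, hn] at k1 k2 k3 k4
  have hI : ∀ z : ℂ, (a * (Complex.I * z) ^ 2) = -(a * z ^ 2) := by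
    intro z; rw [mul_pow, Complex.I_sq]; ring
  simp only [neg_sq, hI, mul_neg, Complex.add_re, Complex.neg_re] at k1 k2 k3 k4
  nlinarith [sq_pos_of_pos hr]

end HasExp2

/-- `∂∂̄` of the logarithm of the Poincaré density `r / (r² - |z|²)`, up to sign. -/
theorem exists_hasExp2_log_radius {r : ℝ} {w : ℂ} (hw : ‖w‖ < r) :
    ∃ b, HasExp2 (fun z => Real.log (r ^ 2 - ‖z‖ ^ 2)) w b (-r ^ 2 / (r ^ 2 - ‖w‖ ^ 2) ^ 2) := by
  have hpos : 0 < r ^ 2 - ‖w‖ ^ 2 := by nlinarith [norm_nonneg w]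
  have h := ((HasExp2.const (w := w) (r ^ 2)).add
    ((HasExp2.norm_sq_analytic (analyticAt_id (z := w))).const_mul (-1))).congr
    (v := fun z => r ^ 2 - ‖z‖ ^ 2) (Eventually.of_forall fun z => by simp; ring)
  have h2 := h.log hpos.ne'
  refine ⟨_, by convert h2 using 1; simp; field_simp; ring⟩

/-- **Ahlfors–Schwarz lemma**: a continuous density with curvature bounded above by a negative
constant wherever it is nonzero is dominated by the Poincaré density of the disc. -/
theorem ahlfors_schwarz {v : ℂ → ℝ} {R c : ℝ} (hc : 0 < c)
    (hcont : ContinuousOn v (Metric.ball 0 R))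
    (hexp : ∀ w ∈ Metric.ball (0 : ℂ) R, 0 < v w →
      ∃ b ℓ, HasExp2 (fun z => Real.log (v z)) w b ℓ ∧ (c * v w) ^ 2 ≤ ℓ) :
    ∀ w ∈ Metric.ball (0 : ℂ) R, v w ≤ c⁻¹ * (R / (R ^ 2 - ‖w‖ ^ 2)) := by
  have main : ∀ r, 0 < r → r < R → ∀ w ∈ Metric.ball (0 : ℂ) r,
      v w * (r ^ 2 - ‖w‖ ^ 2) ≤ c⁻¹ * r := by
    intro r hr0 hr w hw
    have hsub : Metric.closedBall (0 : ℂ) r ⊆ Metric.ball 0 R := Metric.closedBall_subset_ball hr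
    obtain ⟨w₀, hw₀, hmax⟩ := (isCompact_closedBall (0 : ℂ) r).exists_isMaxOn
      ⟨0, by simp [hr0.le]⟩
      (f := fun w => v w * (r ^ 2 - ‖w‖ ^ 2)) ((hcont.mono hsub).mul (by fun_prop))
    refine (hmax (Metric.ball_subset_closedBall hw)).trans ?_
    simp only
    by_cases hv : 0 < v w₀ * (r ^ 2 - ‖w₀‖ ^ 2)
    swap
    · exact (not_lt.1 hv).trans (by positivity)
    have hw₀' : ‖w₀‖ ≤ r := by simpa using hw₀
    have hx0 : 0 ≤ r ^ 2 - ‖w₀‖ ^ 2 := by nlinarith [norm_nonneg w₀]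
    have hx : 0 < r ^ 2 - ‖w₀‖ ^ 2 := lt_of_le_of_ne hx0 fun h => by simp [← h] at hv
    have hvpos : 0 < v w₀ := by
      by_contra! h; nlinarith
    have hlt : ‖w₀‖ < r := by nlinarith [norm_nonneg w₀]
    obtain ⟨b, ℓ, hE, hℓ⟩ := hexp w₀ (hsub hw₀) hvpos
    obtain ⟨b', hE'⟩ := exists_hasExp2_log_radius hlt
    have hsum := hE.add hE'
    have hloc : IsLocalMax (fun z => Real.log (v z) + Real.log (r ^ 2 - ‖z‖ ^ 2)) w₀ := by
      have hnear : Metric.ball (0 : ℂ) r ∈ 𝓝 w₀ := Metric.isOpen_ball.mem_nhds (by simpa using hlt)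
      have hpos : ∀ᶠ z in 𝓝 w₀, 0 < v z :=
        (hcont.continuousAt (Metric.isOpen_ball.mem_nhds (hsub hw₀))).eventually
          (lt_mem_nhds hvpos)
      filter_upwards [hnear, hpos] with z hz hvz
      have hz' : ‖z‖ < r := by simpa using hz
      have hzx : 0 < r ^ 2 - ‖z‖ ^ 2 := by nlinarith [norm_nonneg z]
      rw [← Real.log_mul hvz.ne' hzx.ne', ← Real.log_mul hvpos.ne' hx.ne']
      exact Real.log_le_log (by positivity) (hmax (Metric.ball_subset_closedBall hz))
    have hle := hsum.nonpos_of_isLocalMax hloc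
    have h1 : (c * v w₀) ^ 2 * (r ^ 2 - ‖w₀‖ ^ 2) ^ 2 ≤ r ^ 2 := by
      have : ℓ ≤ r ^ 2 / (r ^ 2 - ‖w₀‖ ^ 2) ^ 2 := by
        rw [neg_div] at hle; linarith
      rw [← le_div_iff₀ (by positivity)]
      linarith
    have h2 : c * v w₀ * (r ^ 2 - ‖w₀‖ ^ 2) ≤ r := by
      apply le_of_sq_le_sq _ hr0.le
      rw [mul_pow]; exact h1
    rw [inv_mul_eq_div, le_div_iff₀ hc]
    linarith
  intro w hw
  have hw' : ‖w‖ < R := by simpa using hw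
  have hx : 0 < R ^ 2 - ‖w‖ ^ 2 := by nlinarith [norm_nonneg w]
  have hlim : v w * (R ^ 2 - ‖w‖ ^ 2) ≤ c⁻¹ * R := by
    have t1 : Tendsto (fun r : ℝ => v w * (r ^ 2 - ‖w‖ ^ 2)) (𝓝[<] R)
        (𝓝 (v w * (R ^ 2 - ‖w‖ ^ 2))) := by
      apply Tendsto.mono_left _ nhdsWithin_le_nhds
      exact Continuous.tendsto (by fun_prop) R
    have t2 : Tendsto (fun r : ℝ => c⁻¹ * r) (𝓝[<] R) (𝓝 (c⁻¹ * R)) := by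
      apply Tendsto.mono_left _ nhdsWithin_le_nhds
      exact Continuous.tendsto (by fun_prop) R
    refine le_of_tendsto_of_tendsto t1 t2 ?_
    filter_upwards [Ioo_mem_nhdsLT hw'] with r hr
    exact main r ((norm_nonneg w).trans_lt hr.1) hr.2 w (by simpa using hr.1)
  rw [← mul_div_assoc, le_div_iff₀ hx]
  exact hlim

/-! ### Homogeneous coordinates and the chordal distance on the Riemann sphere -/

/-- The determinant of two vectors of `ℂ²`. -/
def wedge (x y : ℂ × ℂ) : ℂ := x.1 * y.2 - x.2 * y.1

/-- The squared Hermitian norm on `ℂ²`. (The norm of `ℂ × ℂ` is the supremum norm.) -/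
def nsq (x : ℂ × ℂ) : ℝ := ‖x.1‖ ^ 2 + ‖x.2‖ ^ 2

/-- The Hermitian inner product of `ℂ²`, antilinear in the second argument. -/
def herm (x y : ℂ × ℂ) : ℂ := x.1 * starRingEnd ℂ y.1 + x.2 * starRingEnd ℂ y.2

theorem norm_sq_eq_mul_conj (z : ℂ) : ((‖z‖ ^ 2 : ℝ) : ℂ) = z * starRingEnd ℂ z := by
  rw [Complex.mul_conj, Complex.normSq_eq_norm_sq]

/-- Lagrange's identity. -/
theorem norm_wedge_sq_add (x y : ℂ × ℂ) :
    ‖wedge x y‖ ^ 2 + ‖herm x y‖ ^ 2 = nsq x * nsq y := by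
  apply Complex.ofReal_injective
  rw [nsq, nsq, Complex.ofReal_add, Complex.ofReal_mul, Complex.ofReal_add, Complex.ofReal_add]
  simp only [norm_sq_eq_mul_conj, wedge, herm, map_add, map_sub, map_mul, Complex.conj_conj]
  ring

theorem nsq_nonneg (x : ℂ × ℂ) : 0 ≤ nsq x := by unfold nsq; positivity

theorem nsq_pos {x : ℂ × ℂ} (hx : x ≠ 0) : 0 < nsq x := by
  refine lt_of_le_of_ne (nsq_nonneg x) fun h => hx ?_
  unfold nsq at h
  have h1 : ‖x.1‖ = 0 := by nlinarith [sq_nonneg ‖x.1‖, sq_nonneg ‖x.2‖]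
  have h2 : ‖x.2‖ = 0 := by nlinarith [sq_nonneg ‖x.1‖, sq_nonneg ‖x.2‖]
  exact Prod.ext (norm_eq_zero.1 h1) (norm_eq_zero.1 h2)

theorem wedge_swap (x y : ℂ × ℂ) : wedge x y = -wedge y x := by unfold wedge; ring

theorem wedge_self (x : ℂ × ℂ) : wedge x x = 0 := by unfold wedge; ring

theorem nsq_smul (c : ℂ) (x : ℂ × ℂ) : nsq (c • x) = ‖c‖ ^ 2 * nsq x := by
  simp [nsq]; ring

theorem wedge_smul_left (c : ℂ) (x y : ℂ × ℂ) : wedge (c • x) y = c * wedge x y := by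
  simp [wedge]; ring

theorem wedge_smul_right (c : ℂ) (x y : ℂ × ℂ) : wedge x (c • y) = c * wedge x y := by
  simp [wedge]; ring

theorem wedge_mul_wedge (x y a b : ℂ × ℂ) :
    wedge x y * wedge a b = wedge x a * wedge y b - wedge x b * wedge y a := by
  unfold wedge; ring

theorem eq_smul_of_wedge_eq_zero {x y : ℂ × ℂ} (hy : nsq y = 1) (h : wedge x y = 0) :
    x = herm x y • y := by
  have h1 : y.1 * starRingEnd ℂ y.1 + y.2 * starRingEnd ℂ y.2 = 1 := by
    rw [← norm_sq_eq_mul_conj, ← norm_sq_eq_mul_conj, ← Complex.ofReal_add]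
    simpa [nsq] using congrArg Complex.ofReal hy
  have h2 : x.1 * y.2 - x.2 * y.1 = 0 := h
  refine Prod.ext ?_ ?_
  · simp only [herm, Prod.smul_fst, smul_eq_mul]
    linear_combination (-x.1) * h1 + starRingEnd ℂ y.2 * h2
  · simp only [herm, Prod.smul_snd, smul_eq_mul]
    linear_combination (-x.2) * h1 - starRingEnd ℂ y.1 * h2

/-- A unit vector spanning the line in `ℂ²` of slope `x`: homogeneous coordinates of a point of the
Riemann sphere. -/
def rep (x : OnePoint ℂ) : ℂ × ℂ :=
  x.elim (0, 1) fun z => (((√(1 + ‖z‖ ^ 2))⁻¹ : ℝ) : ℂ) • (1, z)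

theorem rep_infty : rep OnePoint.infty = (0, 1) := rfl

theorem rep_coe (z : ℂ) : rep (z : OnePoint ℂ) = (((√(1 + ‖z‖ ^ 2))⁻¹ : ℝ) : ℂ) • (1, z) := rfl

theorem nsq_rep (x : OnePoint ℂ) : nsq (rep x) = 1 := by
  induction x using OnePoint.rec with
  | infty => simp [rep_infty, nsq]
  | coe z =>
    rw [rep_coe, nsq_smul]
    have h : 0 < 1 + ‖z‖ ^ 2 := by positivity
    simp only [nsq, norm_one, Complex.norm_real, norm_inv, Real.norm_eq_abs,
      abs_of_nonneg (Real.sqrt_nonneg _), inv_pow, Real.sq_sqrt h.le, one_pow]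
    field_simp

theorem rep_ne_zero (x : OnePoint ℂ) : rep x ≠ 0 := by
  intro h
  have := nsq_rep x
  rw [h] at this
  simp [nsq] at this

theorem rep_coe_fst_ne_zero (z : ℂ) : (((√(1 + ‖z‖ ^ 2))⁻¹ : ℝ) : ℂ) ≠ 0 := by
  have : 0 < √(1 + ‖z‖ ^ 2) := by positivity
  exact_mod_cast (inv_pos.2 this).ne'

theorem wedge_rep_eq_zero_iff {x y : OnePoint ℂ} : wedge (rep x) (rep y) = 0 ↔ x = y := by
  refine ⟨fun h => ?_, fun h => h ▸ wedge_self _⟩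
  induction x using OnePoint.rec with
  | infty =>
    induction y using OnePoint.rec with
    | infty => rfl
    | coe z =>
      rw [rep_infty, rep_coe, wedge_smul_right] at h
      simp [wedge] at h
      exact absurd h (by positivity)
  | coe z =>
    induction y using OnePoint.rec with
    | infty =>
      rw [rep_infty, rep_coe, wedge_smul_left] at h
      simp [wedge] at h
      exact absurd h (by positivity)
    | coe z' =>
      rw [rep_coe, rep_coe, wedge_smul_left, wedge_smul_right] at h
      have := (mul_eq_zero.1 ((mul_eq_zero.1 h).resolve_left
        (rep_coe_fst_ne_zero z))).resolve_left (rep_coe_fst_ne_zero z')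
      simp only [wedge, one_mul, mul_one, sub_eq_zero] at this
      rw [this]

/-- The chordal distance on the Riemann sphere, normalized to have diameter `1`. -/
def chord (x y : OnePoint ℂ) : ℝ := ‖wedge (rep x) (rep y)‖

theorem chord_nonneg (x y : OnePoint ℂ) : 0 ≤ chord x y := norm_nonneg _

theorem chord_eq_zero_iff {x y : OnePoint ℂ} : chord x y = 0 ↔ x = y := by
  rw [chord, norm_eq_zero, wedge_rep_eq_zero_iff]

theorem chord_le_one (x y : OnePoint ℂ) : chord x y ≤ 1 := by
  have := norm_wedge_sq_add (rep x) (rep y)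
  rw [nsq_rep, nsq_rep] at this
  unfold chord
  nlinarith [sq_nonneg ‖herm (rep x) (rep y)‖, norm_nonneg (wedge (rep x) (rep y))]

theorem chord_eq_div {x y : OnePoint ℂ} {X Y : ℂ × ℂ} (hX : X ≠ 0) (hx : wedge X (rep x) = 0)
    (hY : Y ≠ 0) (hy : wedge Y (rep y) = 0) : chord x y = ‖wedge X Y‖ / (√(nsq X) * √(nsq Y)) := by
  have e1 := eq_smul_of_wedge_eq_zero (nsq_rep x) hx
  have e2 := eq_smul_of_wedge_eq_zero (nsq_rep y) hy
  generalize herm X (rep x) = c at e1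
  generalize herm Y (rep y) = d at e2
  have hc : c ≠ 0 := fun h => hX (by rw [e1, h, zero_smul])
  have hd : d ≠ 0 := fun h => hY (by rw [e2, h, zero_smul])
  rw [e1, e2, nsq_smul, nsq_smul, nsq_rep, nsq_rep, wedge_smul_left, wedge_smul_right, chord]
  simp only [mul_one, Real.sqrt_sq (norm_nonneg _), norm_mul]
  field_simp [norm_ne_zero_iff.2 hc, norm_ne_zero_iff.2 hd]

/-- The triangle inequality for the chordal distance. -/
theorem chord_triangle (x y z : OnePoint ℂ) : chord x y ≤ chord z x + chord z y := by
  -- `(x ∧ y) z = (z ∧ y) x - (z ∧ x) y`, tested against a vector `t` with `z ∧ t = 1`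
  set t : ℂ × ℂ := (-starRingEnd ℂ (rep z).2, starRingEnd ℂ (rep z).1) with ht
  have h1 : wedge (rep z) t = 1 := by
    have := congrArg Complex.ofReal (nsq_rep z)
    rw [nsq, Complex.ofReal_add, norm_sq_eq_mul_conj, norm_sq_eq_mul_conj] at this
    simp only [wedge, ht]
    push_cast at this
    linear_combination this
  have hnt : nsq t = 1 := by
    rw [← nsq_rep z, nsq, nsq]; simp only [ht, norm_neg, RCLike.norm_conj]; ring
  have hb : ∀ u : OnePoint ℂ, ‖wedge (rep u) t‖ ≤ 1 := by
    intro u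
    have := norm_wedge_sq_add (rep u) t
    rw [nsq_rep, hnt] at this
    nlinarith [sq_nonneg ‖herm (rep u) t‖, norm_nonneg (wedge (rep u) t)]
  have h2 := wedge_mul_wedge (rep x) (rep y) (rep z) t
  rw [h1, mul_one] at h2
  unfold chord
  rw [h2, wedge_swap (rep x) (rep z), wedge_swap (rep y) (rep z)]
  refine (norm_sub_le _ _).trans ?_
  simp only [norm_mul, norm_neg]
  gcongr
  · exact mul_le_of_le_one_right (norm_nonneg _) (hb y)
  · exact mul_le_of_le_one_left (norm_nonneg _) (hb x)

/-- `F : ℂ → ℂ²` is a holomorphic family of homogeneous coordinates of the sphere-valued map `f`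
near `w`. -/
def LiftAt (F : ℂ → ℂ × ℂ) (f : ℂ → OnePoint ℂ) (w : ℂ) : Prop :=
  AnalyticAt ℂ F w ∧ ∀ᶠ z in 𝓝 w, F z ≠ 0 ∧ wedge (F z) (rep (f z)) = 0

/-- The derivative of a sphere-valued map with respect to the chordal distance; for a meromorphic
function this is `|f'| / (1 + |f|²)`. -/
def sphDeriv (f : ℂ → OnePoint ℂ) (w : ℂ) : ℝ :=
  limUnder (𝓝[≠] w) fun z => chord (f z) (f w) / ‖z - w‖

/-- The Wronskian `F ∧ F'`; it vanishes where the sphere-valued map with homogeneous coordinates `F`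
has derivative zero. -/
def wronskian (F : ℂ → ℂ × ℂ) (w : ℂ) : ℂ := wedge (F w) (deriv F w)

theorem analyticAt_wedge {F G : ℂ → ℂ × ℂ} {w : ℂ} (hF : AnalyticAt ℂ F w)
    (hG : AnalyticAt ℂ G w) : AnalyticAt ℂ (fun z => wedge (F z) (G z)) w := by
  exact ((analyticAt_fst.comp hF).mul (analyticAt_snd.comp hG)).sub
    ((analyticAt_snd.comp hF).mul (analyticAt_fst.comp hG))

theorem analyticAt_wronskian {F : ℂ → ℂ × ℂ} {w : ℂ} (hF : AnalyticAt ℂ F w) :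
    AnalyticAt ℂ (wronskian F) w := analyticAt_wedge hF hF.deriv

theorem hasDerivAt_wedge {F : ℂ → ℂ × ℂ} {w : ℂ} {F' : ℂ × ℂ} (hF : HasDerivAt F F' w)
    (a : ℂ × ℂ) : HasDerivAt (fun z => wedge (F z) a) (wedge F' a) w := by
  have h1 : HasDerivAt (fun z => (F z).1) F'.1 w := hF.fst
  have h2 : HasDerivAt (fun z => (F z).2) F'.2 w := hF.snd
  exact (h1.mul_const a.2).sub (h2.mul_const a.1)

theorem continuousAt_nsq {F : ℂ → ℂ × ℂ} {w : ℂ} (hF : ContinuousAt F w) :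
    ContinuousAt (fun z => nsq (F z)) w := by
  unfold nsq
  fun_prop

namespace LiftAt

variable {F G : ℂ → ℂ × ℂ} {f g : ℂ → OnePoint ℂ} {w : ℂ}

theorem analyticAt (h : LiftAt F f w) : AnalyticAt ℂ F w := h.1

theorem ne_zero (h : LiftAt F f w) : F w ≠ 0 := h.2.self_of_nhds.1

theorem wedge_eq_zero (h : LiftAt F f w) : wedge (F w) (rep (f w)) = 0 := h.2.self_of_nhds.2

theorem eventually (h : LiftAt F f w) : ∀ᶠ z in 𝓝 w, LiftAt F f z := by
  filter_upwards [h.1.eventually_analyticAt, h.2.eventually_nhds] with z h1 h2 using ⟨h1, h2⟩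

theorem nsq_pos (h : LiftAt F f w) : 0 < nsq (F w) := _root_.nsq_pos h.ne_zero

theorem congr (h : LiftAt F f w) (hfg : g =ᶠ[𝓝 w] f) : LiftAt F g w :=
  ⟨h.1, by filter_upwards [h.2, hfg] with z hz h'; rwa [h']⟩

theorem chord_eq (hF : LiftAt F f w) (hG : LiftAt G g w) :
    chord (f w) (g w) = ‖wedge (F w) (G w)‖ / (√(nsq (F w)) * √(nsq (G w))) :=
  chord_eq_div hF.ne_zero hF.wedge_eq_zero hG.ne_zero hG.wedge_eq_zero

theorem chord_const_eq (hF : LiftAt F f w) (y : OnePoint ℂ) :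
    chord (f w) y = ‖wedge (F w) (rep y)‖ / √(nsq (F w)) := by
  rw [chord_eq_div hF.ne_zero hF.wedge_eq_zero (rep_ne_zero y) (wedge_self _), nsq_rep]
  simp

theorem eq_iff (hF : LiftAt F f w) (hG : LiftAt G g w) :
    f w = g w ↔ wedge (F w) (G w) = 0 := by
  rw [← chord_eq_zero_iff, hF.chord_eq hG, div_eq_zero_iff, norm_eq_zero]
  have h1 := Real.sqrt_pos.2 hF.nsq_pos
  have h2 := Real.sqrt_pos.2 hG.nsq_pos
  exact or_iff_left (by positivity)

theorem eq_const_iff (hF : LiftAt F f w) (y : OnePoint ℂ) :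
    f w = y ↔ wedge (F w) (rep y) = 0 := by
  rw [← chord_eq_zero_iff, hF.chord_const_eq, div_eq_zero_iff, norm_eq_zero]
  have h1 := Real.sqrt_pos.2 hF.nsq_pos
  exact or_iff_left (by positivity)

theorem sphDeriv_eq (hF : LiftAt F f w) :
    sphDeriv f w = ‖wronskian F w‖ / nsq (F w) := by
  have hd := hasDerivAt_wedge hF.analyticAt.differentiableAt.hasDerivAt (F w)
  have h1 := hd.tendsto_slope.norm
  have hcont : Tendsto (fun z => √(nsq (F z)) * √(nsq (F w))) (𝓝[≠] w)
      (𝓝 (√(nsq (F w)) * √(nsq (F w)))) := by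
    refine Tendsto.mono_left ?_ nhdsWithin_le_nhds
    exact ((continuousAt_nsq hF.analyticAt.continuousAt).sqrt).mul continuousAt_const
  rw [Real.mul_self_sqrt hF.nsq_pos.le] at hcont
  have h2 := h1.div hcont hF.nsq_pos.ne'
  have h3 : ‖wedge (deriv F w) (F w)‖ = ‖wronskian F w‖ := by
    rw [wedge_swap, norm_neg]; rfl
  rw [h3] at h2
  apply Tendsto.limUnder_eq
  refine h2.congr' ?_
  filter_upwards [self_mem_nhdsWithin, nhdsWithin_le_nhds hF.eventually] with z hz hFz
  simp only [Pi.div_apply]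
  rw [chord_eq_div hFz.ne_zero hFz.wedge_eq_zero hF.ne_zero hF.wedge_eq_zero, slope_def_module,
    wedge_self, sub_zero, norm_smul, norm_inv]
  ring

/-- Lifts pull back under holomorphic changes of the variable. -/
theorem comp {h : ℂ → ℂ} (hF : LiftAt F f (h w)) (hh : AnalyticAt ℂ h w) :
    LiftAt (F ∘ h) (f ∘ h) w :=
  ⟨hF.1.comp hh, hh.continuousAt.eventually hF.2⟩

theorem wronskian_comp {h : ℂ → ℂ} (hF : LiftAt F f (h w)) (hh : AnalyticAt ℂ h w) :
    wronskian (F ∘ h) w = deriv h w * wronskian F (h w) := by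
  have : deriv (F ∘ h) w = deriv h w • deriv F (h w) :=
    deriv.scomp w hF.1.differentiableAt hh.differentiableAt
  rw [wronskian, this, wedge_smul_right]; rfl

theorem sphDeriv_comp {h : ℂ → ℂ} (hF : LiftAt F f (h w)) (hh : AnalyticAt ℂ h w) :
    sphDeriv (f ∘ h) w = sphDeriv f (h w) * ‖deriv h w‖ := by
  rw [(hF.comp hh).sphDeriv_eq, hF.sphDeriv_eq, hF.wronskian_comp hh, norm_mul]
  simp only [Function.comp]
  ring

end LiftAt

/-- A nonvanishing holomorphic function has a local logarithm. -/
theorem exists_exp_eq {H : ℂ → ℂ} {w : ℂ} (hH : AnalyticAt ℂ H w) (h0 : H w ≠ 0) :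
    ∃ k : ℂ → ℂ, AnalyticAt ℂ k w ∧ ∀ᶠ z in 𝓝 w, H z = Complex.exp (k z) := by
  refine ⟨fun z => Complex.log (H z / H w) + Complex.log (H w), ?_, ?_⟩
  · refine AnalyticAt.add (AnalyticAt.clog (hH.div analyticAt_const h0) ?_) analyticAt_const
    simp [div_self h0]
  · filter_upwards [hH.continuousAt.eventually_ne h0] with z hz
    rw [Complex.exp_add, Complex.exp_log (div_ne_zero hz h0), Complex.exp_log h0,
      div_mul_cancel₀ _ h0]

/-- `∂∂̄ log |F|² = (f*)²`. -/
theorem hasExp2_log_nsq {F : ℂ → ℂ × ℂ} {w : ℂ} (hF : AnalyticAt ℂ F w) (h0 : F w ≠ 0) :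
    HasExp2 (fun z => Real.log (nsq (F z))) w (2 * herm (deriv F w) (F w) / nsq (F w))
      (‖wronskian F w‖ ^ 2 / nsq (F w) ^ 2) := by
  have hpos := nsq_pos h0
  have hd := hF.differentiableAt.hasDerivAt
  have d1 : deriv (fun z => (F z).1) w = (deriv F w).1 :=
    HasDerivAt.deriv (f := fun z => (F z).1) hd.fst
  have d2 : deriv (fun z => (F z).2) w = (deriv F w).2 :=
    HasDerivAt.deriv (f := fun z => (F z).2) hd.snd
  have h1 := HasExp2.norm_sq_analytic (k := fun z => (F z).1) (analyticAt_fst.comp hF)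
  have h2 := HasExp2.norm_sq_analytic (k := fun z => (F z).2) (analyticAt_snd.comp hF)
  rw [d1] at h1
  rw [d2] at h2
  have h3 : HasExp2 (fun z => nsq (F z)) w (2 * herm (deriv F w) (F w)) (nsq (deriv F w)) := by
    convert h1.add h2 using 1
    · rfl
    · unfold herm; ring
    · rfl
  convert h3.log hpos.ne' using 1
  · push_cast; field_simp
  · have := norm_wedge_sq_add (deriv F w) (F w)
    rw [wedge_swap, norm_neg] at this
    simp only [wronskian, norm_mul, Complex.norm_ofNat]
    field_simp
    linear_combination 4 * this

/-- The Laplacian of a power of the chordal distance of `f` to a point. For `0 < η < 1` it is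
unbounded from above near that point, while the function itself is bounded. -/
theorem hasExp2_chord_rpow {F : ℂ → ℂ × ℂ} {f : ℂ → OnePoint ℂ} {w : ℂ} (hF : LiftAt F f w)
    {y : OnePoint ℂ} (hy : f w ≠ y) (η : ℝ) :
    ∃ b, HasExp2 (fun z => chord (f z) y ^ (2 * η)) w b
      (sphDeriv f w ^ 2 * (η ^ 2 * chord (f w) y ^ (2 * η - 2)
        - (η + η ^ 2) * chord (f w) y ^ (2 * η))) := by
  set a := rep y with ha
  have hH : AnalyticAt ℂ (fun z => wedge (F z) a) w := analyticAt_wedge hF.analyticAt analyticAt_const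
  have hH0 : wedge (F w) a ≠ 0 := fun h => hy ((hF.eq_const_iff y).2 h)
  obtain ⟨k, hk, hke⟩ := exists_exp_eq hH hH0
  -- the logarithmic derivative of `F ∧ a`
  have hdk : deriv k w = wedge (deriv F w) a / wedge (F w) a := by
    have e1 := (hasDerivAt_wedge hF.analyticAt.differentiableAt.hasDerivAt a)
    have e2 : HasDerivAt (fun z => Complex.exp (k z)) (Complex.exp (k w) * deriv k w) w :=
      hk.differentiableAt.hasDerivAt.cexp
    have e3 := (e2.congr_of_eventuallyEq hke).unique e1
    rw [← hke.self_of_nhds] at e3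
    field_simp
    linear_combination e3
  have hN := hasExp2_log_nsq hF.analyticAt hF.ne_zero
  have hsum := (((HasExp2.re_analytic hk).const_mul 2).add (hN.const_mul (-1))).const_mul η
  have hexp := hsum.exp
  have hcpos : ∀ᶠ z in 𝓝 w, chord (f z) y ^ (2 * η) =
      Real.exp (η * (2 * (k z).re + -1 * Real.log (nsq (F z)))) := by
    filter_upwards [hF.eventually, hke] with z hz hkz
    have hn := hz.nsq_pos
    have hc : chord (f z) y = Real.exp ((k z).re - Real.log (nsq (F z)) / 2) := by
      rw [hz.chord_const_eq, ← ha, hkz, Complex.norm_exp, Real.exp_sub, ← Real.log_sqrt hn.le,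
        Real.exp_log (Real.sqrt_pos.2 hn)]
    rw [hc, ← Real.exp_mul]
    ring_nf
  have hc0 : chord (f w) y ≠ 0 := fun h => hy (chord_eq_zero_iff.1 h)
  have hcp : 0 < chord (f w) y := lt_of_le_of_ne (chord_nonneg _ _) hc0.symm
  suffices h : Real.exp (η * (2 * (k w).re + -1 * Real.log (nsq (F w)))) *
      (η * (2 * 0 + -1 * (‖wronskian F w‖ ^ 2 / nsq (F w) ^ 2)) +
        ‖(η : ℂ) * (((2 : ℝ) : ℂ) * deriv k w
          + ((-1 : ℝ) : ℂ) * (2 * herm (deriv F w) (F w) / nsq (F w)))‖ ^ 2 / 4)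
      = sphDeriv f w ^ 2 * (η ^ 2 * chord (f w) y ^ (2 * η - 2)
        - (η + η ^ 2) * chord (f w) y ^ (2 * η)) from ⟨_, h ▸ hexp.congr hcpos⟩
  rw [← hcpos.self_of_nhds]
  have hn := hF.nsq_pos
  -- `|∂ log s|² = f*² (1 - s) / s` for `s = chord²`
  have key : ‖deriv k w - herm (deriv F w) (F w) / nsq (F w)‖ ^ 2
      = sphDeriv f w ^ 2 * (1 / chord (f w) y ^ 2 - 1) := by
    have hnC : (nsq (F w) : ℂ) ≠ 0 := by exact_mod_cast hn.ne'
    have hn' : (nsq (F w) : ℂ) = (F w).1 * starRingEnd ℂ (F w).1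
        + (F w).2 * starRingEnd ℂ (F w).2 := by
      rw [nsq, Complex.ofReal_add, norm_sq_eq_mul_conj, norm_sq_eq_mul_conj]
    have e1 : deriv k w - herm (deriv F w) (F w) / nsq (F w)
        = -(wronskian F w * starRingEnd ℂ (herm (F w) a)) / (wedge (F w) a * nsq (F w)) := by
      rw [hdk, div_sub_div _ _ hH0 hnC]
      congr 1
      rw [hn']
      simp only [wronskian, herm, wedge, map_add, map_mul, Complex.conj_conj]
      ring
    have hL := norm_wedge_sq_add (F w) a
    rw [ha, nsq_rep, mul_one, ← ha] at hL
    have hA : 0 < ‖wedge (F w) a‖ := norm_pos_iff.2 hH0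
    rw [e1, hF.sphDeriv_eq, hF.chord_const_eq, ← ha, norm_div, norm_neg, norm_mul, norm_mul,
      RCLike.norm_conj, Complex.norm_real, Real.norm_of_nonneg hn.le, div_pow, div_pow,
      div_pow, Real.sq_sqrt hn.le]
    field_simp
    linear_combination ‖wronskian F w‖ ^ 2 * hL
  have hb : ‖((η : ℝ) : ℂ) * (((2 : ℝ) : ℂ) * deriv k w
      + ((-1 : ℝ) : ℂ) * (2 * herm (deriv F w) (F w) / nsq (F w)))‖ ^ 2 / 4
      = η ^ 2 * (sphDeriv f w ^ 2 * (1 / chord (f w) y ^ 2 - 1)) := by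
    rw [← key]
    have : ((η : ℝ) : ℂ) * (((2 : ℝ) : ℂ) * deriv k w
      + ((-1 : ℝ) : ℂ) * (2 * herm (deriv F w) (F w) / nsq (F w)))
      = (2 * η : ℝ) * (deriv k w - herm (deriv F w) (F w) / nsq (F w)) := by
      push_cast; ring
    rw [this, norm_mul, Complex.norm_real, mul_pow, Real.norm_eq_abs, sq_abs]
    ring
  rw [hb, hF.sphDeriv_eq, Real.rpow_sub hcp, Real.rpow_two, div_pow]
  field_simp
  ring

/-! ### The density of a pair of maps sharing values -/

/-- Near `w` the function is the modulus of a nonvanishing holomorphic function. -/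
def LogHol (u : ℂ → ℝ) (w : ℂ) : Prop :=
  ∃ k : ℂ → ℂ, AnalyticAt ℂ k w ∧ ∀ᶠ z in 𝓝 w, u z = Real.exp (k z).re

/-- Near `w`, but possibly not at `w`, the function is `|z - w|^ν` times the modulus of
a nonvanishing holomorphic function. -/
def HasOrd (u : ℂ → ℝ) (w : ℂ) (ν : ℝ) : Prop :=
  ∃ k : ℂ → ℂ, AnalyticAt ℂ k w ∧ ∀ᶠ z in 𝓝[≠] w, u z = ‖z - w‖ ^ ν * Real.exp (k z).re

section

variable {u v : ℂ → ℝ} {w : ℂ} {μ ν : ℝ}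

theorem LogHol.congr (hu : LogHol u w) (h : v =ᶠ[𝓝 w] u) : LogHol v w := by
  obtain ⟨k, hk, hu⟩ := hu
  exact ⟨k, hk, by filter_upwards [hu, h] with z h1 h2; rw [h2, h1]⟩

theorem HasOrd.congr (hu : HasOrd u w ν) (h : v =ᶠ[𝓝[≠] w] u) : HasOrd v w ν := by
  obtain ⟨k, hk, hu⟩ := hu
  exact ⟨k, hk, by filter_upwards [hu, h] with z h1 h2; rw [h2, h1]⟩

theorem LogHol.hasOrd (hu : LogHol u w) : HasOrd u w 0 := by
  obtain ⟨k, hk, hu⟩ := hu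
  exact ⟨k, hk, by filter_upwards [nhdsWithin_le_nhds hu] with z h1; simp [h1]⟩

theorem LogHol.mul (hu : LogHol u w) (hv : LogHol v w) : LogHol (fun z => u z * v z) w := by
  obtain ⟨k, hk, hu⟩ := hu
  obtain ⟨l, hl, hv⟩ := hv
  refine ⟨_, hk.add hl, ?_⟩
  filter_upwards [hu, hv] with z h1 h2
  rw [h1, h2, ← Real.exp_add]; rfl

theorem LogHol.rpow (hu : LogHol u w) (p : ℝ) : LogHol (fun z => u z ^ p) w := by
  obtain ⟨k, hk, hu⟩ := hu
  refine ⟨_, (analyticAt_const (v := (p : ℂ))).mul hk, ?_⟩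
  filter_upwards [hu] with z h1
  rw [h1, ← Real.exp_mul, Pi.mul_apply, Complex.re_ofReal_mul, mul_comm]

theorem LogHol.const {c : ℝ} (hc : 0 < c) : LogHol (fun _ => c) w :=
  ⟨fun _ => Real.log c, analyticAt_const, by simp [Real.exp_log hc]⟩

theorem LogHol.prod {ι : Type*} (s : Finset ι) {u : ι → ℂ → ℝ} (h : ∀ i ∈ s, LogHol (u i) w) :
    LogHol (fun z => ∏ i ∈ s, u i z) w := by
  classical
  induction s using Finset.induction_on with
  | empty => simpa using LogHol.const one_pos
  | insert i s hi ih =>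
    simp only [Finset.prod_insert hi]
    exact (h i (by simp)).mul (ih fun j hj => h j (by simp [hj]))

theorem LogHol.norm {H : ℂ → ℂ} (hH : AnalyticAt ℂ H w) (h0 : H w ≠ 0) :
    LogHol (fun z => ‖H z‖) w := by
  obtain ⟨k, hk, h⟩ := exists_exp_eq hH h0
  exact ⟨k, hk, by filter_upwards [h] with z hz; rw [hz, Complex.norm_exp]⟩

theorem LogHol.pos (hu : LogHol u w) : ∀ᶠ z in 𝓝 w, 0 < u z := by
  obtain ⟨k, hk, hu⟩ := hu
  filter_upwards [hu] with z h1
  rw [h1]; positivity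

theorem LogHol.continuousAt (hu : LogHol u w) : ContinuousAt u w := by
  obtain ⟨k, hk, hu⟩ := hu
  refine ContinuousAt.congr ?_ (EventuallyEq.symm hu)
  exact (Complex.continuous_re.continuousAt.comp hk.continuousAt).rexp

theorem HasOrd.mul (hu : HasOrd u w μ) (hv : HasOrd v w ν) :
    HasOrd (fun z => u z * v z) w (μ + ν) := by
  obtain ⟨k, hk, hu⟩ := hu
  obtain ⟨l, hl, hv⟩ := hv
  refine ⟨_, hk.add hl, ?_⟩
  filter_upwards [hu, hv, self_mem_nhdsWithin] with z h1 h2 hz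
  have : 0 < ‖z - w‖ := norm_pos_iff.2 (sub_ne_zero.2 hz)
  rw [h1, h2, Real.rpow_add this, Pi.add_apply, Complex.add_re, Real.exp_add]
  ring

theorem HasOrd.rpow (hu : HasOrd u w μ) (p : ℝ) : HasOrd (fun z => u z ^ p) w (μ * p) := by
  obtain ⟨k, hk, hu⟩ := hu
  refine ⟨_, (analyticAt_const (v := (p : ℂ))).mul hk, ?_⟩
  filter_upwards [hu] with z h1
  rw [h1, Real.mul_rpow (by positivity) (by positivity), ← Real.rpow_mul (norm_nonneg _),
    ← Real.exp_mul, Pi.mul_apply, Complex.re_ofReal_mul, mul_comm p]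

theorem HasOrd.prod {ι : Type*} (s : Finset ι) {u : ι → ℂ → ℝ} {ν : ι → ℝ}
    (h : ∀ i ∈ s, HasOrd (u i) w (ν i)) : HasOrd (fun z => ∏ i ∈ s, u i z) w (∑ i ∈ s, ν i) := by
  classical
  induction s using Finset.induction_on with
  | empty => simpa using (LogHol.const one_pos).hasOrd
  | insert i s hi ih =>
    simp only [Finset.prod_insert hi, Finset.sum_insert hi]
    exact (h i (by simp)).mul (ih fun j hj => h j (by simp [hj]))

theorem HasOrd.tendsto (hu : HasOrd u w ν) (hν : 0 < ν) : Tendsto u (𝓝[≠] w) (𝓝 0) := by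
  obtain ⟨k, hk, hu⟩ := hu
  have h1 : Tendsto (fun z => ‖z - w‖ ^ ν * Real.exp (k z).re) (𝓝[≠] w) (𝓝 0) := by
    refine Tendsto.mono_left ?_ nhdsWithin_le_nhds
    have h2 : ContinuousAt (fun z => ‖z - w‖ ^ ν * Real.exp (k z).re) w := by
      refine ContinuousAt.mul (ContinuousAt.rpow_const (by fun_prop) (Or.inr hν.le)) ?_
      exact (Complex.continuous_re.continuousAt.comp hk.continuousAt).rexp
    simpa [Real.zero_rpow hν.ne'] using h2.tendsto
  exact h1.congr' (by filter_upwards [hu] with z hz; rw [hz])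

theorem exists_eq_pow_mul {H : ℂ → ℂ} (hH : AnalyticAt ℂ H w) (h0 : ¬ ∀ᶠ z in 𝓝 w, H z = 0) :
    ∃ (n : ℕ) (h : ℂ → ℂ), AnalyticAt ℂ h w ∧ h w ≠ 0 ∧ (∀ᶠ z in 𝓝 w, H z = (z - w) ^ n * h z) ∧
      (n = 0 ↔ H w ≠ 0) := by
  obtain ⟨n, h, ha, hne, he⟩ := hH.exists_eventuallyEq_pow_smul_nonzero_iff.2 h0
  refine ⟨n, h, ha, hne, he, ?_⟩
  rw [he.self_of_nhds]
  rcases Nat.eq_zero_or_pos n with rfl | hn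
  · simpa using hne
  · simp [hn.ne']

theorem HasOrd.of_eq_pow_mul {H h : ℂ → ℂ} {n : ℕ} (hh : AnalyticAt ℂ h w) (h0 : h w ≠ 0)
    (he : ∀ᶠ z in 𝓝 w, H z = (z - w) ^ n * h z) : HasOrd (fun z => ‖H z‖) w n := by
  obtain ⟨k, hk, hk'⟩ := LogHol.norm hh h0
  refine ⟨k, hk, ?_⟩
  filter_upwards [nhdsWithin_le_nhds he, nhdsWithin_le_nhds hk'] with z h1 h2
  rw [h1, norm_mul, h2, norm_pow, Real.rpow_natCast]

theorem HasOrd.norm {H : ℂ → ℂ} (hH : AnalyticAt ℂ H w) (h0 : ¬ ∀ᶠ z in 𝓝 w, H z = 0) :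
    ∃ n : ℕ, HasOrd (fun z => ‖H z‖) w n ∧ (n = 0 ↔ H w ≠ 0) := by
  obtain ⟨n, h, ha, hne, he, hn⟩ := exists_eq_pow_mul hH h0
  exact ⟨n, .of_eq_pow_mul ha hne he, hn⟩

end

section wronskian

variable {F G : ℂ → ℂ × ℂ} {w : ℂ}

/-- If `F ∧ a` vanishes at `w` to order `n`, then the Wronskian of `F` vanishes to order `n - 1`. -/
theorem hasOrd_wronskian (hF : AnalyticAt ℂ F w) (hF0 : F w ≠ 0) {a : ℂ × ℂ} (ha : nsq a = 1)
    (h0 : wedge (F w) a = 0) (hne : ¬ ∀ᶠ z in 𝓝 w, wedge (F z) a = 0) :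
    ∃ n : ℕ, 1 ≤ n ∧ HasOrd (fun z => ‖wedge (F z) a‖) w n ∧
      HasOrd (fun z => ‖wronskian F z‖) w ((n : ℝ) - 1) := by
  have hA := analyticAt_wedge hF (analyticAt_const (v := a))
  obtain ⟨n, h, hh, hh0, he, hn⟩ := exists_eq_pow_mul hA hne
  have hn1 : 1 ≤ n := Nat.one_le_iff_ne_zero.2 fun h' => hn.1 h' h0
  refine ⟨n, hn1, .of_eq_pow_mul hh hh0 he, ?_⟩
  obtain ⟨n, rfl⟩ : ∃ m, n = m + 1 := ⟨n - 1, by omega⟩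
  -- a second vector `b` with `a ∧ b = 1`
  set b : ℂ × ℂ := (-starRingEnd ℂ a.2, starRingEnd ℂ a.1) with hb
  have hab : wedge a b = 1 := by
    have := congrArg Complex.ofReal ha
    rw [nsq, Complex.ofReal_add, norm_sq_eq_mul_conj, norm_sq_eq_mul_conj] at this
    simp only [wedge, hb]
    push_cast at this
    linear_combination this
  have hB := analyticAt_wedge hF (analyticAt_const (v := b))
  have hB0 : wedge (F w) b ≠ 0 := by
    have e := eq_smul_of_wedge_eq_zero ha h0
    rw [e, wedge_smul_left, hab, mul_one]
    intro h'
    exact hF0 (by rw [e, h', zero_smul])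
  set B := fun z => wedge (F z) b
  set r : ℂ → ℂ := fun z =>
    (z - w) * (h z * deriv B z - B z * deriv h z) - (n + 1) * (B z * h z) with hr
  have hra : AnalyticAt ℂ r w := by
    have : AnalyticAt ℂ (fun z : ℂ => z - w) w := analyticAt_id.sub analyticAt_const
    exact (this.mul ((hh.mul hB.deriv).sub (hB.mul hh.deriv))).sub
      (analyticAt_const.mul (hB.mul hh))
  have hr0 : r w ≠ 0 := by
    simp only [hr, sub_self, zero_mul, zero_sub]
    exact neg_ne_zero.2 (mul_ne_zero (by exact_mod_cast n.succ_ne_zero) (mul_ne_zero hB0 hh0))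
  have hcast : (((n + 1 : ℕ) : ℝ) - 1) = n := by push_cast; ring
  rw [hcast]
  refine .of_eq_pow_mul hra hr0 ?_
  filter_upwards [he.eventually_nhds, hF.eventually_analyticAt, hh.eventually_analyticAt]
    with z hez hFz hhz
  have hFd := hFz.differentiableAt.hasDerivAt
  have e1 : wedge (deriv F z) a = (n + 1) * (z - w) ^ n * h z + (z - w) ^ (n + 1) * deriv h z := by
    have e2 := hasDerivAt_wedge hFd a
    have e3 : HasDerivAt (fun y => (y - w) ^ (n + 1) * h y) _ z :=
      (((hasDerivAt_id z).sub_const w).pow (n + 1)).mul hhz.differentiableAt.hasDerivAt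
    rw [(e2.congr_of_eventuallyEq (EventuallyEq.symm hez)).unique e3]
    simp
  have e2 : deriv B z = wedge (deriv F z) b := (hasDerivAt_wedge hFd b).deriv
  have e4 := wedge_mul_wedge (F z) (deriv F z) a b
  rw [hab, mul_one] at e4
  rw [wronskian, e4, hez.self_of_nhds, e1, hr]
  simp only [e2]
  ring

theorem wronskian_eventually_zero (hF : AnalyticAt ℂ F w) {a : ℂ × ℂ} (ha : nsq a = 1)
    (h : ∀ᶠ z in 𝓝 w, wedge (F z) a = 0) : ∀ᶠ z in 𝓝 w, wronskian F z = 0 := by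
  filter_upwards [h.eventually_nhds, hF.eventually_analyticAt] with z hz hFz
  have e1 : wedge (deriv F z) a = 0 := by
    have e2 := hasDerivAt_wedge hFz.differentiableAt.hasDerivAt a
    exact (e2.congr_of_eventuallyEq (f₁ := fun _ => (0 : ℂ)) (EventuallyEq.symm hz)).unique
      (hasDerivAt_const z 0)
  rw [wronskian, eq_smul_of_wedge_eq_zero ha hz.self_of_nhds, eq_smul_of_wedge_eq_zero ha e1,
    wedge_smul_left, wedge_smul_right, wedge_self]
  simp

end wronskian

/-- The density built from two sphere-valued maps `f`, `g` sharing the values in `A`: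
`|f,g| ∏ |f,α|^{-(1-e)(1-D)} ∏ |g,α|^{-(1-e)D} (f*)^{1-D} (g*)^D`, where `|·,·|` is the chordal
distance and `f*`, `g*` are the spherical derivatives. As `0` to a nonzero power is `0`, it takes
the value `0` where `f` takes a value in `A`; this is also its limit there. -/
def dens (A : Finset (OnePoint ℂ)) (e D : ℝ) (f g : ℂ → OnePoint ℂ) (w : ℂ) : ℝ :=
  chord (f w) (g w) * (∏ α ∈ A, chord (f w) α) ^ (-((1 - e) * (1 - D))) *
    (∏ α ∈ A, chord (g w) α) ^ (-((1 - e) * D)) * sphDeriv f w ^ (1 - D) * sphDeriv g w ^ D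

/-- The factor of `dens` whose logarithm is harmonic off its zeros and poles, in terms of
homogeneous coordinates. -/
def densHol (A : Finset (OnePoint ℂ)) (e D : ℝ) (F G : ℂ → ℂ × ℂ) (w : ℂ) : ℝ :=
  ‖wedge (F w) (G w)‖ * (∏ α ∈ A, ‖wedge (F w) (rep α)‖) ^ (-((1 - e) * (1 - D))) *
    (∏ α ∈ A, ‖wedge (G w) (rep α)‖) ^ (-((1 - e) * D)) *
      ‖wronskian F w‖ ^ (1 - D) * ‖wronskian G w‖ ^ D

/-- The exponent of `|F|²` in `dens`. -/
def densExp (A : Finset (OnePoint ℂ)) (e D : ℝ) : ℝ :=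
  (A.card * (1 - e) * D - 2 * D - 1) / 2

section dens

variable {A : Finset (OnePoint ℂ)} {e D : ℝ} {F G : ℂ → ℂ × ℂ} {f g : ℂ → OnePoint ℂ} {w : ℂ}

theorem LiftAt.sphDeriv_nonneg (hF : LiftAt F f w) : 0 ≤ sphDeriv f w := by
  rw [hF.sphDeriv_eq]
  exact div_nonneg (norm_nonneg _) (nsq_nonneg _)

theorem dens_nonneg (hF : LiftAt F f w) (hG : LiftAt G g w) : 0 ≤ dens A e D f g w := by
  have h1 := hF.sphDeriv_nonneg
  have h2 := hG.sphDeriv_nonneg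
  have h3 := chord_nonneg (f w) (g w)
  have h4 : 0 ≤ ∏ α ∈ A, chord (f w) α := Finset.prod_nonneg fun α _ => chord_nonneg _ α
  have h5 : 0 ≤ ∏ α ∈ A, chord (g w) α := Finset.prod_nonneg fun α _ => chord_nonneg _ α
  unfold dens
  positivity

theorem LiftAt.dens_eq (hF : LiftAt F f w) (hG : LiftAt G g w) :
    dens A e D f g w = densHol A e D F G w *
      (nsq (F w) ^ densExp A e (1 - D) * nsq (G w) ^ densExp A e D) := by
  have hf := hF.nsq_pos
  have hg := hG.nsq_pos
  have prod_eq : ∀ {F : ℂ → ℂ × ℂ} {f : ℂ → OnePoint ℂ} (p : ℝ), LiftAt F f w →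
      (∏ α ∈ A, chord (f w) α) ^ p
        = (∏ α ∈ A, ‖wedge (F w) (rep α)‖) ^ p * nsq (F w) ^ (-(A.card * p) / 2) := by
    intro F f p hF
    have : ∏ α ∈ A, chord (f w) α = (∏ α ∈ A, ‖wedge (F w) (rep α)‖) *
        nsq (F w) ^ (-(A.card : ℝ) / 2) := by
      simp only [hF.chord_const_eq, Finset.prod_div_distrib, Finset.prod_const]
      rw [div_eq_mul_inv, Real.sqrt_eq_rpow, ← Real.rpow_natCast, ← Real.rpow_mul hF.nsq_pos.le,
        ← Real.rpow_neg hF.nsq_pos.le]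
      ring_nf
    rw [this, Real.mul_rpow (Finset.prod_nonneg fun _ _ => norm_nonneg _)
      (Real.rpow_nonneg hF.nsq_pos.le _), ← Real.rpow_mul hF.nsq_pos.le]
    ring_nf
  rw [dens, densHol, prod_eq _ hF, prod_eq _ hG, hF.chord_eq hG, hF.sphDeriv_eq, hG.sphDeriv_eq,
    Real.div_rpow (norm_nonneg _) hf.le, Real.div_rpow (norm_nonneg _) hg.le, Real.sqrt_eq_rpow,
    Real.sqrt_eq_rpow]
  have e1 : nsq (F w) ^ densExp A e (1 - D) = nsq (F w) ^ (-(A.card * (-((1 - e) * (1 - D)))) / 2)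
      / (nsq (F w) ^ (1 / 2 : ℝ) * nsq (F w) ^ (1 - D)) := by
    rw [← Real.rpow_add hf, ← Real.rpow_sub hf, densExp]; ring_nf
  have e2 : nsq (G w) ^ densExp A e D = nsq (G w) ^ (-(A.card * (-((1 - e) * D))) / 2)
      / (nsq (G w) ^ (1 / 2 : ℝ) * nsq (G w) ^ D) := by
    rw [← Real.rpow_add hg, ← Real.rpow_sub hg, densExp]; ring_nf
  rw [e1, e2]
  field_simp

/-- Transformation rule of `dens` under holomorphic changes of the variable. -/
theorem LiftAt.dens_comp {h : ℂ → ℂ} (hF : LiftAt F f (h w)) (hG : LiftAt G g (h w))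
    (hh : AnalyticAt ℂ h w) (hD0 : 0 < D) (hD1 : D < 1) :
    dens A e D (f ∘ h) (g ∘ h) w = dens A e D f g (h w) * ‖deriv h w‖ := by
  simp only [dens, hF.sphDeriv_comp hh, hG.sphDeriv_comp hh]
  rw [Real.mul_rpow hF.sphDeriv_nonneg (norm_nonneg _),
    Real.mul_rpow hG.sphDeriv_nonneg (norm_nonneg _)]
  have : ‖deriv h w‖ ^ (1 - D) * ‖deriv h w‖ ^ D = ‖deriv h w‖ := by
    rw [← Real.rpow_add_of_nonneg (norm_nonneg _) (by linarith) hD0.le]; simp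
  simp only [Function.comp]
  linear_combination (chord (f (h w)) (g (h w)) *
    (∏ α ∈ A, chord (f (h w)) α) ^ (-((1 - e) * (1 - D))) *
    (∏ α ∈ A, chord (g (h w)) α) ^ (-((1 - e) * D)) * sphDeriv f (h w) ^ (1 - D)
      * sphDeriv g (h w) ^ D) * this

/-- Two holomorphic families of homogeneous coordinates near `w`, of locally nonconstant maps that
are not locally equal, and which at `w` share the values in `A`. -/
structure Generic (A : Finset (OnePoint ℂ)) (F G : ℂ → ℂ × ℂ) (f g : ℂ → OnePoint ℂ) (w : ℂ) :
    Prop where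
  left : LiftAt F f w
  right : LiftAt G g w
  wronskian_left : ¬ ∀ᶠ z in 𝓝 w, wronskian F z = 0
  wronskian_right : ¬ ∀ᶠ z in 𝓝 w, wronskian G z = 0
  ne : ¬ ∀ᶠ z in 𝓝 w, wedge (F z) (G z) = 0
  share : ∀ α ∈ A, f w = α ↔ g w = α

/-- At each point the density is either regular or vanishes to a definite positive order. At a
shared value taken by `f` with multiplicity `n` and by `g` with multiplicity `m`, the order is at
least `1 - (1-e)((1-D)n + Dm) + (1-D)(n-1) + D(m-1) = e((1-D)n + Dm) ≥ e`. -/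
theorem Generic.logHol_or_hasOrd (h : Generic A F G f g w) (he0 : 0 < e) (he1 : e < 1)
    (hD0 : 0 < D) (hD1 : D ≤ 1 / 2) :
    (LogHol (densHol A e D F G) w ∧ ∀ α ∈ A, f w ≠ α ∧ g w ≠ α) ∨
      (densHol A e D F G w = 0 ∧ ∃ ν, min e D ≤ ν ∧ HasOrd (densHol A e D F G) w ν) := by
  classical
  have hF := h.left.analyticAt
  have hG := h.right.analyticAt
  have hFA : ∀ α, AnalyticAt ℂ (fun z => wedge (F z) (rep α)) w := fun α =>
    analyticAt_wedge hF analyticAt_const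
  have hGA : ∀ α, AnalyticAt ℂ (fun z => wedge (G z) (rep α)) w := fun α =>
    analyticAt_wedge hG analyticAt_const
  obtain ⟨n, hn, hn0⟩ := HasOrd.norm (analyticAt_wedge hF hG) h.ne
  by_cases hA : ∃ α ∈ A, f w = α
  · right
    obtain ⟨α, hα, hfα⟩ := hA
    have hgα := (h.share α hα).1 hfα
    have hfg : wedge (F w) (G w) = 0 := (h.left.eq_iff h.right).1 (hfα.trans hgα.symm)
    refine ⟨by simp [densHol, hfg], ?_⟩
    have hn1 : 1 ≤ n := Nat.one_le_iff_ne_zero.2 fun h' => hn0.1 h' hfg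
    obtain ⟨a, ha1, hFa, hWF⟩ := hasOrd_wronskian hF h.left.ne_zero (nsq_rep α)
      ((h.left.eq_const_iff α).1 hfα)
      fun h' => h.wronskian_left (wronskian_eventually_zero hF (nsq_rep α) h')
    obtain ⟨b, hb1, hGb, hWG⟩ := hasOrd_wronskian hG h.right.ne_zero (nsq_rep α)
      ((h.right.eq_const_iff α).1 hgα)
      fun h' => h.wronskian_right (wronskian_eventually_zero hG (nsq_rep α) h')
    have hprod : ∀ {F : ℂ → ℂ × ℂ} {f : ℂ → OnePoint ℂ} {a : ℕ}, LiftAt F f w → f w = α →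
        HasOrd (fun z => ‖wedge (F z) (rep α)‖) w a →
        HasOrd (fun z => ∏ β ∈ A, ‖wedge (F z) (rep β)‖) w a := by
      intro F f a hF hfα hFa
      have h1 : LogHol (fun z => ∏ β ∈ A.erase α, ‖wedge (F z) (rep β)‖) w := by
        refine LogHol.prod _ fun β hβ => LogHol.norm
          (analyticAt_wedge hF.analyticAt analyticAt_const) fun h' => ?_
        have := (hF.eq_const_iff β).2 h'
        exact (Finset.mem_erase.1 hβ).1 (this.symm.trans hfα)
      have := hFa.mul h1.hasOrd
      rw [add_zero] at this
      refine this.congr (Eventually.of_forall fun z => ?_)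
      exact (Finset.mul_prod_erase A _ hα).symm
    refine ⟨_, ?_, (((hn.mul ((hprod h.left hfα hFa).rpow _)).mul
      ((hprod h.right hgα hGb).rpow _)).mul (hWF.rpow _)).mul (hWG.rpow _)⟩
    refine (min_le_left _ _).trans ?_
    have h1 : (1 : ℝ) ≤ n := by exact_mod_cast hn1
    have h2 : (1 : ℝ) ≤ a := by exact_mod_cast ha1
    have h3 : (1 : ℝ) ≤ b := by exact_mod_cast hb1
    have h4 : e * ((1 - D) * 1 + D * 1) ≤ e * ((1 - D) * a + D * b) := by
      have : 0 < 1 - D := by linarith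
      gcongr
    linarith
  · push Not at hA
    have hA' : ∀ α ∈ A, g w ≠ α := fun α hα h' => hA α hα ((h.share α hα).2 h')
    have hP : ∀ {F : ℂ → ℂ × ℂ} {f : ℂ → OnePoint ℂ}, LiftAt F f w → (∀ α ∈ A, f w ≠ α) →
        LogHol (fun z => ∏ β ∈ A, ‖wedge (F z) (rep β)‖) w := by
      intro F f hF hf
      exact LogHol.prod _ fun β hβ => LogHol.norm
        (analyticAt_wedge hF.analyticAt analyticAt_const)
        fun h' => hf β hβ ((hF.eq_const_iff β).2 h')
    have hPF := hP h.left hA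
    have hPG := hP h.right hA'
    by_cases hz : wedge (F w) (G w) = 0 ∨ wronskian F w = 0 ∨ wronskian G w = 0
    · right
      refine ⟨?_, ?_⟩
      · rcases hz with hz | hz | hz
        · simp [densHol, hz]
        · simp [densHol, hz, Real.zero_rpow (by linarith : 1 - D ≠ 0)]
        · simp [densHol, hz, Real.zero_rpow hD0.ne']
      obtain ⟨a, hFa, ha0⟩ := HasOrd.norm (analyticAt_wronskian hF) h.wronskian_left
      obtain ⟨b, hGb, hb0⟩ := HasOrd.norm (analyticAt_wronskian hG) h.wronskian_right
      refine ⟨_, ?_, (((hn.mul (hPF.hasOrd.rpow _)).mul (hPG.hasOrd.rpow _)).mul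
        (hFa.rpow _)).mul (hGb.rpow _)⟩
      refine (min_le_right _ _).trans ?_
      simp only [zero_mul, add_zero]
      have hna : (0 : ℝ) ≤ n := Nat.cast_nonneg n
      have haa : 0 ≤ (a : ℝ) * (1 - D) := mul_nonneg (Nat.cast_nonneg a) (by linarith)
      have hbb : 0 ≤ (b : ℝ) * D := mul_nonneg (Nat.cast_nonneg b) hD0.le
      rcases hz with hz | hz | hz
      · have : (1 : ℝ) ≤ n := by
          exact_mod_cast Nat.one_le_iff_ne_zero.2 fun h' => hn0.1 h' hz
        linarith
      · have : (1 : ℝ) ≤ a := by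
          exact_mod_cast Nat.one_le_iff_ne_zero.2 fun h' => ha0.1 h' hz
        have : 1 * (1 - D) ≤ a * (1 - D) := by
          apply mul_le_mul_of_nonneg_right this; linarith
        linarith
      · have : (1 : ℝ) ≤ b := by
          exact_mod_cast Nat.one_le_iff_ne_zero.2 fun h' => hb0.1 h' hz
        have : 1 * D ≤ b * D := mul_le_mul_of_nonneg_right this hD0.le
        linarith
    · push Not at hz
      left
      refine ⟨?_, fun α hα => ⟨hA α hα, hA' α hα⟩⟩
      exact ((((LogHol.norm (analyticAt_wedge hF hG) hz.1).mul (hPF.rpow _)).mul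
        (hPG.rpow _)).mul ((LogHol.norm (analyticAt_wronskian hF) hz.2.1).rpow _)).mul
        ((LogHol.norm (analyticAt_wronskian hG) hz.2.2).rpow _)

theorem Generic.continuousAt_dens (h : Generic A F G f g w) (he0 : 0 < e) (he1 : e < 1)
    (hD0 : 0 < D) (hD1 : D ≤ 1 / 2) : ContinuousAt (dens A e D f g) w := by
  have hev : dens A e D f g =ᶠ[𝓝 w] fun z => densHol A e D F G z *
      (nsq (F z) ^ densExp A e (1 - D) * nsq (G z) ^ densExp A e D) := by
    filter_upwards [h.left.eventually, h.right.eventually] with z h1 h2 using h1.dens_eq h2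
  refine ContinuousAt.congr ?_ hev.symm
  refine ContinuousAt.mul ?_ (ContinuousAt.mul ?_ ?_)
  · rcases h.logHol_or_hasOrd he0 he1 hD0 hD1 with h1 | ⟨h0, ν, hν, h1⟩
    · exact h1.1.continuousAt
    · rw [continuousAt_iff_punctured_nhds, h0]
      exact h1.tendsto ((lt_min he0 hD0).trans_le hν)
  · exact (continuousAt_nsq h.left.analyticAt.continuousAt).rpow_const (Or.inl h.left.nsq_pos.ne')
  · exact (continuousAt_nsq h.right.analyticAt.continuousAt).rpow_const
      (Or.inl h.right.nsq_pos.ne')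

end dens

/-! ### Comparison of the density with the Poincaré density -/

/-- A point is chordally close to at most one element of a finite set. -/
theorem exists_prod_chord_rpow_le (A : Finset (OnePoint ℂ)) {p : ℝ} (hp : p ≤ 0) :
    ∃ K : ℝ, 0 < K ∧ ∀ x : OnePoint ℂ, (∀ α ∈ A, x ≠ α) →
      (∏ α ∈ A, chord x α) ^ p ≤ K * (1 + ∑ α ∈ A, chord x α ^ p) := by
  classical
  obtain ⟨d, hd0, hd1, hd⟩ : ∃ d : ℝ, 0 < d ∧ d ≤ 1 ∧
      ∀ α ∈ A, ∀ β ∈ A, α ≠ β → 2 * d ≤ chord α β := by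
    rcases A.offDiag.eq_empty_or_nonempty with h | h
    · refine ⟨1, one_pos, le_rfl, fun α hα β hβ hne => ?_⟩
      have : (α, β) ∈ A.offDiag := Finset.mem_offDiag.2 ⟨hα, hβ, hne⟩
      rw [h] at this
      simp at this
    · obtain ⟨⟨α, β⟩, hm, hmin⟩ := A.offDiag.exists_min_image (fun q => chord q.1 q.2) h
      have hne := (Finset.mem_offDiag.1 hm).2.2
      have hpos : 0 < chord α β :=
        lt_of_le_of_ne (chord_nonneg _ _) fun h' => hne (chord_eq_zero_iff.1 h'.symm)
      refine ⟨chord α β / 2, by positivity, by linarith [chord_le_one α β], ?_⟩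
      intro α' hα' β' hβ' hne'
      have := hmin (α', β') (Finset.mem_offDiag.2 ⟨hα', hβ', hne'⟩)
      simp only at this
      linarith
  have hdp : 1 ≤ d ^ p := Real.one_le_rpow_of_pos_of_le_one_of_nonpos hd0 hd1 hp
  refine ⟨(d ^ p) ^ A.card, by positivity, fun x hx => ?_⟩
  have hc0 : ∀ α ∈ A, 0 < chord x α := fun α hα =>
    lt_of_le_of_ne (chord_nonneg _ _) fun h' => hx α hα (chord_eq_zero_iff.1 h'.symm)
  have hsum0 : 0 ≤ ∑ α ∈ A, chord x α ^ p :=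
    Finset.sum_nonneg fun α _ => Real.rpow_nonneg (chord_nonneg _ _) _
  have hle : ∀ B ⊆ A, (∀ α ∈ B, d ≤ chord x α) → ∏ α ∈ B, chord x α ^ p ≤ (d ^ p) ^ A.card := by
    intro B hB h
    calc ∏ α ∈ B, chord x α ^ p ≤ ∏ α ∈ B, d ^ p :=
          Finset.prod_le_prod (fun α _ => Real.rpow_nonneg (chord_nonneg _ _) _) fun α hα =>
            Real.rpow_le_rpow_of_nonpos hd0 (h α hα) hp
      _ = (d ^ p) ^ B.card := by simp
      _ ≤ _ := pow_le_pow_right₀ hdp (Finset.card_le_card hB)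
  rw [← Real.finsetProd_rpow A _ fun α _ => chord_nonneg x α]
  by_cases h : ∀ α ∈ A, d ≤ chord x α
  · refine (hle A subset_rfl h).trans (le_mul_of_one_le_right (by positivity) (by linarith))
  · push Not at h
    obtain ⟨α, hα, hlt⟩ := h
    rw [← Finset.mul_prod_erase A _ hα, mul_comm]
    refine mul_le_mul (hle _ (Finset.erase_subset _ _) fun β hβ => ?_) ?_
      (Real.rpow_nonneg (chord_nonneg _ _) _) (by positivity)
    · have h1 := hd α hα β (Finset.mem_of_mem_erase hβ) (Finset.ne_of_mem_erase hβ).symm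
      have h2 := chord_triangle α β x
      linarith
    · have := Finset.single_le_sum (f := fun α => chord x α ^ p)
        (fun α _ => Real.rpow_nonneg (chord_nonneg _ _) _) hα
      linarith

/-- The Laplacian of the bounded function `∑ chord(f, α)^{2e}` contributes the singular term needed
to dominate `dens`. -/
theorem exists_hasExp2_sum_chord {F : ℂ → ℂ × ℂ} {f : ℂ → OnePoint ℂ} {w : ℂ} (hF : LiftAt F f w)
    {A : Finset (OnePoint ℂ)} (hA : ∀ α ∈ A, f w ≠ α) {e : ℝ} (he : 0 < e) :
    ∃ b ℓ, HasExp2 (fun z => ∑ α ∈ A, chord (f z) α ^ (2 * e)) w b ℓ ∧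
      sphDeriv f w ^ 2 * (e ^ 2 * ∑ α ∈ A, chord (f w) α ^ (2 * e - 2) - (e + e ^ 2) * A.card) ≤ ℓ
    := by
  have h : ∀ α : OnePoint ℂ, ∃ b, α ∈ A → HasExp2 (fun z => chord (f z) α ^ (2 * e)) w b
      (sphDeriv f w ^ 2 * (e ^ 2 * chord (f w) α ^ (2 * e - 2)
        - (e + e ^ 2) * chord (f w) α ^ (2 * e))) := by
    intro α
    by_cases hα : α ∈ A
    · obtain ⟨b, hb⟩ := hasExp2_chord_rpow hF (hA α hα) e
      exact ⟨b, fun _ => hb⟩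
    · exact ⟨0, fun h' => absurd h' hα⟩
  choose b hb using h
  refine ⟨_, _, HasExp2.sum A fun α hα => hb α hα, ?_⟩
  rw [← Finset.mul_sum]
  refine mul_le_mul_of_nonneg_left ?_ (sq_nonneg _)
  rw [Finset.sum_sub_distrib, ← Finset.mul_sum, ← Finset.mul_sum]
  have h1 : ∑ α ∈ A, chord (f w) α ^ (2 * e) ≤ A.card := by
    calc _ ≤ ∑ α ∈ A, (1 : ℝ) := Finset.sum_le_sum fun α _ =>
          Real.rpow_le_one (chord_nonneg _ _) (chord_le_one _ _) (by linarith)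
      _ = _ := by simp
  gcongr

/-- Up to the factor `|f,g|² ≤ 1`, the square of the density is a weighted geometric mean of the two
terms on the right. -/
theorem dens_sq_le {A : Finset (OnePoint ℂ)} {e D : ℝ} {F G : ℂ → ℂ × ℂ} {f g : ℂ → OnePoint ℂ}
    {w : ℂ} (hF : LiftAt F f w) (hG : LiftAt G g w) (hD0 : 0 ≤ D) (hD1 : D ≤ 1) :
    dens A e D f g w ^ 2 ≤ sphDeriv f w ^ 2 * (∏ α ∈ A, chord (f w) α) ^ (2 * e - 2) +
      sphDeriv g w ^ 2 * (∏ α ∈ A, chord (g w) α) ^ (2 * e - 2) := by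
  have h1 := hF.sphDeriv_nonneg
  have h2 := hG.sphDeriv_nonneg
  have h4 : 0 ≤ ∏ α ∈ A, chord (f w) α := Finset.prod_nonneg fun α _ => chord_nonneg _ α
  have h5 : 0 ≤ ∏ α ∈ A, chord (g w) α := Finset.prod_nonneg fun α _ => chord_nonneg _ α
  set x := sphDeriv f w ^ 2 * (∏ α ∈ A, chord (f w) α) ^ (2 * e - 2)
  set y := sphDeriv g w ^ 2 * (∏ α ∈ A, chord (g w) α) ^ (2 * e - 2)
  have hx : 0 ≤ x := by positivity
  have hy : 0 ≤ y := by positivity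
  have key : dens A e D f g w ^ 2 = chord (f w) (g w) ^ 2 * (x ^ (1 - D) * y ^ D) := by
    simp only [x, y]
    rw [Real.mul_rpow (by positivity) (by positivity), Real.mul_rpow (by positivity) (by positivity),
      ← Real.rpow_mul h4, ← Real.rpow_mul h5, ← Real.rpow_natCast_mul h1,
      ← Real.rpow_natCast_mul h2, dens]
    simp only [mul_pow]
    rw [← Real.rpow_mul_natCast h4, ← Real.rpow_mul_natCast h5, ← Real.rpow_mul_natCast h1,
      ← Real.rpow_mul_natCast h2]
    ring_nf
  have hc : chord (f w) (g w) ^ 2 ≤ 1 := pow_le_one₀ (chord_nonneg _ _) (chord_le_one _ _)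
  have hxy := Real.geom_mean_le_arith_mean2_weighted (w₁ := 1 - D) (w₂ := D) (by linarith) hD0 hx hy
    (by ring)
  rw [key]
  calc _ ≤ 1 * (x ^ (1 - D) * y ^ D) := by gcongr
    _ ≤ (1 - D) * x + D * y := by linarith
    _ ≤ 1 * x + 1 * y := by gcongr; linarith
    _ = _ := by ring

/-- The density `dens` is dominated by the Poincaré density of the disc when the exponents of `|F|`
and `|G|` are positive. -/
theorem exists_dens_le_of_pos (A : Finset (OnePoint ℂ)) {e D : ℝ} (he0 : 0 < e) (he1 : e < 1)
    (hD0 : 0 < D) (hD1 : D ≤ 1 / 2) (hP : 0 < densExp A e (1 - D)) (hQ : 0 < densExp A e D) :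
    ∃ K : ℝ, 0 < K ∧ ∀ (R : ℝ) (f g : ℂ → OnePoint ℂ),
      (∀ w ∈ Metric.ball (0 : ℂ) R, ∃ F G, Generic A F G f g w) →
        ∀ w ∈ Metric.ball (0 : ℂ) R, dens A e D f g w ≤ K * (R / (R ^ 2 - ‖w‖ ^ 2)) := by
  set P := densExp A e (1 - D)
  set Q := densExp A e D
  set q : ℝ := (A.card : ℝ)
  have hq : 0 ≤ q := Nat.cast_nonneg _
  obtain ⟨K₀, hK₀, hsep⟩ := exists_prod_chord_rpow_le A (p := 2 * e - 2) (by linarith)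
  -- `δ` is so small that the bump functions use up at most half of the curvature
  obtain ⟨δ, hδ0, hδP, hδQ⟩ : ∃ δ : ℝ, 0 < δ ∧ δ * ((e + e ^ 2) * q) ≤ P / 2 ∧
      δ * ((e + e ^ 2) * q) ≤ Q / 2 := by
    have hm : 0 < min P Q := lt_min hP hQ
    refine ⟨min P Q / (2 * ((e + e ^ 2) * q + 1)), by positivity, ?_, ?_⟩ <;>
    · have h1 : min P Q / (2 * ((e + e ^ 2) * q + 1)) * ((e + e ^ 2) * q) ≤ min P Q / 2 := by
        rw [div_mul_eq_mul_div, div_le_div_iff₀ (by positivity) (by norm_num)]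
        nlinarith
      have := min_le_left P Q
      have := min_le_right P Q
      linarith
  set c₀ := min (min (P / 2) (Q / 2)) (δ * e ^ 2) with hc₀
  have hc₀pos : 0 < c₀ := lt_min (lt_min (by positivity) (by positivity)) (by positivity)
  set M := Real.exp (δ * q + δ * q) with hM
  set c := √(c₀ / K₀) / M with hc
  have hcpos : 0 < c := by positivity
  refine ⟨c⁻¹, by positivity, fun R f g hgen => ?_⟩
  set S : (ℂ → OnePoint ℂ) → ℂ → ℝ := fun f z => ∑ α ∈ A, chord (f z) α ^ (2 * e) with hS
  have hS0 : ∀ f z, 0 ≤ S f z := fun f z => Finset.sum_nonneg fun α _ =>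
    Real.rpow_nonneg (chord_nonneg _ _) _
  have hSq : ∀ f z, S f z ≤ q := fun f z => by
    calc _ ≤ ∑ α ∈ A, (1 : ℝ) := Finset.sum_le_sum fun α _ =>
          Real.rpow_le_one (chord_nonneg _ _) (chord_le_one _ _) (by linarith)
      _ = _ := by simp [q]
  have hScont : ∀ {F : ℂ → ℂ × ℂ} {f : ℂ → OnePoint ℂ} {w : ℂ}, LiftAt F f w →
      ContinuousAt (S f) w := by
    intro F f w hF
    have hev : S f =ᶠ[𝓝 w] fun z =>
        ∑ α ∈ A, (‖wedge (F z) (rep α)‖ / √(nsq (F z))) ^ (2 * e) := by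
      filter_upwards [hF.eventually] with z hz
      simp only [hS, hz.chord_const_eq]
    refine ContinuousAt.congr ?_ hev.symm
    refine tendsto_finsetSum _ fun α _ => ContinuousAt.rpow_const ?_ (Or.inr (by positivity))
    refine ContinuousAt.div ?_ ?_ (Real.sqrt_pos.2 hF.nsq_pos).ne'
    · exact (analyticAt_wedge hF.analyticAt analyticAt_const).continuousAt.norm
    · exact (continuousAt_nsq hF.analyticAt.continuousAt).sqrt
  set v : ℂ → ℝ := fun z => dens A e D f g z * Real.exp (δ * S f z + δ * S g z) with hv
  have hle : ∀ w ∈ Metric.ball (0 : ℂ) R, dens A e D f g w ≤ v w := by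
    intro w hw
    obtain ⟨F, G, h⟩ := hgen w hw
    refine le_mul_of_one_le_right (dens_nonneg h.left h.right) (Real.one_le_exp ?_)
    have := hS0 f w
    have := hS0 g w
    positivity
  suffices h : ∀ w ∈ Metric.ball (0 : ℂ) R, v w ≤ c⁻¹ * (R / (R ^ 2 - ‖w‖ ^ 2)) from
    fun w hw => (hle w hw).trans (h w hw)
  refine ahlfors_schwarz hcpos ?_ ?_
  · intro w hw
    obtain ⟨F, G, h⟩ := hgen w hw
    refine ContinuousAt.continuousWithinAt ?_
    refine (h.continuousAt_dens he0 he1 hD0 hD1).mul (ContinuousAt.rexp ?_)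
    exact (continuousAt_const.mul (hScont h.left)).add (continuousAt_const.mul (hScont h.right))
  · intro w hw hvw
    obtain ⟨F, G, h⟩ := hgen w hw
    have hd : 0 < dens A e D f g w := pos_of_mul_pos_left hvw (Real.exp_pos _).le
    rcases h.logHol_or_hasOrd he0 he1 hD0 hD1 with ⟨⟨k, hk, hke⟩, hA⟩ | ⟨h0, -⟩
    swap
    · rw [h.left.dens_eq h.right, h0, zero_mul] at hd
      exact absurd hd (lt_irrefl _)
    obtain ⟨bf, ℓf, hEf, hℓf⟩ := exists_hasExp2_sum_chord h.left (fun α hα => (hA α hα).1) he0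
    obtain ⟨bg, ℓg, hEg, hℓg⟩ := exists_hasExp2_sum_chord h.right (fun α hα => (hA α hα).2) he0
    have hE := ((HasExp2.re_analytic hk).add (((hasExp2_log_nsq h.left.analyticAt
      h.left.ne_zero).const_mul P).add ((hasExp2_log_nsq h.right.analyticAt
      h.right.ne_zero).const_mul Q))).add ((hEf.const_mul δ).add (hEg.const_mul δ))
    refine ⟨_, _, hE.congr ?_, ?_⟩
    · filter_upwards [h.left.eventually, h.right.eventually, hke] with z h1 h2 h3
      have n1 := h1.nsq_pos
      have n2 := h2.nsq_pos
      simp only [hv]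
      rw [h1.dens_eq h2, h3, Real.log_mul (by positivity) (by positivity),
        Real.log_mul (by positivity) (by positivity), Real.log_mul (by positivity) (by positivity),
        Real.log_exp, Real.log_exp, Real.log_rpow n1, Real.log_rpow n2]
    · rw [← div_pow, ← div_pow, ← h.left.sphDeriv_eq, ← h.right.sphDeriv_eq]
      set x := sphDeriv f w ^ 2 with hx
      set y := sphDeriv g w ^ 2 with hy
      set Tf := ∑ α ∈ A, chord (f w) α ^ (2 * e - 2)
      set Tg := ∑ α ∈ A, chord (g w) α ^ (2 * e - 2)
      have hTf : 0 ≤ Tf := Finset.sum_nonneg fun α _ => Real.rpow_nonneg (chord_nonneg _ _) _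
      have hTg : 0 ≤ Tg := Finset.sum_nonneg fun α _ => Real.rpow_nonneg (chord_nonneg _ _) _
      have hx0 : 0 ≤ x := sq_nonneg _
      have hy0 : 0 ≤ y := sq_nonneg _
      have hcP : c₀ ≤ P / 2 := (min_le_left _ _).trans (min_le_left _ _)
      have hcQ : c₀ ≤ Q / 2 := (min_le_left _ _).trans (min_le_right _ _)
      have hcδ : c₀ ≤ δ * e ^ 2 := min_le_right _ _
      have lower : c₀ * (x * (1 + Tf) + y * (1 + Tg)) ≤
          0 + (P * x + Q * y) + (δ * ℓf + δ * ℓg) := by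
        have a1 := mul_le_mul_of_nonneg_left hℓf hδ0.le
        have a2 := mul_le_mul_of_nonneg_left hℓg hδ0.le
        have a3 : c₀ * Tf ≤ δ * e ^ 2 * Tf := mul_le_mul_of_nonneg_right hcδ hTf
        have a4 : c₀ * Tg ≤ δ * e ^ 2 * Tg := mul_le_mul_of_nonneg_right hcδ hTg
        have a5 : x * (c₀ + c₀ * Tf) ≤
            x * (P + δ * e ^ 2 * Tf - δ * ((e + e ^ 2) * q)) :=
          mul_le_mul_of_nonneg_left (by linarith) hx0
        have a6 : y * (c₀ + c₀ * Tg) ≤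
            y * (Q + δ * e ^ 2 * Tg - δ * ((e + e ^ 2) * q)) :=
          mul_le_mul_of_nonneg_left (by linarith) hy0
        linarith
      refine le_trans ?_ lower
      have upper := dens_sq_le (A := A) (e := e) h.left h.right hD0.le (by linarith)
      have u1 := mul_le_mul_of_nonneg_left (hsep (f w) fun α hα => (hA α hα).1) hx0
      have u2 := mul_le_mul_of_nonneg_left (hsep (g w) fun α hα => (hA α hα).2) hy0
      have hdens : dens A e D f g w ^ 2 ≤ K₀ * (x * (1 + Tf) + y * (1 + Tg)) := by linarith
      have hexp : Real.exp (δ * S f w + δ * S g w) ≤ M := by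
        refine Real.exp_le_exp.2 ?_
        have := mul_le_mul_of_nonneg_left (hSq f w) hδ0.le
        have := mul_le_mul_of_nonneg_left (hSq g w) hδ0.le
        linarith
      have hcv : c * v w ≤ √(c₀ / K₀) * dens A e D f g w := by
        have hM0 : 0 < M := Real.exp_pos _
        have : c * v w = √(c₀ / K₀) * dens A e D f g w *
            (Real.exp (δ * S f w + δ * S g w) / M) := by
          simp only [hc, hv]; ring
        rw [this]
        exact mul_le_of_le_one_right (by positivity) ((div_le_one hM0).2 hexp)
      calc (c * v w) ^ 2 ≤ (√(c₀ / K₀) * dens A e D f g w) ^ 2 := by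
            gcongr
        _ = c₀ / K₀ * dens A e D f g w ^ 2 := by
            rw [mul_pow, Real.sq_sqrt (by positivity)]
        _ ≤ c₀ / K₀ * (K₀ * (x * (1 + Tf) + y * (1 + Tg))) := by gcongr
        _ = _ := by field_simp

/-- The density `dens` is dominated by the Poincaré density also when the exponent of `|G|`
vanishes: diminishing `e` increases `dens` and makes both exponents positive. -/
theorem exists_dens_le (A : Finset (OnePoint ℂ)) {e D : ℝ} (he0 : 0 < e) (he1 : e < 1)
    (hD0 : 0 < D) (hD1 : D ≤ 1 / 2) (hA : A.Nonempty)
    (hP : 0 ≤ densExp A e (1 - D)) (hQ : 0 ≤ densExp A e D) :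
    ∃ K : ℝ, 0 < K ∧ ∀ (R : ℝ) (f g : ℂ → OnePoint ℂ),
      (∀ w ∈ Metric.ball (0 : ℂ) R, ∃ F G, Generic A F G f g w) →
        ∀ w ∈ Metric.ball (0 : ℂ) R, dens A e D f g w ≤ K * (R / (R ^ 2 - ‖w‖ ^ 2)) := by
  have hq : (0 : ℝ) < A.card := by exact_mod_cast hA.card_pos
  have hP' : 0 < densExp A (e / 2) (1 - D) := by
    have : 0 < A.card * (e / 2) * (1 - D) := mul_pos (by positivity) (by linarith)
    simp only [densExp] at hP ⊢
    linarith
  have hQ' : 0 < densExp A (e / 2) D := by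
    have : 0 < A.card * (e / 2) * D := by positivity
    simp only [densExp] at hQ ⊢
    linarith
  obtain ⟨K, hK, h⟩ := exists_dens_le_of_pos A (e := e / 2) (by positivity) (by linarith) hD0 hD1
    hP' hQ'
  refine ⟨K, hK, fun R f g hgen w hw => le_trans ?_ (h R f g hgen w hw)⟩
  obtain ⟨F, G, hFG⟩ := hgen w hw
  have h1 := hFG.left.sphDeriv_nonneg
  have h2 := hFG.right.sphDeriv_nonneg
  have h3 := chord_nonneg (f w) (g w)
  have mono : ∀ (x : OnePoint ℂ) (p p' : ℝ), p ≤ p' → p < 0 →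
      (∏ α ∈ A, chord x α) ^ p' ≤ (∏ α ∈ A, chord x α) ^ p ∨ 0 ≤ p' := by
    intro x p p' hpp hp
    by_cases hp' : 0 ≤ p'
    · exact Or.inr hp'
    left
    have hx0 : 0 ≤ ∏ α ∈ A, chord x α := Finset.prod_nonneg fun α _ => chord_nonneg _ α
    have hx1 : ∏ α ∈ A, chord x α ≤ 1 :=
      Finset.prod_le_one (fun α _ => chord_nonneg _ α) fun α _ => chord_le_one _ α
    rcases hx0.eq_or_lt with h0 | h0
    · rw [← h0, Real.zero_rpow hp.ne, Real.zero_rpow (by linarith)]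
    · exact Real.rpow_le_rpow_of_exponent_ge h0 hx1 hpp
  have m1 := (mono (f w) (-((1 - e / 2) * (1 - D))) (-((1 - e) * (1 - D))) (by nlinarith)
    (by nlinarith)).resolve_right (by nlinarith)
  have m2 := (mono (g w) (-((1 - e / 2) * D)) (-((1 - e) * D)) (by nlinarith)
    (by nlinarith)).resolve_right (by nlinarith)
  have p1 : ∀ (x : OnePoint ℂ) (p : ℝ), 0 ≤ (∏ α ∈ A, chord x α) ^ p := fun x p =>
    Real.rpow_nonneg (Finset.prod_nonneg fun α _ => chord_nonneg _ α) _
  unfold dens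
  refine mul_le_mul_of_nonneg_right (mul_le_mul_of_nonneg_right ?_ (by positivity)) (by positivity)
  refine mul_le_mul (mul_le_mul_of_nonneg_left m1 h3) m2 (p1 _ _) ?_
  exact mul_nonneg h3 (p1 _ _)

/-! ### Holomorphic maps between discs, surfaces and the sphere -/

/-- A sphere-valued map whose homogeneous coordinates have vanishing Wronskian is locally
constant. -/
theorem LiftAt.eventually_eq_of_wronskian {F : ℂ → ℂ × ℂ} {f : ℂ → OnePoint ℂ} {w : ℂ}
    (hF : LiftAt F f w) (h : ∀ᶠ z in 𝓝 w, wronskian F z = 0) : ∀ᶠ z in 𝓝 w, f z = f w := by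
  set a := rep (f w) with ha
  set b : ℂ × ℂ := (-starRingEnd ℂ a.2, starRingEnd ℂ a.1) with hb
  have hab : wedge a b = 1 := by
    have := congrArg Complex.ofReal (nsq_rep (f w))
    rw [nsq, Complex.ofReal_add, norm_sq_eq_mul_conj, norm_sq_eq_mul_conj, ← ha] at this
    simp only [wedge, hb]
    push_cast at this
    linear_combination this
  have hB := analyticAt_wedge hF.analyticAt (analyticAt_const (v := b))
  have hB0 : wedge (F w) b ≠ 0 := by
    have e := eq_smul_of_wedge_eq_zero (nsq_rep (f w)) hF.wedge_eq_zero
    rw [e, wedge_smul_left, hab, mul_one]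
    intro h'
    exact hF.ne_zero (by rw [e, h', zero_smul])
  obtain ⟨r, hr, hball⟩ := Metric.eventually_nhds_iff_ball.1
    ((h.and (hB.continuousAt.eventually_ne hB0)).and hF.eventually)
  have hder : ∀ z ∈ Metric.ball w r,
      HasDerivAt (fun z => wedge (F z) a / wedge (F z) b) 0 z := by
    intro z hz
    obtain ⟨⟨h1, h2⟩, h3⟩ := hball z hz
    have hd := h3.analyticAt.differentiableAt.hasDerivAt
    refine ((hasDerivAt_wedge hd a).div (hasDerivAt_wedge hd b) h2).congr_deriv ?_
    have e := wedge_mul_wedge (F z) (deriv F z) a b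
    rw [show wedge (F z) (deriv F z) = 0 from h1, zero_mul] at e
    rw [div_eq_zero_iff]
    left
    linear_combination e
  filter_upwards [Metric.ball_mem_nhds w hr] with z hz
  have hconst := Metric.isOpen_ball.is_const_of_deriv_eq_zero
    (convex_ball w r).isPreconnected (fun y hy => (hder y hy).differentiableAt.differentiableWithinAt)
    (fun y hy => (hder y hy).deriv) hz (Metric.mem_ball_self hr)
  simp only [hF.wedge_eq_zero, ha, zero_div] at hconst
  rw [(hball z hz).2.eq_const_iff]
  exact (div_eq_zero_iff.1 hconst).resolve_right (hball z hz).1.2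

section surface

variable {S : Type*} [TopologicalSpace S] [ChartedSpace ℂ S]

/-- `Φ : ℂ → S` is holomorphic near `w`. -/
def HolAt (Φ : ℂ → S) (w : ℂ) : Prop := ∀ᶠ z in 𝓝 w, MDifferentiableAt 𝓘(ℂ) 𝓘(ℂ) Φ z

/-- The pullback of a length element along `Φ : ℂ → S`, as a density with respect to `|dz|`. -/
def pull (L : (p : S) → TangentSpace 𝓘(ℂ) p → ℝ) (Φ : ℂ → S) (w : ℂ) : ℝ :=
  L (Φ w) (mfderiv 𝓘(ℂ) 𝓘(ℂ) Φ w (1 : ℂ))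

/-- Absolute homogeneity of a length element. -/
def IsHomog (L : (p : S) → TangentSpace 𝓘(ℂ) p → ℝ) : Prop :=
  ∀ (p : S) (c : ℂ) (v : TangentSpace 𝓘(ℂ) p), L p (c • v) = ‖c‖ * L p v

variable {L : (p : S) → TangentSpace 𝓘(ℂ) p → ℝ} {Φ Ψ : ℂ → S} {w : ℂ}

theorem HolAt.congr (h : HolAt Φ w) (he : Ψ =ᶠ[𝓝 w] Φ) : HolAt Ψ w := by
  filter_upwards [h, he.eventually_nhds] with z h1 h2 using h1.congr_of_eventuallyEq h2

theorem HolAt.eventually (h : HolAt Φ w) : ∀ᶠ z in 𝓝 w, HolAt Φ z := Eventually.eventually_nhds h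

theorem HolAt.mdifferentiableAt (h : HolAt Φ w) : MDifferentiableAt 𝓘(ℂ) 𝓘(ℂ) Φ w :=
  Eventually.self_of_nhds h

theorem HolAt.continuousAt (h : HolAt Φ w) : ContinuousAt Φ w := h.mdifferentiableAt.continuousAt

theorem HolAt.comp {h : ℂ → ℂ} (hΦ : HolAt Φ (h w)) (hh : AnalyticAt ℂ h w) :
    HolAt (Φ ∘ h) w := by
  filter_upwards [hh.continuousAt.eventually hΦ, hh.eventually_analyticAt] with z h1 h2
  exact h1.comp z h2.differentiableAt.mdifferentiableAt

theorem pull_congr (he : Ψ =ᶠ[𝓝 w] Φ) : pull L Ψ w = pull L Φ w := by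
  unfold pull
  rw [he.mfderiv_eq]
  congr 1
  · exact he.eq_of_nhds

theorem pull_comp (hL : IsHomog L) {h : ℂ → ℂ} (hΦ : MDifferentiableAt 𝓘(ℂ) 𝓘(ℂ) Φ (h w))
    (hh : DifferentiableAt ℂ h w) : pull L (Φ ∘ h) w = pull L Φ (h w) * ‖deriv h w‖ := by
  unfold pull
  rw [mfderiv_comp w hΦ hh.mdifferentiableAt, mfderiv_eq_fderiv]
  have h1 : fderiv ℂ h w (1 : ℂ) = deriv h w • (1 : ℂ) := by simp
  have h2 : (mfderiv 𝓘(ℂ) 𝓘(ℂ) Φ (h w) ∘L fderiv ℂ h w) (1 : ℂ)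
      = deriv h w • mfderiv 𝓘(ℂ) 𝓘(ℂ) Φ (h w) (1 : ℂ) := by
    rw [ContinuousLinearMap.comp_apply]
    exact (congrArg (mfderiv 𝓘(ℂ) 𝓘(ℂ) Φ (h w)) h1).trans (ContinuousLinearMap.map_smul _ _ _)
  rw [mul_comm, ← hL]
  exact congrArg (L (Φ (h w))) h2

theorem HolAt.eventually_eq_chart (hΦ : HolAt Φ w) {p : S} (hp : Φ w ∈ (chartAt ℂ p).source) :
    ∀ᶠ z in 𝓝 w, Φ z ∈ (chartAt ℂ p).source ∧
      Φ z = ((chartAt ℂ p).symm ∘ (chartAt ℂ p ∘ Φ)) z := by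
  filter_upwards [hΦ.continuousAt.eventually ((chartAt ℂ p).open_source.mem_nhds hp)] with z h
  exact ⟨h, ((chartAt ℂ p).left_inv h).symm⟩

/-- Sphere-valued holomorphic maps have holomorphic homogeneous coordinates along `Φ`. -/
theorem IsHolomorphicToSphere.exists_lift {g : S → OnePoint ℂ} (hg : IsHolomorphicToSphere g)
    (hΦ : HolAt Φ w) : ∃ F, LiftAt F (g ∘ Φ) w := by
  obtain ⟨f, hf, h⟩ := hg (Φ w)
  have hfa : AnalyticAt ℂ (f ∘ Φ) w := by
    rw [Complex.analyticAt_iff_eventually_differentiableAt]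
    filter_upwards [hΦ, hΦ.continuousAt.eventually hf] with z h1 h2
    exact (h2.comp z h1).differentiableAt
  rcases h with h | h
  · refine ⟨fun z => (1, f (Φ z)), analyticAt_const.prod hfa, ?_⟩
    filter_upwards [hΦ.continuousAt.eventually h] with z hz
    refine ⟨fun h' => one_ne_zero (congrArg Prod.fst h'), ?_⟩
    rw [Function.comp_apply, hz, rep_coe, wedge_smul_right]
    simp [wedge]
  · refine ⟨fun z => (f (Φ z), 1), hfa.prod analyticAt_const, ?_⟩
    filter_upwards [hΦ.continuousAt.eventually h] with z hz
    refine ⟨fun h' => one_ne_zero (congrArg Prod.snd h'), ?_⟩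
    rw [Function.comp_apply, hz, sphereInv]
    split_ifs with h0
    · rw [rep_infty]; simp [wedge, h0]
    · rw [rep_coe, wedge_smul_right]; simp [wedge, h0]

theorem isHolomorphicToSphere_const (c : OnePoint ℂ) :
    IsHolomorphicToSphere fun _ : S => c := by
  intro p
  induction c using OnePoint.rec with
  | infty => exact ⟨fun _ => 0, Eventually.of_forall fun _ => mdifferentiableAt_const,
      Or.inr (by simp [sphereInv])⟩
  | coe z => exact ⟨fun _ => z, Eventually.of_forall fun _ => mdifferentiableAt_const,
      Or.inl (by simp)⟩

variable [IsManifold 𝓘(ℂ) ω S]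

theorem holAt_chart_symm (p : S) {z : ℂ} (hz : z ∈ (chartAt ℂ p).target) :
    HolAt (chartAt ℂ p).symm z := by
  filter_upwards [(chartAt ℂ p).open_target.mem_nhds hz] with y hy
  exact mdifferentiableAt_atlas_symm (chart_mem_atlas ℂ p) hy

theorem HolAt.analyticAt_chart (hΦ : HolAt Φ w) {p : S} (hp : Φ w ∈ (chartAt ℂ p).source) :
    AnalyticAt ℂ (chartAt ℂ p ∘ Φ) w := by
  rw [Complex.analyticAt_iff_eventually_differentiableAt]
  filter_upwards [hΦ, hΦ.continuousAt.eventually ((chartAt ℂ p).open_source.mem_nhds hp)]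
    with z h1 h2
  exact ((mdifferentiableAt_atlas (chart_mem_atlas ℂ p) h2).comp z h1).differentiableAt

/-- A length element pulled back along `Φ`, computed in a chart. -/
theorem HolAt.pull_eq_chart (hL : IsHomog L) (hΦ : HolAt Φ w) {p : S}
    (hp : Φ w ∈ (chartAt ℂ p).source) :
    pull L Φ w = pull L (chartAt ℂ p).symm (chartAt ℂ p (Φ w)) * ‖deriv (chartAt ℂ p ∘ Φ) w‖ := by
  rw [pull_congr ((hΦ.eventually_eq_chart hp).mono fun _ h => h.2)]
  exact pull_comp (h := chartAt ℂ p ∘ Φ) hL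
    (holAt_chart_symm p ((chartAt ℂ p).map_source hp)).mdifferentiableAt
    (hΦ.analyticAt_chart hp).differentiableAt

/-- A holomorphic map with nonvanishing derivative is open. -/
theorem HolAt.map_nhds (hΦ : HolAt Φ w) {p : S} (hp : Φ w ∈ (chartAt ℂ p).source)
    (hd : deriv (chartAt ℂ p ∘ Φ) w ≠ 0) : map Φ (𝓝 w) = 𝓝 (Φ w) := by
  have h1 := (hΦ.analyticAt_chart hp).hasStrictDerivAt.map_nhds_eq hd
  have h2 := (chartAt ℂ p).symm.map_nhds_eq (x := chartAt ℂ p (Φ w))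
    ((chartAt ℂ p).map_source hp)
  rw [(chartAt ℂ p).left_inv hp] at h2
  rw [← h2]
  change _ = map _ (𝓝 ((chartAt ℂ p ∘ Φ) w))
  rw [← h1, Filter.map_map]
  exact Filter.map_congr ((hΦ.eventually_eq_chart hp).mono fun _ h => h.2)

/-- **Identity theorem** for holomorphic maps to the Riemann sphere. -/
theorem IsHolomorphicToSphere.eq_of_eventually_eq [ConnectedSpace S] {g g' : S → OnePoint ℂ}
    (hg : IsHolomorphicToSphere g) (hg' : IsHolomorphicToSphere g') {p : S}
    (h : ∀ᶠ x in 𝓝 p, g x = g' x) : g = g' := by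
  have hclopen : IsClopen {p | ∀ᶠ x in 𝓝 p, g x = g' x} := by
    refine ⟨?_, isOpen_setOfPred_eventually_nhds⟩
    refine isClosed_of_closure_subset fun a ha => ?_
    set φ := chartAt ℂ a
    have ht : φ a ∈ φ.target := mem_chart_target ℂ a
    have hψ : HolAt φ.symm (φ a) := holAt_chart_symm a ht
    obtain ⟨F, hF⟩ := hg.exists_lift hψ
    obtain ⟨F', hF'⟩ := hg'.exists_lift hψ
    have hW := analyticAt_wedge hF.analyticAt hF'.analyticAt
    have hmap : map φ.symm (𝓝 (φ a)) = 𝓝 a := by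
      rw [φ.symm.map_nhds_eq ht, φ.left_inv (mem_chart_source ℂ a)]
    have hiff : ∀ᶠ z in 𝓝 (φ a), (g (φ.symm z) = g' (φ.symm z) ↔ wedge (F z) (F' z) = 0) := by
      filter_upwards [hF.eventually, hF'.eventually] with z h1 h2 using h1.eq_iff h2
    have hfreq : ∃ᶠ z in 𝓝[≠] (φ a), wedge (F z) (F' z) = 0 := by
      rw [frequently_nhdsWithin_iff, frequently_iff]
      intro U hU
      obtain ⟨V, hVsub, hVo, haV⟩ := mem_nhds_iff.1
        (inter_mem (inter_mem hU hiff) (φ.open_target.mem_nhds ht))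
      have hVmem : φ.symm '' V ∈ 𝓝 a := by
        rw [← hmap]; exact image_mem_map (hVo.mem_nhds haV)
      obtain ⟨x, hxV, hx⟩ := mem_closure_iff_nhds.1 ha _ hVmem
      obtain ⟨z, hzV, rfl⟩ := hxV
      have hzt : z ∈ φ.target := (hVsub hzV).2
      have hev : ∀ᶠ y in 𝓝 z, g (φ.symm y) = g' (φ.symm y) :=
        (φ.symm.continuousAt hzt).eventually hx
      have hev' : ∀ᶠ y in 𝓝[≠] z, g (φ.symm y) = g' (φ.symm y) ∧ y ∈ V ∧ y ≠ φ a := by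
        have h3 : ∀ᶠ y in 𝓝[≠] z, y ≠ φ a := by
          by_cases hza : z = φ a
          · rw [hza]; exact self_mem_nhdsWithin
          · exact nhdsWithin_le_nhds (isOpen_ne.mem_nhds hza)
        filter_upwards [nhdsWithin_le_nhds hev, nhdsWithin_le_nhds (hVo.mem_nhds hzV), h3]
          with y h1 h2 h3 using ⟨h1, h2, h3⟩
      obtain ⟨y, hy1, hy2, hy3⟩ := hev'.exists
      exact ⟨y, (hVsub hy2).1.1, (hVsub hy2).1.2.1 hy1, hy3⟩
    have hz := (hW.frequently_eq_iff_eventually_eq analyticAt_const).1 hfreq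
    change ∀ᶠ x in 𝓝 a, g x = g' x
    rw [← hmap, eventually_map]
    filter_upwards [hz, hiff] with z h1 h2 using h2.2 h1
  have := hclopen.eq_univ ⟨p, h⟩
  funext x
  have hx : x ∈ {p | ∀ᶠ x in 𝓝 p, g x = g' x} := this ▸ Set.mem_univ x
  exact Eventually.self_of_nhds (p := fun x => g x = g' x) hx

/-- The derivative of a nonconstant map does not vanish identically near any point. -/
theorem IsHolomorphicToSphere.wronskian_ne [ConnectedSpace S] {g : S → OnePoint ℂ}
    (hg : IsHolomorphicToSphere g) (hnc : ¬ IsConstantMap g)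
    (hmap : map Φ (𝓝 w) = 𝓝 (Φ w)) {F : ℂ → ℂ × ℂ} (hF : LiftAt F (g ∘ Φ) w) :
    ¬ ∀ᶠ z in 𝓝 w, wronskian F z = 0 := by
  intro h
  have h1 := hF.eventually_eq_of_wronskian h
  have h2 : ∀ᶠ x in 𝓝 (Φ w), g x = g (Φ w) := by
    rw [← hmap, eventually_map]; exact h1
  have := hg.eq_of_eventually_eq (isHolomorphicToSphere_const (g (Φ w))) h2
  exact hnc ⟨g (Φ w), fun p => congrFun this p⟩

/-- Sphere-valued maps sharing values on a surface remain so in the parameter of an open map into the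
surface. -/
theorem generic_of_sharesValue [ConnectedSpace S] {g g' : S → OnePoint ℂ}
    (hg : IsHolomorphicToSphere g) (hg' : IsHolomorphicToSphere g') (hnc : ¬ IsConstantMap g)
    (hnc' : ¬ IsConstantMap g') (hne : g ≠ g') {A : Finset (OnePoint ℂ)}
    (hA : ∀ α ∈ A, SharesValue g g' α) (hmap : map Φ (𝓝 w) = 𝓝 (Φ w)) {F G : ℂ → ℂ × ℂ}
    (hF : LiftAt F (g ∘ Φ) w) (hG : LiftAt G (g' ∘ Φ) w) :
    Generic A F G (g ∘ Φ) (g' ∘ Φ) w where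
  left := hF
  right := hG
  wronskian_left := hg.wronskian_ne hnc hmap hF
  wronskian_right := hg'.wronskian_ne hnc' hmap hG
  ne h := by
    refine hne (hg.eq_of_eventually_eq hg' (p := Φ w) ?_)
    rw [← hmap, eventually_map]
    filter_upwards [h, hF.eventually, hG.eventually] with z h1 h2 h3 using (h2.eq_iff h3).2 h1
  share α hα := by
    have : Φ w ∈ g ⁻¹' {α} ↔ Φ w ∈ g' ⁻¹' {α} := by rw [hA α hα]
    simpa using this

end surface

/-! ### Development of flat metrics with singularities at infinite distance -/

section development

variable {S : Type*} [TopologicalSpace S] [ChartedSpace ℂ S]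

/-- `L` is a flat conformal metric on the open set `U`, and the points of the complement of `U` are
isolated and at infinite distance. -/
structure IsFlatOn (L : (p : S) → TangentSpace 𝓘(ℂ) p → ℝ) (U : Set S) : Prop where
  homog : IsHomog L
  isOpen : IsOpen U
  flat : ∀ p ∈ U, LogHol (pull L (chartAt ℂ p).symm) (chartAt ℂ p p)
  sing : ∀ p ∉ U, ∃ c : ℝ, 0 < c ∧ ∀ᶠ z in 𝓝[≠] (chartAt ℂ p p),
    (chartAt ℂ p).symm z ∈ U ∧ c / ‖z - chartAt ℂ p p‖ ≤ pull L (chartAt ℂ p).symm z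

/-- Near `w`, `Φ` is a local isometry from the Euclidean plane to `U` with the metric `L`. -/
def IsoAt (L : (p : S) → TangentSpace 𝓘(ℂ) p → ℝ) (U : Set S) (Φ : ℂ → S) (w : ℂ) : Prop :=
  HolAt Φ w ∧ ∀ᶠ z in 𝓝 w, Φ z ∈ U ∧ pull L Φ z = 1

variable {L : (p : S) → TangentSpace 𝓘(ℂ) p → ℝ} {U : Set S} {Φ Ψ : ℂ → S} {w : ℂ}

theorem IsoAt.congr (h : IsoAt L U Φ w) (he : Ψ =ᶠ[𝓝 w] Φ) : IsoAt L U Ψ w := by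
  refine ⟨h.1.congr he, ?_⟩
  filter_upwards [h.2, he.eventually_nhds] with z h1 h2
  rw [h2.self_of_nhds, pull_congr h2]
  exact h1

theorem IsoAt.eventually (h : IsoAt L U Φ w) : ∀ᶠ z in 𝓝 w, IsoAt L U Φ z := by
  filter_upwards [h.1.eventually, h.2.eventually_nhds] with z h1 h2 using ⟨h1, h2⟩

theorem IsoAt.mem (h : IsoAt L U Φ w) : Φ w ∈ U := h.2.self_of_nhds.1

theorem IsoAt.pull_eq (h : IsoAt L U Φ w) : pull L Φ w = 1 := h.2.self_of_nhds.2

/-- Gluing of maps that agree on overlaps. -/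
theorem exists_glue {X Y ι : Type*} [Nonempty Y] (V : ι → Set X) (f : ι → X → Y)
    (h : ∀ i j, ∀ x ∈ V i, x ∈ V j → f i x = f j x) : ∃ F : X → Y, ∀ i, ∀ x ∈ V i, F x = f i x := by
  classical
  refine ⟨fun x => if hx : ∃ i, x ∈ V i then f hx.choose x else Classical.arbitrary Y,
    fun i x hx => ?_⟩
  have hx' : ∃ i, x ∈ V i := ⟨i, hx⟩
  simp only [dif_pos hx']
  exact h _ _ x hx'.choose_spec hx

/-- Gluing of local isometries, the first of which fixes the germ at the origin. -/
theorem exists_glue_isoAt {ι : Type*} (V : ι → Set ℂ) (hV : ∀ i, IsOpen (V i))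
    (f : ι → ℂ → S) (hf : ∀ i, ∀ z ∈ V i, IsoAt L U (f i) z)
    (h : ∀ i j, ∀ x ∈ V i, x ∈ V j → f i x = f j x) {i₀ : ι} {z₀ : ℂ} (hz₀ : z₀ ∈ V i₀) :
    ∃ F : ℂ → S, (∀ i, ∀ z ∈ V i, IsoAt L U F z) ∧ F =ᶠ[𝓝 z₀] f i₀ := by
  have : Nonempty S := ⟨f i₀ z₀⟩
  obtain ⟨F, hF⟩ := exists_glue V f h
  have hev : ∀ i, ∀ z ∈ V i, F =ᶠ[𝓝 z] f i := fun i z hz => by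
    filter_upwards [(hV i).mem_nhds hz] with y hy using hF i y hy
  exact ⟨F, fun i z hz => (hf i z hz).congr (hev i z hz), hev i₀ z₀ hz₀⟩

variable [IsManifold 𝓘(ℂ) ω S]

/-- Flat coordinates: `Q` is a local isometry with local inverse `P`. -/
theorem IsFlatOn.exists_coord (hL : IsFlatOn L U) {p : S} (hp : p ∈ U) :
    ∃ δ > 0, ∃ (Q : ℂ → S) (P : S → ℂ), (∀ z ∈ Metric.ball (0 : ℂ) (2 * δ), IsoAt L U Q z) ∧
      ∀ᶠ x in 𝓝 p, P x ∈ Metric.ball (0 : ℂ) δ ∧ Q (P x) = x ∧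
        MDifferentiableAt 𝓘(ℂ) 𝓘(ℂ) P x := by
  set φ := chartAt ℂ p
  set z₀ := φ p
  have ht : z₀ ∈ φ.target := mem_chart_target ℂ p
  have hs : p ∈ φ.source := mem_chart_source ℂ p
  have hp0 : φ.symm z₀ = p := φ.left_inv hs
  obtain ⟨k, hk, hke⟩ := hL.flat p hp
  have hU : ∀ᶠ z in 𝓝 z₀, φ.symm z ∈ U :=
    (φ.symm.continuousAt ht).eventually (by rw [hp0]; exact hL.isOpen.mem_nhds hp)
  obtain ⟨r, hr, hball⟩ := Metric.eventually_nhds_iff_ball.1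
    ((hk.eventually_analyticAt.and hke).and (hU.and (φ.open_target.mem_nhds ht)))
  have hex : DifferentiableOn ℂ (fun z => Complex.exp (k z)) (Metric.ball z₀ r) := fun z hz =>
    (hball z hz).1.1.differentiableAt.cexp.differentiableWithinAt
  obtain ⟨P₀, hP₀, hP₀'⟩ := hex.isExactOn_ball.with_val_at z₀ 0
  have hz₀ : z₀ ∈ Metric.ball z₀ r := Metric.mem_ball_self hr
  have hPa : AnalyticAt ℂ P₀ z₀ := by
    rw [Complex.analyticAt_iff_eventually_differentiableAt]
    filter_upwards [Metric.ball_mem_nhds z₀ hr] with z hz using (hP₀' z hz).differentiableAt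
  have hst : HasStrictDerivAt P₀ (Complex.exp (k z₀)) z₀ := by
    rw [← (hP₀' z₀ hz₀).deriv]; exact hPa.hasStrictDerivAt
  have hsf := hst.hasStrictFDerivAt_equiv (Complex.exp_ne_zero _)
  set e := hsf.toOpenPartialHomeomorph P₀ with he
  have hecoe : (e : ℂ → ℂ) = P₀ := hsf.toOpenPartialHomeomorph_coe
  have hes : z₀ ∈ e.source := hsf.mem_toOpenPartialHomeomorph_source
  have he0 : e z₀ = 0 := by rw [hecoe, hP₀]
  have het : (0 : ℂ) ∈ e.target := he0 ▸ e.map_source hes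
  have hes0 : e.symm 0 = z₀ := by rw [← he0]; exact e.left_inv hes
  have hnear : ∀ᶠ y in 𝓝 (0 : ℂ), y ∈ e.target ∧ e.symm y ∈ Metric.ball z₀ r := by
    refine (e.open_target.eventually_mem het).and ?_
    exact (e.symm.continuousAt het).eventually
      (by rw [hes0]; exact Metric.ball_mem_nhds z₀ hr)
  obtain ⟨ρ, hρ, hρball⟩ := Metric.eventually_nhds_iff_ball.1 hnear
  have hder : ∀ y ∈ Metric.ball (0 : ℂ) ρ,
      HasDerivAt e.symm (Complex.exp (k (e.symm y)))⁻¹ y := by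
    intro y hy
    obtain ⟨h1, h2⟩ := hρball y hy
    refine e.hasDerivAt_symm h1 (Complex.exp_ne_zero _) ?_
    rw [hecoe]
    exact hP₀' _ h2
  refine ⟨ρ / 2, by positivity, φ.symm ∘ e.symm, P₀ ∘ φ, ?_, ?_⟩
  · rw [mul_div_cancel₀ _ (two_ne_zero)]
    intro y hy
    have hnb : Metric.ball (0 : ℂ) ρ ∈ 𝓝 y := Metric.isOpen_ball.mem_nhds hy
    have hya : AnalyticAt ℂ e.symm y := by
      rw [Complex.analyticAt_iff_eventually_differentiableAt]
      filter_upwards [hnb] with z hz using (hder z hz).differentiableAt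
    refine ⟨(holAt_chart_symm p (hball _ (hρball y hy).2).2.2).comp hya, ?_⟩
    filter_upwards [hnb] with z hz
    obtain ⟨⟨h1, h2⟩, h3, h4⟩ := hball _ (hρball z hz).2
    refine ⟨h3, ?_⟩
    rw [pull_comp hL.homog (holAt_chart_symm p h4).mdifferentiableAt (hder z hz).differentiableAt,
      h2, (hder z hz).deriv, norm_inv, Complex.norm_exp, mul_inv_cancel₀ (Real.exp_pos _).ne']
  · have hc1 : ContinuousAt φ p := φ.continuousAt hs
    have hc2 : ContinuousAt P₀ z₀ := hPa.continuousAt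
    have h1 : ∀ᶠ x in 𝓝 p, P₀ (φ x) ∈ Metric.ball (0 : ℂ) (ρ / 2) := by
      refine hc1.eventually (p := fun z => P₀ z ∈ Metric.ball (0 : ℂ) (ρ / 2)) ?_
      exact hc2.eventually (by rw [hP₀]; exact Metric.ball_mem_nhds _ (by positivity))
    filter_upwards [h1, φ.open_source.mem_nhds hs,
      hc1.eventually (e.open_source.mem_nhds hes),
      hc1.eventually (Metric.ball_mem_nhds z₀ hr)] with x hx1 hx2 hx3 hx4
    refine ⟨hx1, ?_, ?_⟩
    · simp only [Function.comp]
      rw [← hecoe, e.left_inv hx3, φ.left_inv hx2]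
    · exact (hP₀' _ hx4).differentiableAt.mdifferentiableAt.comp x
        (mdifferentiableAt_atlas (chart_mem_atlas ℂ p) hx2)

/-- Local isometries at points near `p` extend to discs of a definite radius. -/
theorem IsFlatOn.exists_extension (hL : IsFlatOn L U) {p : S} (hp : p ∈ U) :
    ∃ δ > 0, ∀ᶠ x in 𝓝 p, ∀ (Φ : ℂ → S) (w : ℂ), IsoAt L U Φ w → Φ w = x →
      ∃ Ψ : ℂ → S, (∀ z ∈ Metric.ball w δ, IsoAt L U Ψ z) ∧ Ψ =ᶠ[𝓝 w] Φ := by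
  obtain ⟨δ, hδ, Q, P, hQ, hP⟩ := hL.exists_coord hp
  refine ⟨δ, hδ, ?_⟩
  filter_upwards [hP.eventually_nhds] with x hx Φ w hΦ hΦx
  subst hΦx
  set ξ : ℂ → ℂ := P ∘ Φ
  have hnear : ∀ᶠ z in 𝓝 w, ξ z ∈ Metric.ball (0 : ℂ) δ ∧ Q (ξ z) = Φ z ∧
      MDifferentiableAt 𝓘(ℂ) 𝓘(ℂ) P (Φ z) := hΦ.1.continuousAt.eventually hx
  have hξ : AnalyticAt ℂ ξ w := by
    rw [Complex.analyticAt_iff_eventually_differentiableAt]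
    filter_upwards [hnear, hΦ.1] with z h1 h2
    exact (h1.2.2.comp z h2).differentiableAt
  have hsub : Metric.ball (0 : ℂ) δ ⊆ Metric.ball 0 (2 * δ) :=
    Metric.ball_subset_ball (by linarith)
  have hnorm : ∀ᶠ z in 𝓝 w, ‖deriv ξ z‖ = 1 := by
    filter_upwards [hnear.eventually_nhds, hΦ.2, hξ.eventually_analyticAt] with z h1 h2 h3
    have e1 : pull L Φ z = pull L (Q ∘ ξ) z :=
      pull_congr (h1.mono fun y hy => hy.2.1.symm)
    have hz := hQ _ (hsub h1.self_of_nhds.1)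
    rw [h2.2, pull_comp hL.homog hz.1.mdifferentiableAt h3.differentiableAt, hz.pull_eq,
      one_mul] at e1
    exact e1.symm
  -- a holomorphic function of constant modulus is constant
  have hconst : ∀ᶠ z in 𝓝 w, deriv ξ z = deriv ξ w := by
    refine Complex.eventually_eq_of_isLocalMax_norm
      (hξ.deriv.eventually_analyticAt.mono fun z hz => hz.differentiableAt) ?_
    filter_upwards [hnorm] with z hz
    simp only [Function.comp, hz, hnorm.self_of_nhds, le_refl]
  obtain ⟨r, hr, hball⟩ := Metric.eventually_nhds_iff_ball.1
    (hconst.and hξ.eventually_analyticAt)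
  set h : ℂ → ℂ := fun z => ξ w + deriv ξ w * (z - w) with hh
  have hhd : ∀ z, HasDerivAt h (deriv ξ w) z := fun z =>
    ((((hasDerivAt_id z).sub_const w).const_mul (deriv ξ w)).const_add (ξ w)).congr_deriv
      (mul_one _)
  have hξh : ∀ z ∈ Metric.ball w r, ξ z = h z := by
    intro z hz
    have := Metric.isOpen_ball.is_const_of_deriv_eq_zero (f := fun z => ξ z - h z)
      (convex_ball w r).isPreconnected
      (fun y hy => ((hball y hy).2.differentiableAt.sub
        (hhd y).differentiableAt).differentiableWithinAt)
      (fun y hy => by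
        have := (((hball y hy).2.differentiableAt.hasDerivAt).sub (hhd y)).deriv
        rw [(hball y hy).1, sub_self] at this
        exact this) hz (Metric.mem_ball_self hr)
    simp only [hh, sub_self, mul_zero, add_zero] at this
    rw [hh]
    exact sub_eq_zero.1 this
  have hha : ∀ z, AnalyticAt ℂ h z := fun z => by
    rw [Complex.analyticAt_iff_eventually_differentiableAt]
    exact Eventually.of_forall fun y => (hhd y).differentiableAt
  have hmem : ∀ z ∈ Metric.ball w δ, h z ∈ Metric.ball (0 : ℂ) (2 * δ) := by
    intro z hz
    have h1 := hnear.self_of_nhds.1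
    rw [Metric.mem_ball, dist_zero_right] at h1 ⊢
    rw [Metric.mem_ball, dist_eq_norm] at hz
    calc ‖h z‖ ≤ ‖ξ w‖ + ‖deriv ξ w * (z - w)‖ := norm_add_le _ _
      _ = ‖ξ w‖ + ‖z - w‖ := by rw [norm_mul, hnorm.self_of_nhds, one_mul]
      _ < _ := by linarith
  refine ⟨Q ∘ h, fun z hz => ?_, ?_⟩
  · have hz' := hQ _ (hmem z hz)
    refine ⟨hz'.1.comp (hha z), ?_⟩
    filter_upwards [(hha z).continuousAt.eventually hz'.eventually] with y hy
    refine ⟨hy.mem, ?_⟩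
    rw [pull_comp hL.homog hy.1.mdifferentiableAt (hhd y).differentiableAt, hy.pull_eq,
      (hhd y).deriv, hnorm.self_of_nhds, one_mul]
  · filter_upwards [hnear, Metric.ball_mem_nhds w hr] with z h1 h2
    rw [← h1.2.1, Function.comp, hξh z h2]

/-- **Identity theorem** for holomorphic maps from plane domains to a Riemann surface. -/
theorem HolAt.eventuallyEq_of_isPreconnected [T2Space S] {D : Set ℂ} (hD : IsPreconnected D)
    (hΦ : ∀ z ∈ D, HolAt Φ z) (hΨ : ∀ z ∈ D, HolAt Ψ z) {z₀ : ℂ} (hz₀ : z₀ ∈ D)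
    (h : Φ =ᶠ[𝓝 z₀] Ψ) : ∀ z ∈ D, Φ =ᶠ[𝓝 z] Ψ := by
  have hsub := hD.subset_of_closure_inter_subset (u := {z | Φ =ᶠ[𝓝 z] Ψ})
    isOpen_setOfPred_eventually_nhds ⟨z₀, hz₀, h⟩ ?_
  · exact fun z hz => hsub hz
  rintro z ⟨hzc, hzD⟩
  have hfreq0 : ∃ᶠ y in 𝓝 z, Φ =ᶠ[𝓝 y] Ψ := mem_closure_iff_frequently.1 hzc
  have hΦz := hΦ z hzD
  have hΨz := hΨ z hzD
  have heq : Φ z = Ψ z := tendsto_nhds_unique_of_frequently_eq hΦz.continuousAt hΨz.continuousAt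
    (hfreq0.mono fun y hy => hy.eq_of_nhds)
  have hs : Φ z ∈ (chartAt ℂ (Φ z)).source := mem_chart_source ℂ _
  have hs' : Ψ z ∈ (chartAt ℂ (Φ z)).source := heq ▸ hs
  have hfreq : ∃ᶠ y in 𝓝[≠] z, (chartAt ℂ (Φ z) ∘ Φ) y = (chartAt ℂ (Φ z) ∘ Ψ) y := by
    rw [frequently_nhdsWithin_iff, frequently_iff]
    intro V hV
    obtain ⟨W, hWV, hWo, hzW⟩ := mem_nhds_iff.1 hV
    obtain ⟨y, hyW, hy⟩ := frequently_iff.1 hfreq0 (hWo.mem_nhds hzW)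
    have h3 : ∀ᶠ x in 𝓝[≠] y, x ≠ z := by
      by_cases hyz : y = z
      · rw [hyz]; exact self_mem_nhdsWithin
      · exact nhdsWithin_le_nhds (isOpen_ne.mem_nhds hyz)
    obtain ⟨x, hx1, hx2, hx3⟩ := ((Eventually.filter_mono nhdsWithin_le_nhds hy).and
      ((Eventually.filter_mono nhdsWithin_le_nhds (hWo.eventually_mem hyW)).and h3)).exists
    exact ⟨x, hWV hx2, by simp only [Function.comp, show Φ x = Ψ x from hx1], hx3⟩
  have hev := ((hΦz.analyticAt_chart hs).frequently_eq_iff_eventually_eq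
    (hΨz.analyticAt_chart hs')).1 hfreq
  change ∀ᶠ y in 𝓝 z, Φ y = Ψ y
  filter_upwards [hev, hΦz.eventually_eq_chart hs, hΨz.eventually_eq_chart hs'] with y h1 h2 h3
  rw [h2.2, h3.2]
  simp only [Function.comp] at h1 ⊢
  rw [h1]

/-- A maximal isometric disc with a given germ at its centre. -/
theorem exists_maximal_disc [T2Space S] {Φ₀ : ℂ → S} (h0 : IsoAt L U Φ₀ 0)
    {R₁ : ℝ} (hbdd : ∀ (r : ℝ) (Φ : ℂ → S), (∀ z ∈ Metric.ball (0 : ℂ) r, IsoAt L U Φ z) →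
      Φ =ᶠ[𝓝 0] Φ₀ → r ≤ R₁) :
    ∃ R > 0, ∃ Φ : ℂ → S, (∀ z ∈ Metric.ball (0 : ℂ) R, IsoAt L U Φ z) ∧ Φ =ᶠ[𝓝 0] Φ₀ ∧
      ∀ (r : ℝ) (Ψ : ℂ → S), (∀ z ∈ Metric.ball (0 : ℂ) r, IsoAt L U Ψ z) →
        Ψ =ᶠ[𝓝 0] Φ₀ → r ≤ R := by
  set T : Set ℝ := {r | 0 < r ∧ ∃ Φ : ℂ → S, (∀ z ∈ Metric.ball (0 : ℂ) r, IsoAt L U Φ z) ∧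
    Φ =ᶠ[𝓝 0] Φ₀}
  obtain ⟨r₀, hr₀, hball⟩ := Metric.eventually_nhds_iff_ball.1 h0.eventually
  have hT₀ : r₀ ∈ T := ⟨hr₀, Φ₀, hball, EventuallyEq.rfl⟩
  have hTb : BddAbove T := ⟨R₁, fun r ⟨_, Φ, h1, h2⟩ => hbdd r Φ h1 h2⟩
  have hR : 0 < sSup T := hr₀.trans_le (le_csSup hTb hT₀)
  choose f hf hf0 using fun r : T => r.2.2
  have hcompat : ∀ i j : T, ∀ x ∈ Metric.ball (0 : ℂ) i, x ∈ Metric.ball (0 : ℂ) j →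
      f i x = f j x := by
    intro i j x hi hj
    refine (HolAt.eventuallyEq_of_isPreconnected
      (((convex_ball (0 : ℂ) i).inter (convex_ball (0 : ℂ) j)).isPreconnected)
      (fun z hz => (hf i z hz.1).1) (fun z hz => (hf j z hz.2).1) (z₀ := 0)
      ⟨Metric.mem_ball_self i.2.1, Metric.mem_ball_self j.2.1⟩
      ((hf0 i).trans (hf0 j).symm) x ⟨hi, hj⟩).eq_of_nhds
  obtain ⟨F, hF, hF0⟩ := exists_glue_isoAt (fun i : T => Metric.ball (0 : ℂ) i)
    (fun i => Metric.isOpen_ball) f hf hcompat (i₀ := ⟨r₀, hT₀⟩) (z₀ := 0)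
    (Metric.mem_ball_self hr₀)
  refine ⟨sSup T, hR, F, fun z hz => ?_, hF0.trans (hf0 _), fun r Ψ h1 h2 => ?_⟩
  · obtain ⟨r, hr, hzr⟩ := exists_lt_of_lt_csSup ⟨r₀, hT₀⟩ (by simpa using hz : ‖z‖ < sSup T)
    exact hF ⟨r, hr⟩ z (by simpa using hzr)
  · by_cases hr : 0 < r
    · exact le_csSup hTb ⟨hr, Ψ, h1, h2⟩
    · linarith

/-- A maximal isometric disc has a radius along which it has no limit point in the flat part:
otherwise it could be extended across each boundary point. -/
theorem exists_ray_of_maximal [T2Space S] (hL : IsFlatOn L U) {R : ℝ} (hR : 0 < R) {Φ : ℂ → S}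
    (hΦ : ∀ z ∈ Metric.ball (0 : ℂ) R, IsoAt L U Φ z)
    (hmax : ∀ (r : ℝ) (Ψ : ℂ → S), (∀ z ∈ Metric.ball (0 : ℂ) r, IsoAt L U Ψ z) →
        Ψ =ᶠ[𝓝 0] Φ → r ≤ R) :
    ∃ a : ℂ, ‖a‖ = R ∧ ∀ p ∈ U, ¬ MapClusterPt p (𝓝[<] (1 : ℝ)) fun t => Φ (t * a) := by
  by_contra! hcon
  have hext : ∀ a : {a : ℂ // ‖a‖ = R}, ∃ (c : ℂ) (δ : ℝ) (Ψ : ℂ → S), c ∈ Metric.ball (0 : ℂ) R ∧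
      0 < δ ∧ (∀ z ∈ Metric.ball c δ, IsoAt L U Ψ z) ∧ Ψ =ᶠ[𝓝 c] Φ ∧
        (a : ℂ) ∈ Metric.ball c (δ / 2) := by
    rintro ⟨a, ha⟩
    obtain ⟨p, hp, hcl⟩ := hcon a ha
    obtain ⟨δ, hδ, hev⟩ := hL.exists_extension hp
    have hfreq := mapClusterPt_iff_frequently.1 hcl _ hev
    have hlim : Tendsto (fun t : ℝ => (t : ℂ) * a) (𝓝[<] 1) (𝓝 a) := by
      have : Continuous fun t : ℝ => (t : ℂ) * a := by fun_prop
      simpa using (this.tendsto 1).mono_left nhdsWithin_le_nhds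
    have h1 : ∀ᶠ t : ℝ in 𝓝[<] 1, (t : ℂ) * a ∈ Metric.ball a (δ / 2) :=
      hlim (Metric.ball_mem_nhds a (by positivity))
    have h2 : ∀ᶠ t : ℝ in 𝓝[<] 1, (t : ℂ) * a ∈ Metric.ball (0 : ℂ) R := by
      filter_upwards [Ioo_mem_nhdsLT (zero_lt_one (α := ℝ))] with t ht
      simp only [Metric.mem_ball, dist_zero_right, norm_mul, Complex.norm_real, ha,
        Real.norm_of_nonneg ht.1.le]
      nlinarith [ht.2]
    obtain ⟨t, ht, ht1, ht2⟩ := (hfreq.and_eventually (h1.and h2)).exists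
    obtain ⟨Ψ, hΨ, hΨe⟩ := ht Φ _ (hΦ _ ht2) rfl
    exact ⟨t * a, δ, Ψ, ht2, hδ, hΨ, hΨe, by rwa [Metric.mem_ball, dist_comm]⟩
  choose c δ f hc hδ hf hfe hmem using hext
  have hpre : ∀ a b : {a : ℂ // ‖a‖ = R}, IsPreconnected (Metric.ball (c a) (δ a) ∩
      Metric.ball (c b) (δ b)) := fun a b => ((convex_ball _ _).inter (convex_ball _ _)).isPreconnected
  have h0 : ∀ a, ∀ z ∈ Metric.ball (0 : ℂ) R, z ∈ Metric.ball (c a) (δ a) → f a =ᶠ[𝓝 z] Φ := by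
    intro a z hz hz'
    exact HolAt.eventuallyEq_of_isPreconnected
      (((convex_ball (0 : ℂ) R).inter (convex_ball (c a) (δ a))).isPreconnected)
      (fun z hz => (hf a z hz.2).1) (fun z hz => (hΦ z hz.1).1) (z₀ := c a)
      ⟨hc a, Metric.mem_ball_self (hδ a)⟩ (hfe a) z ⟨hz, hz'⟩
  -- if two half-size discs meet, the centre of one lies in the other full-size disc
  have h1 : ∀ a b, δ b ≤ δ a → ∀ z ∈ Metric.ball (c a) (δ a / 2), z ∈ Metric.ball (c b) (δ b / 2) →
      f a z = f b z := by
    intro a b hab z hza hzb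
    have hcb : c b ∈ Metric.ball (c a) (δ a) := by
      rw [Metric.mem_ball] at *
      have := dist_triangle_left (c b) (c a) z
      linarith
    have hcb' : c b ∈ Metric.ball (c b) (δ b) := Metric.mem_ball_self (hδ b)
    refine (HolAt.eventuallyEq_of_isPreconnected (hpre a b) (fun z hz => (hf a z hz.1).1)
      (fun z hz => (hf b z hz.2).1) (z₀ := c b) ⟨hcb, hcb'⟩
      ((h0 a _ (hc b) hcb).trans (hfe b).symm) z ⟨?_, ?_⟩).eq_of_nhds
    · exact Metric.ball_subset_ball (by linarith [hδ a]) hza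
    · exact Metric.ball_subset_ball (by linarith [hδ b]) hzb
  set V : Option {a : ℂ // ‖a‖ = R} → Set ℂ := fun i =>
    i.elim (Metric.ball (0 : ℂ) R) fun a => Metric.ball (c a) (δ a / 2) with hV
  set g : Option {a : ℂ // ‖a‖ = R} → ℂ → S := fun i => i.elim Φ f with hg
  have hsub : ∀ a, Metric.ball (c a) (δ a / 2) ⊆ Metric.ball (c a) (δ a) := fun a =>
    Metric.ball_subset_ball (by linarith [hδ a])
  have hVo : ∀ i, IsOpen (V i) := by
    rintro (_ | a) <;> exact Metric.isOpen_ball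
  obtain ⟨F, hF, hF0⟩ := exists_glue_isoAt (L := L) (U := U) V hVo g (by
      rintro (_ | a) z hz
      · exact hΦ z hz
      · exact hf a z (hsub a hz)) (by
      rintro (_ | a) (_ | b) z hz hz'
      · rfl
      · exact (h0 b z hz (hsub b hz')).eq_of_nhds.symm
      · exact (h0 a z hz' (hsub a hz)).eq_of_nhds
      · rcases le_total (δ b) (δ a) with h | h
        · exact h1 a b h z hz hz'
        · exact (h1 b a h z hz' hz).symm) (i₀ := none) (z₀ := 0) (Metric.mem_ball_self hR)
  have hcover : Metric.closedBall (0 : ℂ) R ⊆ ⋃ i, V i := by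
    intro z hz
    have hz' : ‖z‖ ≤ R := by simpa using hz
    rcases hz'.lt_or_eq with h | h
    · exact Set.mem_iUnion.2 ⟨none, by simpa [hV] using h⟩
    · exact Set.mem_iUnion.2 ⟨some ⟨z, h⟩, hmem ⟨z, h⟩⟩
  obtain ⟨ε, hε, hthick⟩ := (isCompact_closedBall (0 : ℂ) R).exists_thickening_subset_open
    (isOpen_iUnion hVo) hcover
  rw [thickening_closedBall hε hR.le] at hthick
  have := hmax (ε + R) F (fun z hz => by
    obtain ⟨i, hi⟩ := Set.mem_iUnion.1 (hthick hz)
    exact hF i z hi) hF0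
  linarith

/-- Points outside `U` are at infinite distance, so a ray without limit points in `U` has no limit
points at all. -/
theorem tendsto_cocompact_of_ray [T2Space S] (hL : IsFlatOn L U) {R : ℝ} (hR : 0 < R)
    {Φ : ℂ → S} (hΦ : ∀ z ∈ Metric.ball (0 : ℂ) R, IsoAt L U Φ z) {a : ℂ} (ha : ‖a‖ = R)
    (hray : ∀ p ∈ U, ¬ MapClusterPt p (𝓝[<] (1 : ℝ)) fun t => Φ (t * a)) :
    Tendsto (fun t : ℝ => Φ (t * a)) (𝓝[<] 1) (cocompact S) := by
  set γ : ℝ → S := fun t => Φ (t * a) with hγ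
  have hmemball : ∀ t : ℝ, 0 ≤ t → t < 1 → (t : ℂ) * a ∈ Metric.ball (0 : ℂ) R := by
    intro t ht ht'
    simp only [Metric.mem_ball, dist_zero_right, norm_mul, Complex.norm_real, ha,
      Real.norm_of_nonneg ht]
    nlinarith
  suffices hall : ∀ p, ¬ MapClusterPt p (𝓝[<] (1 : ℝ)) γ by
    refine tendsto_iff_forall_eventually_mem.2 fun s hs => ?_
    obtain ⟨K, hK, hKs⟩ := mem_cocompact.1 hs
    have : ¬ ∃ᶠ t in 𝓝[<] (1 : ℝ), γ t ∈ K := fun h => by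
      obtain ⟨p, -, hp⟩ := hK.exists_mapClusterPt_of_frequently h
      exact hall p hp
    filter_upwards [not_frequently.1 this] with t ht using hKs ht
  intro p hcl
  have hpU : p ∉ U := fun h => hray p h hcl
  set φ := chartAt ℂ p
  set z₀ := φ p
  have ht : z₀ ∈ φ.target := mem_chart_target ℂ p
  have hs : p ∈ φ.source := mem_chart_source ℂ p
  obtain ⟨c, hc, hcev⟩ := hL.sing p hpU
  obtain ⟨ρ, hρ, hball⟩ := Metric.eventually_nhds_iff_ball.1
    ((eventually_nhdsWithin_iff.1 hcev).and (φ.open_target.mem_nhds ht))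
  set C : ℝ := 2 * R / c with hC
  have hCpos : 0 < C := by positivity
  -- a time close to `1` at which the ray is near `p`
  obtain ⟨t₀, ht₀1, ht₀2, ht₀3, ht₀s, ht₀b⟩ : ∃ t₀ : ℝ, 0 < t₀ ∧ t₀ < 1 ∧ C * (1 - t₀) ≤ Real.log 2 ∧
      γ t₀ ∈ φ.source ∧ φ (γ t₀) ∈ Metric.ball z₀ (ρ / 2) := by
    have h1 : ∀ᶠ x in 𝓝 p, x ∈ φ.source ∧ φ x ∈ Metric.ball z₀ (ρ / 2) :=
      (φ.open_source.eventually_mem hs).and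
        ((φ.continuousAt hs).eventually (Metric.ball_mem_nhds _ (by positivity)))
    have h2 : ∀ᶠ t : ℝ in 𝓝[<] 1, C * (1 - t) ≤ Real.log 2 := by
      have h3 : Tendsto (fun t : ℝ => C * (1 - t)) (𝓝[<] 1) (𝓝 0) := by
        have : Continuous fun t : ℝ => C * (1 - t) := by fun_prop
        simpa using (this.tendsto 1).mono_left nhdsWithin_le_nhds
      filter_upwards [h3.eventually (gt_mem_nhds (Real.log_pos one_lt_two))] with t ht using ht.le
    obtain ⟨t, h3, h4, h5⟩ := ((mapClusterPt_iff_frequently.1 hcl _ h1).and_eventually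
      (h2.and (Ioo_mem_nhdsLT (zero_lt_one (α := ℝ))))).exists
    exact ⟨t, h5.1, h5.2, h4, h3.1, h3.2⟩
  set r := ‖φ (γ t₀) - z₀‖ with hr
  have hiso : ∀ t, t₀ ≤ t → t < 1 → IsoAt L U Φ (t * a) := fun t h1 h2 =>
    hΦ _ (hmemball t (ht₀1.le.trans h1) h2)
  have hγne : ∀ t, t₀ ≤ t → t < 1 → γ t ∈ φ.source → φ (γ t) ≠ z₀ := by
    intro t h1 h2 h3 h4
    have : γ t = p := by rw [← φ.left_inv h3, h4, φ.left_inv hs]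
    exact hpU (this ▸ (hiso t h1 h2).mem)
  have hrpos : 0 < r := norm_pos_iff.2 (sub_ne_zero.2 (hγne t₀ le_rfl ht₀2 ht₀s))
  have hrρ : r < ρ / 2 := by simpa [dist_eq_norm] using ht₀b
  -- the compact annulus in which the ray stays
  set N : Set ℂ := {z | r / 2 ≤ ‖z - z₀‖ ∧ ‖z - z₀‖ ≤ 2 * r} with hN
  have hNc : IsCompact N := by
    refine (isCompact_closedBall z₀ (2 * r)).of_isClosed_subset ?_ fun z hz => ?_
    · have hcont : Continuous fun z : ℂ => ‖z - z₀‖ := by fun_prop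
      exact (isClosed_le continuous_const hcont).inter (isClosed_le hcont continuous_const)
    · simpa [dist_eq_norm] using hz.2
  have hNball : ∀ z ∈ N, z ∈ Metric.ball z₀ ρ ∧ z ≠ z₀ := by
    intro z hz
    refine ⟨?_, fun h => ?_⟩
    · rw [Metric.mem_ball, dist_eq_norm]; linarith [hz.2]
    · have := hz.1
      rw [h, sub_self, norm_zero] at this
      linarith
  set K : Set S := φ.symm '' N with hK
  have hKc : IsCompact K :=
    hNc.image_of_continuousOn (φ.continuousOn_symm.mono fun z hz => (hball z (hNball z hz).1).2)
  have hKU : K ⊆ U := by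
    rintro _ ⟨z, hz, rfl⟩
    exact ((hball z (hNball z hz).1).1 (hNball z hz).2).1
  have hKs : ∀ x ∈ K, x ∈ φ.source ∧ φ x ∈ N := by
    rintro _ ⟨z, hz, rfl⟩
    have hzt := (hball z (hNball z hz).1).2
    exact ⟨φ.map_target hzt, by rwa [φ.right_inv hzt]⟩
  have hKmem : ∀ t, t₀ ≤ t → t < 1 → γ t ∈ φ.source →
      |Real.log ‖φ (γ t) - z₀‖ - Real.log r| ≤ C * (t - t₀) → γ t ∈ K := by
    intro t h1 h2 h3 h4
    have hpos : 0 < ‖φ (γ t) - z₀‖ := norm_pos_iff.2 (sub_ne_zero.2 (hγne t h1 h2 h3))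
    have h5 : C * (t - t₀) ≤ Real.log 2 := le_trans (by gcongr) ht₀3
    have h6 := abs_le.1 (h4.trans h5)
    refine ⟨φ (γ t), ⟨?_, ?_⟩, φ.left_inv h3⟩
    · rw [← Real.log_le_log_iff (by positivity) hpos, Real.log_div hrpos.ne' two_ne_zero]
      linarith
    · rw [← Real.log_le_log_iff hpos (by positivity), Real.log_mul two_ne_zero hrpos.ne']
      linarith
  have hγc : ∀ t, t₀ ≤ t → t < 1 → ContinuousAt γ t := by
    intro t h1 h2
    have : ContinuousAt (fun t : ℝ => (t : ℂ) * a) t := by fun_prop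
    exact ContinuousAt.comp (f := fun t : ℝ => (t : ℂ) * a) (hiso t h1 h2).1.continuousAt this
  have hstay : ∀ b, b < 1 → Set.Icc t₀ b ⊆
      {t | γ t ∈ K ∧ |Real.log ‖φ (γ t) - z₀‖ - Real.log r| ≤ C * (t - t₀)} := by
    intro b hb
    refine IsClosed.Icc_subset_of_forall_exists_gt ?_ ?_ ?_
    · have hB : IsClosed (Set.Icc t₀ b ∩ γ ⁻¹' K) :=
        ContinuousOn.preimage_isClosed_of_isClosed
          (fun t ht => (hγc t ht.1 (ht.2.trans_lt hb)).continuousWithinAt) isClosed_Icc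
          hKc.isClosed
      have := hB.isClosed_le (f := fun t => |Real.log ‖φ (γ t) - z₀‖ - Real.log r|)
        (g := fun t => C * (t - t₀)) ?_ (by fun_prop)
      · convert this using 1
        ext t
        simp only [Set.mem_inter_iff, Set.mem_ofPred_eq, Set.mem_preimage]
        tauto
      · rintro t ⟨ht, htK⟩
        refine ContinuousAt.continuousWithinAt ?_
        have h1 : ContinuousAt (fun t => φ (γ t)) t :=
          ContinuousAt.comp (f := γ) (φ.continuousAt (hKs _ htK).1) (hγc t ht.1 (ht.2.trans_lt hb))
        refine ContinuousAt.abs (ContinuousAt.sub (ContinuousAt.log ?_ ?_) continuousAt_const)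
        · exact (h1.sub continuousAt_const).norm
        · exact (norm_pos_iff.2 (sub_ne_zero.2 (hNball _ (hKs _ htK).2).2)).ne'
    · have h1 : |Real.log ‖φ (γ t₀) - z₀‖ - Real.log r| ≤ C * (t₀ - t₀) := by simp [← hr]
      exact ⟨hKmem t₀ le_rfl ht₀2 ht₀s h1, h1⟩
    · rintro x ⟨⟨hxK, hxl⟩, hx0, hxb⟩ y hy
      have hx1 : x < 1 := hxb.trans hb
      set w : ℂ := x * a with hw
      have hisow := hiso x hx0 hx1
      have hxs : Φ w ∈ φ.source := (hKs _ hxK).1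
      have hζ := hisow.1.analyticAt_chart (p := p) hxs
      -- the logarithmic derivative of the chart coordinate is bounded along the ray
      have hne : (φ ∘ Φ) w - z₀ ≠ 0 := sub_ne_zero.2 (hNball _ (hKs _ hxK).2).2
      have hlow : c / ‖(φ ∘ Φ) w - z₀‖ ≤ pull L φ.symm ((φ ∘ Φ) w) :=
        ((hball _ (hNball _ (hKs _ hxK).2).1).1 (hNball _ (hKs _ hxK).2).2).2
      have hone := hisow.1.pull_eq_chart hL.homog (p := p) hxs
      rw [hisow.pull_eq] at hone
      have hder : ‖deriv (φ ∘ Φ) w‖ ≤ ‖(φ ∘ Φ) w - z₀‖ / c := by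
        have hpos : 0 < ‖(φ ∘ Φ) w - z₀‖ := norm_pos_iff.2 hne
        have h2 : c / ‖(φ ∘ Φ) w - z₀‖ * ‖deriv (φ ∘ Φ) w‖ ≤ 1 := by
          refine (mul_le_mul_of_nonneg_right hlow (norm_nonneg _)).trans ?_
          exact hone.ge
        rw [le_div_iff₀ hc]
        rw [div_mul_eq_mul_div, div_le_one hpos] at h2
        linarith
      obtain ⟨k, hk, hke⟩ := exists_exp_eq (H := fun z => (φ ∘ Φ) z - z₀)
        (hζ.sub analyticAt_const) hne
      have hkd : ‖deriv k w‖ ≤ 1 / c := by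
        have e1 : HasDerivAt (fun z => (φ ∘ Φ) z - z₀) (deriv (φ ∘ Φ) w) w :=
          hζ.differentiableAt.hasDerivAt.sub_const z₀
        have e2 : HasDerivAt (fun z => Complex.exp (k z)) (Complex.exp (k w) * deriv k w) w :=
          hk.differentiableAt.hasDerivAt.cexp
        have e3 := (e2.congr_of_eventuallyEq hke).unique e1
        rw [← hke.self_of_nhds] at e3
        rw [← e3, norm_mul] at hder
        have hpos : 0 < ‖(φ ∘ Φ) w - z₀‖ := norm_pos_iff.2 hne
        refine le_of_mul_le_mul_left ?_ hpos
        rw [mul_one_div]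
        exact hder
      have hkt : HasDerivAt (fun t : ℝ => k (t * a)) (deriv k w * a) x := by
        have e1 : HasDerivAt (fun t : ℝ => (t : ℂ) * a) a x := by
          simpa using (Complex.ofRealCLM.hasDerivAt (x := x)).mul_const a
        exact HasDerivAt.comp (h₂ := k) (h := fun t : ℝ => (t : ℂ) * a) x
          hk.differentiableAt.hasDerivAt e1
      have hsmall := (hasDerivAt_iff_isLittleO.1 hkt).def (c := R / c) (by positivity)
      have hlip : ∀ᶠ t : ℝ in 𝓝 x, ‖k (t * a) - k (x * a)‖ ≤ C * |t - x| := by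
        filter_upwards [hsmall] with t ht
        have e1 : ‖((t - x : ℝ) : ℂ) * (deriv k w * a)‖ ≤ |t - x| * (R / c) := by
          rw [norm_mul, norm_mul, ha, Complex.norm_real, Real.norm_eq_abs]
          have : ‖deriv k w‖ * R ≤ R / c := by
            have := mul_le_mul_of_nonneg_right hkd hR.le
            rwa [one_div_mul_eq_div] at this
          gcongr
        have e2 : k (t * a) - k (x * a) = (k (t * a) - k (x * a) - (t - x) • (deriv k w * a))
            + ((t - x : ℝ) : ℂ) * (deriv k w * a) := by
          rw [Complex.real_smul]; ring
        rw [e2]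
        refine (norm_add_le _ _).trans ?_
        calc _ ≤ R / c * ‖t - x‖ + |t - x| * (R / c) := add_le_add ht e1
          _ = C * |t - x| := by rw [hC, Real.norm_eq_abs]; ring
      have hlin : Tendsto (fun t : ℝ => (t : ℂ) * a) (𝓝 x) (𝓝 w) := by
        have : Continuous fun t : ℝ => (t : ℂ) * a := by fun_prop
        exact this.tendsto x
      have hlog : ∀ᶠ t : ℝ in 𝓝 x, Real.log ‖φ (γ t) - z₀‖ = (k (t * a)).re := by
        filter_upwards [hlin.eventually hke] with t ht
        have : φ (γ t) - z₀ = Complex.exp (k (t * a)) := ht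
        rw [this, Complex.norm_exp, Real.log_exp]
      have hsrc : ∀ᶠ t : ℝ in 𝓝 x, γ t ∈ φ.source :=
        (hγc x hx0 hx1).eventually (φ.open_source.mem_nhds hxs)
      have hev : ∀ᶠ t : ℝ in 𝓝[>] x, t ∈ Set.Ioc x y ∧ t < 1 ∧ γ t ∈ φ.source ∧
          Real.log ‖φ (γ t) - z₀‖ = (k (t * a)).re ∧ ‖k (t * a) - k (x * a)‖ ≤ C * |t - x| := by
        filter_upwards [Ioc_mem_nhdsGT hy, Ioo_mem_nhdsGT hx1, nhdsWithin_le_nhds hsrc,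
          nhdsWithin_le_nhds hlog, nhdsWithin_le_nhds hlip] with t h1 h2 h3 h4 h5
          using ⟨h1, h2.2, h3, h4, h5⟩
      obtain ⟨t, h1, h2, h3, h4, h5⟩ := hev.exists
      have htl : |Real.log ‖φ (γ t) - z₀‖ - Real.log r| ≤ C * (t - t₀) := by
        have e1 : |Real.log ‖φ (γ t) - z₀‖ - Real.log ‖φ (γ x) - z₀‖| ≤ C * (t - x) := by
          rw [h4, hlog.self_of_nhds, ← Complex.sub_re]
          refine (Complex.abs_re_le_norm _).trans (h5.trans ?_)
          rw [abs_of_pos (sub_pos.2 h1.1)]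
        have e2 := abs_sub_le (Real.log ‖φ (γ t) - z₀‖) (Real.log ‖φ (γ x) - z₀‖) (Real.log r)
        linarith
      exact ⟨t, ⟨hKmem t (hx0.trans h1.1.le) h2 h3 htl, htl⟩, h1⟩
  have hev : ∀ᶠ t in 𝓝[<] (1 : ℝ), γ t ∈ K := by
    filter_upwards [Ioo_mem_nhdsLT ht₀2] with t ht
    exact (hstay t ht.2 ⟨ht.1.le, le_rfl⟩).1
  obtain ⟨p', hp', hcl'⟩ := hKc.exists_mapClusterPt_of_frequently hev.frequently
  exact hray p' (hKU hp') hcl'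

/-- **Development of a flat metric**: if isometric discs with a given germ at the centre have bounded
radius, then one of them has a radius that is a divergent curve. -/
theorem IsFlatOn.exists_divergent_ray [T2Space S] (hL : IsFlatOn L U) {p₀ : S} (hp₀ : p₀ ∈ U)
    (hbdd : ∀ Φ₀ : ℂ → S, IsoAt L U Φ₀ 0 → ∃ R₁ : ℝ, ∀ (r : ℝ) (Φ : ℂ → S),
      (∀ z ∈ Metric.ball (0 : ℂ) r, IsoAt L U Φ z) → Φ =ᶠ[𝓝 0] Φ₀ → r ≤ R₁) :
    ∃ R > 0, ∃ Φ : ℂ → S, (∀ z ∈ Metric.ball (0 : ℂ) R, IsoAt L U Φ z) ∧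
      ∃ a : ℂ, ‖a‖ = R ∧ Tendsto (fun t : ℝ => Φ (t * a)) (𝓝[<] 1) (cocompact S) := by
  obtain ⟨δ, hδ, Q, P, hQ, hP⟩ := hL.exists_coord hp₀
  have h0 : IsoAt L U Q 0 := hQ 0 (Metric.mem_ball_self (by positivity))
  obtain ⟨R₁, hR₁⟩ := hbdd Q h0
  obtain ⟨R, hR, Φ, hΦ, hΦ0, hmax⟩ := exists_maximal_disc h0 hR₁
  obtain ⟨a, ha, hray⟩ := exists_ray_of_maximal hL hR hΦ
    fun r Ψ h1 h2 => hmax r Ψ h1 (h2.trans hΦ0)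
  exact ⟨R, hR, Φ, hΦ, a, ha, tendsto_cocompact_of_ray hL hR hΦ ha hray⟩

end development

/-! ### Conformal metrics and discs in the surface -/

section metric

variable {S : Type*} [TopologicalSpace S] [ChartedSpace ℂ S] {Φ : ℂ → S} {w : ℂ}

/-- A radius of a holomorphic disc is a differentiable curve. -/
theorem HolAt.contMDiffAt_ray [IsManifold 𝓘(ℂ) ω S] {a : ℂ} {t : ℝ} (h : HolAt Φ (t * a)) :
    ContMDiffAt 𝓘(ℝ) 𝓘(ℝ, ℂ) 1 (fun t : ℝ => Φ (t * a)) t := by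
  have hlin : ContDiffAt ℝ 1 (fun t : ℝ => (t : ℂ) * a) t :=
    (Complex.ofRealCLM.contDiff.contDiffAt).mul contDiffAt_const
  have han := h.analyticAt_chart (mem_chart_source ℂ (Φ (t * a)))
  have hd : ContDiffAt ℝ 1 (chartAt ℂ (Φ (t * a)) ∘ Φ) (t * a) :=
    (han.contDiffAt (n := 1)).restrict_scalars ℝ
  rw [contMDiffAt_iff]
  refine ⟨ContinuousAt.comp (f := fun t : ℝ => (t : ℂ) * a) h.continuousAt
    hlin.continuousAt, ContDiffAt.contDiffWithinAt ?_⟩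
  exact ContDiffAt.comp (g := chartAt ℂ (Φ (t * a)) ∘ Φ) (f := fun t : ℝ => (t : ℂ) * a) t hd hlin

theorem HolAt.mfderiv_ray {a : ℂ} {t : ℝ} (h : HolAt Φ (t * a)) :
    mfderiv 𝓘(ℝ) 𝓘(ℝ, ℂ) (fun t : ℝ => Φ (t * a)) t (1 : ℝ)
      = a • mfderiv 𝓘(ℂ) 𝓘(ℂ) Φ (t * a) (1 : ℂ) := by
  obtain ⟨T, hT⟩ : ∃ T : ℂ →L[ℂ] ℂ, T = mfderiv 𝓘(ℂ) 𝓘(ℂ) Φ (t * a) := ⟨_, rfl⟩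
  have h2 : HasFDerivAt (chartAt ℂ (Φ (t * a)) ∘ Φ) T (t * a) := by
    have h1 : HasFDerivWithinAt (chartAt ℂ (Φ (t * a)) ∘ Φ) T (Set.range (id : ℂ → ℂ)) (t * a) := by
      rw [hT]; exact h.mdifferentiableAt.hasMFDerivAt.2
    rwa [Set.range_id, hasFDerivWithinAt_univ] at h1
  have e1 : HasDerivAt (fun t : ℝ => (t : ℂ) * a) a t := by
    simpa using (Complex.ofRealCLM.hasDerivAt (x := t)).mul_const a
  have h3 := HasFDerivAt.comp (g := chartAt ℂ (Φ (t * a)) ∘ Φ) (f := fun t : ℝ => (t : ℂ) * a) t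
    (h2.restrictScalars ℝ) e1.hasFDerivAt
  obtain ⟨R, hR⟩ : ∃ R : ℝ →L[ℝ] ℂ, R = (T.restrictScalars ℝ).comp
    (ContinuousLinearMap.toSpanSingleton ℝ a) := ⟨_, rfl⟩
  have h4 : HasMFDerivAt 𝓘(ℝ) 𝓘(ℝ, ℂ) (fun t : ℝ => Φ (t * a)) t R := by
    refine ⟨ContinuousAt.comp (f := fun t : ℝ => (t : ℂ) * a) h.continuousAt e1.continuousAt, ?_⟩
    rw [hR]
    exact h3.hasFDerivWithinAt
  rw [h4.mfderiv]
  have h5 : R 1 = a • T 1 := by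
    rw [hR, ← ContinuousLinearMap.map_smul]
    simp
  rw [hT] at h5
  exact h5

variable (ds : ConformalMetric S)

namespace ConformalMetric

theorem isHomog : IsHomog ds.len := ds.len_smul

theorem continuousAt_pull_chart (p : S) {z : ℂ} (hz : z ∈ (chartAt ℂ p).target) :
    ContinuousAt (pull ds.len (chartAt ℂ p).symm) z :=
  (ds.smooth p).continuousOn.continuousAt ((chartAt ℂ p).open_target.mem_nhds hz)

variable [IsManifold 𝓘(ℂ) ω S]

theorem pull_chart_pos (p : S) {z : ℂ} (hz : z ∈ (chartAt ℂ p).target) :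
    0 < pull ds.len (chartAt ℂ p).symm z := by
  refine ds.len_pos _ _ fun h => ?_
  -- the derivative of the chart is a left inverse of that of its inverse
  have h1 := mdifferentiableAt_atlas_symm (I := 𝓘(ℂ)) (chart_mem_atlas ℂ p) hz
  have h2 := mdifferentiableAt_atlas (I := 𝓘(ℂ)) (chart_mem_atlas ℂ p)
    ((chartAt ℂ p).map_target hz)
  have h3 := mfderiv_comp_apply z h2 h1 (1 : ℂ)
  have h4 : (chartAt ℂ p ∘ (chartAt ℂ p).symm) =ᶠ[𝓝 z] id := by
    filter_upwards [(chartAt ℂ p).open_target.mem_nhds hz] with y hy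
    exact (chartAt ℂ p).right_inv hy
  rw [h4.mfderiv_eq, h, map_zero, mfderiv_id] at h3
  exact one_ne_zero (α := ℂ) h3

/-- A metric `∏ (1 + |gᵢ|²)^{mᵢ} |η|²` is locally `∏ |Fᵢ|^{mᵢ}` times the modulus of a nonvanishing
holomorphic function, for any homogeneous coordinates `Fᵢ` of the `gᵢ`. At the poles of the `gᵢ` this
holds by removability, as the metric is continuous and positive there. -/
theorem IsGivenBy.logHol [ConnectedSpace S] {ds : ConformalMetric S} {n : ℕ}
    {g : Fin n → S → OnePoint ℂ} {m : Fin n → ℕ} {η : HolomorphicOneForm S}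
    (hds : ds.IsGivenBy g m η) (hg : ∀ i, IsHolomorphicToSphere (g i)) (p : S)
    {F : Fin n → ℂ → ℂ × ℂ}
    (hF : ∀ i, LiftAt (F i) (g i ∘ (chartAt ℂ p).symm) (chartAt ℂ p p)) :
    LogHol (fun z => pull ds.len (chartAt ℂ p).symm z / ∏ i, nsq (F i z) ^ ((m i : ℝ) / 2))
      (chartAt ℂ p p) := by
  set φ := chartAt ℂ p
  set z₀ := φ p
  have ht : z₀ ∈ φ.target := mem_chart_target ℂ p
  set N : ℂ → ℝ := fun z => ∏ i, nsq (F i z) ^ ((m i : ℝ) / 2)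
  set u : ℂ → ℝ := fun z => pull ds.len φ.symm z / N z with hu
  set E : ℂ → ℂ := fun z => η.toFun (φ.symm z) (coordVec p z)
  set B : ℂ → ℂ := fun z => ∏ i, (F i z).1 ^ m i
  have hFall : ∀ᶠ z in 𝓝 z₀, ∀ i, LiftAt (F i) (g i ∘ φ.symm) z :=
    eventually_all.2 fun i => (hF i).eventually
  have hNpos : ∀ z, (∀ i, LiftAt (F i) (g i ∘ φ.symm) z) → 0 < N z := fun z hz =>
    Finset.prod_pos fun i _ => Real.rpow_pos_of_pos (hz i).nsq_pos _
  have hucont : ContinuousAt u z₀ := by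
    refine (ds.continuousAt_pull_chart p ht).div ?_ (hNpos z₀ hF).ne'
    refine tendsto_finsetProd _ fun i _ => ?_
    exact (continuousAt_nsq (hF i).analyticAt.continuousAt).rpow_const
      (Or.inl (hF i).nsq_pos.ne')
  have hu0 : 0 < u z₀ := div_pos (ds.pull_chart_pos p ht) (hNpos z₀ hF)
  -- the poles of the `gᵢ` are isolated
  have hpole : ∀ i, ∀ᶠ z in 𝓝[≠] z₀, (F i z).1 ≠ 0 := by
    intro i
    have hA : AnalyticAt ℂ (fun z => (F i z).1) z₀ := analyticAt_fst.comp (hF i).analyticAt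
    refine hA.eventually_eq_zero_or_eventually_ne_zero.resolve_left fun h0 => ?_
    have h1 : ∀ᶠ x in 𝓝 p, g i x = OnePoint.infty := by
      have hmap : map φ.symm (𝓝 z₀) = 𝓝 p := by
        rw [φ.symm.map_nhds_eq ht, φ.left_inv (mem_chart_source ℂ p)]
      rw [← hmap, eventually_map]
      filter_upwards [h0, (hF i).eventually] with z hz hFz
      refine (hFz.eq_const_iff OnePoint.infty).2 ?_
      simp [rep_infty, wedge, hz]
    obtain ⟨x, hx⟩ := hds.1 i
    have := (hg i).eq_of_eventually_eq (isHolomorphicToSphere_const OnePoint.infty) h1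
    exact hx (congrFun this x)
  have hkey : ∀ z, (∀ i, LiftAt (F i) (g i ∘ φ.symm) z) → (∀ i, (F i z).1 ≠ 0) →
      z ∈ φ.target → u z = ‖E z / B z‖ := by
    intro z hz h0 hzt
    have hval : ∀ i, g i (φ.symm z) = (((F i z).2 / (F i z).1 : ℂ) : OnePoint ℂ) := by
      intro i
      refine ((hz i).eq_const_iff _).2 ?_
      rw [rep_coe, wedge_smul_right]
      have := h0 i
      simp only [wedge]
      field_simp
      simp
    have hsq := hds.2 (φ.symm z) _ hval (coordVec p z)
    have hpull : pull ds.len φ.symm z = ds.len (φ.symm z) (coordVec p z) := rfl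
    have hpos := ds.pull_chart_pos p hzt
    have hN := hNpos z hz
    have hB : ∀ i, 0 < ‖(F i z).1‖ := fun i => norm_pos_iff.2 (h0 i)
    have hN2 : N z ^ 2 = (∏ i, (1 + ‖(F i z).2 / (F i z).1‖ ^ 2) ^ m i) * ‖B z‖ ^ 2 := by
      simp only [N, B, norm_prod, ← Finset.prod_pow, ← Finset.prod_mul_distrib]
      refine Finset.prod_congr rfl fun i _ => ?_
      rw [← Real.rpow_mul_natCast (nsq_nonneg _)]
      have : (m i : ℝ) / 2 * (2 : ℕ) = m i := by push_cast; ring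
      rw [this, Real.rpow_natCast, norm_pow, ← pow_mul, mul_comm (m i) 2, pow_mul, ← mul_pow]
      congr 1
      have := (hB i).ne'
      rw [nsq, norm_div]
      field_simp
    have hBz : 0 < ‖B z‖ := norm_pos_iff.2 (Finset.prod_ne_zero_iff.2 fun i _ =>
      pow_ne_zero _ (h0 i))
    have h2 : u z ^ 2 = ‖E z / B z‖ ^ 2 := by
      rw [hu, norm_div, div_pow, div_pow, hN2, hpull, hsq]
      have : 0 < ∏ i, (1 + ‖(F i z).2 / (F i z).1‖ ^ 2) ^ m i :=
        Finset.prod_pos fun i _ => by positivity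
      field_simp
      rfl
    exact (pow_left_inj₀ (div_pos hpos hN).le (norm_nonneg _) two_ne_zero).1 h2
  -- `E / B` extends holomorphically to `z₀`
  have hev : ∀ᶠ z in 𝓝 z₀, (z ≠ z₀ → (∀ i, (F i z).1 ≠ 0)) ∧
      ((∀ i, LiftAt (F i) (g i ∘ φ.symm) z) ∧ z ∈ φ.target) ∧ u z < u z₀ + 1 := by
    refine (eventually_nhdsWithin_iff.1 (eventually_all.2 hpole)).and
      ((hFall.and (φ.open_target.eventually_mem ht)).and ?_)
    exact hucont.eventually (gt_mem_nhds (by linarith))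
  obtain ⟨r, hr, hball⟩ := Metric.eventually_nhds_iff_ball.1 hev
  have hdiff : DifferentiableOn ℂ (fun z => E z / B z) (Metric.ball z₀ r \ {z₀}) := by
    rintro z ⟨hz, hne⟩
    obtain ⟨h1, ⟨h2, h3⟩, -⟩ := hball z hz
    have hE : DifferentiableAt ℂ E z :=
      (η.holomorphic p z h3).differentiableAt (φ.open_target.mem_nhds h3)
    have hB : DifferentiableAt ℂ B z := by
      have : AnalyticAt ℂ B z := Finset.analyticAt_fun_prod _ fun i _ =>
        (AnalyticAt.pow (analyticAt_fst.comp (h2 i).analyticAt) (m i))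
      exact this.differentiableAt
    exact (hE.div hB (Finset.prod_ne_zero_iff.2 fun i _ =>
      pow_ne_zero _ (h1 hne i))).differentiableWithinAt
  have hbdd : BddAbove (norm ∘ (fun z => E z / B z) '' (Metric.ball z₀ r \ {z₀})) := by
    refine ⟨u z₀ + 1, ?_⟩
    rintro _ ⟨z, ⟨hz, hne⟩, rfl⟩
    obtain ⟨h1, ⟨h2, h3⟩, h4⟩ := hball z hz
    simp only [Function.comp]
    rw [← hkey z h2 (h1 hne) h3]
    exact h4.le
  have hrem := Complex.differentiableOn_update_limUnder_of_bddAbove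
    (Metric.ball_mem_nhds z₀ hr) hdiff hbdd
  set H := Function.update (fun z => E z / B z) z₀ (limUnder (𝓝[≠] z₀) fun z => E z / B z)
  have hHa : AnalyticAt ℂ H z₀ := hrem.analyticAt (Metric.ball_mem_nhds z₀ hr)
  have hHu : ∀ᶠ z in 𝓝[≠] z₀, ‖H z‖ = u z := by
    filter_upwards [self_mem_nhdsWithin, nhdsWithin_le_nhds (Metric.ball_mem_nhds z₀ hr)]
      with z hne hz
    obtain ⟨h1, ⟨h2, h3⟩, -⟩ := hball z hz
    rw [hkey z h2 (h1 hne) h3]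
    simp only [H, Function.update_of_ne hne]
  have hHz : ‖H z₀‖ = u z₀ := by
    have t1 := (hHa.continuousAt.norm.tendsto).mono_left (nhdsWithin_le_nhds (s := {z₀}ᶜ))
    have t2 := hucont.tendsto.mono_left (nhdsWithin_le_nhds (s := {z₀}ᶜ))
    exact tendsto_nhds_unique (t1.congr' hHu) t2
  refine (LogHol.norm hHa ?_).congr ?_
  · rw [← norm_pos_iff, hHz]; exact hu0
  · have := eventually_nhdsWithin_iff.1 hHu
    filter_upwards [this] with z hz
    by_cases h : z = z₀
    · rw [h]; exact hHz.symm
    · exact (hz h).symm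

end ConformalMetric

end metric

/-! ### The flat metric of two families of maps sharing values -/

section local_forms

variable {A : Finset (OnePoint ℂ)} {e D : ℝ} {F G : ℂ → ℂ × ℂ} {f f' g g' : ℂ → OnePoint ℂ} {w : ℂ}

theorem densHol_nonneg : 0 ≤ densHol A e D F G w := by
  have h (F : ℂ → ℂ × ℂ) : 0 ≤ ∏ α ∈ A, ‖wedge (F w) (rep α)‖ :=
    Finset.prod_nonneg fun _ _ => norm_nonneg _
  have h1 := h F
  have h2 := h G
  unfold densHol
  positivity

theorem LiftAt.dens_congr (hF : LiftAt F f w) (hG : LiftAt G g w) (hf : f' =ᶠ[𝓝 w] f)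
    (hg : g' =ᶠ[𝓝 w] g) : dens A e D f' g' w = dens A e D f g w := by
  rw [hF.dens_eq hG, (hF.congr hf).dens_eq (hG.congr hg)]

theorem HasOrd.exists_div_le {u : ℂ → ℝ} {ν : ℝ} (hu : HasOrd u w ν) (hν : ν ≤ -1) :
    ∃ c : ℝ, 0 < c ∧ ∀ᶠ z in 𝓝[≠] w, c / ‖z - w‖ ≤ u z := by
  obtain ⟨k, hk, hu⟩ := hu
  refine ⟨Real.exp ((k w).re - 1), Real.exp_pos _, ?_⟩
  have h1 : ∀ᶠ z in 𝓝 w, (k w).re - 1 < (k z).re :=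
    (Complex.continuous_re.continuousAt.comp hk.continuousAt).eventually
      (lt_mem_nhds (by simp))
  filter_upwards [hu, nhdsWithin_le_nhds h1, nhdsWithin_le_nhds (Metric.ball_mem_nhds w one_pos),
    self_mem_nhdsWithin] with z hz h1 h2 h3
  have h0 : 0 < ‖z - w‖ := norm_pos_iff.2 (sub_ne_zero.2 h3)
  have h4 : ‖z - w‖ < 1 := by simpa [dist_eq_norm] using h2
  rw [hz, div_eq_mul_inv, mul_comm]
  refine mul_le_mul ?_ (Real.exp_le_exp.2 h1.le) (Real.exp_pos _).le (by positivity)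
  rw [← Real.rpow_neg_one]
  exact Real.rpow_le_rpow_of_exponent_ge h0 h4.le hν

end local_forms

theorem map_chart_symm {S : Type*} [TopologicalSpace S] [ChartedSpace ℂ S] (p : S) :
    map (chartAt ℂ p).symm (𝓝 (chartAt ℂ p p)) = 𝓝 p := by
  rw [(chartAt ℂ p).symm.map_nhds_eq (mem_chart_target ℂ p),
    (chartAt ℂ p).left_inv (mem_chart_source ℂ p)]

/-- Two families of sphere-valued maps `fᵢ`, `gᵢ` on a surface, together with, for each `i` in the
finite set `I`, the set `Aᵢ` of values that `fᵢ` and `gᵢ` share, the parameters of the density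
`dens` built from them, and the weight `kᵢ` with which it enters. -/
structure SharingFamily (S : Type*) (n : ℕ) where
  /-- the first family -/
  f : Fin n → S → OnePoint ℂ
  /-- the second family -/
  g : Fin n → S → OnePoint ℂ
  /-- the indices of the nonconstant maps -/
  I : Finset (Fin n)
  /-- the shared values -/
  A : Fin n → Finset (OnePoint ℂ)
  /-- the exponent by which the poles of the density at the shared values are weakened -/
  e : Fin n → ℝ
  /-- the share of the second map in the density -/
  D : Fin n → ℝ
  /-- the weights -/
  k : Fin n → ℝ

namespace SharingFamily

variable {S : Type*} {n : ℕ} (c : SharingFamily S n)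

/-- The total weight. -/
def weight : ℝ := ∑ i ∈ c.I, c.k i

/-- The product of powers of the densities of the pairs `fᵢ ∘ Φ`, `gᵢ ∘ Φ`. -/
def prodDens (Φ : ℂ → S) (w : ℂ) : ℝ :=
  ∏ i ∈ c.I, dens (c.A i) (c.e i) (c.D i) (c.f i ∘ Φ) (c.g i ∘ Φ) w ^ c.k i

variable [TopologicalSpace S] [ChartedSpace ℂ S]

/-- The compatibility of a sharing family with a metric `∏ (1 + |fᵢ|²)^{mᵢ} |η|²`. The exponents are
such that the factors `(1 + |fᵢ|²)` cancel in the quotient of `prodDens` by the metric, and that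
`prodDens` vanishes to order at least `1 - weight` wherever it vanishes. -/
structure Admissible (ds : ConformalMetric S) (m : Fin n → ℕ) (η : HolomorphicOneForm S) :
    Prop where
  given : ds.IsGivenBy c.f m η
  hol_f : ∀ i, IsHolomorphicToSphere (c.f i)
  hol_g : ∀ i, IsHolomorphicToSphere (c.g i)
  nonempty : c.I.Nonempty
  nonconst_f : ∀ i ∈ c.I, ¬ IsConstantMap (c.f i)
  nonconst_g : ∀ i ∈ c.I, ¬ IsConstantMap (c.g i)
  const_f : ∀ i ∉ c.I, IsConstantMap (c.f i)
  ne : ∀ i ∈ c.I, c.f i ≠ c.g i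
  A_nonempty : ∀ i ∈ c.I, (c.A i).Nonempty
  share : ∀ i ∈ c.I, ∀ α ∈ c.A i, SharesValue (c.f i) (c.g i) α
  e_pos : ∀ i ∈ c.I, 0 < c.e i
  e_lt : ∀ i ∈ c.I, c.e i < 1
  D_pos : ∀ i ∈ c.I, 0 < c.D i
  D_le : ∀ i ∈ c.I, c.D i ≤ 1 / 2
  k_pos : ∀ i ∈ c.I, 0 < c.k i
  weight_lt : c.weight < 1
  exp_f : ∀ i ∈ c.I, c.k i * densExp (c.A i) (c.e i) (1 - c.D i) = m i / 2
  exp_g : ∀ i ∈ c.I, densExp (c.A i) (c.e i) (c.D i) = 0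
  le_order : ∀ i ∈ c.I, 1 - c.weight ≤ c.k i * min (c.e i) (c.D i)

variable (ds : ConformalMetric S)

/-- The quotient of `prodDens` by the power of the metric with the same homogeneity; it is a function
on the surface. -/
def ratio (p : S) : ℝ :=
  c.prodDens (chartAt ℂ p).symm (chartAt ℂ p p) /
    pull ds.len (chartAt ℂ p).symm (chartAt ℂ p p) ^ c.weight

/-- The conformal change of the metric that makes it flat. -/
def flatLen (p : S) (v : TangentSpace 𝓘(ℂ) p) : ℝ :=
  ds.len p v * c.ratio ds p ^ (-(1 / (1 - c.weight)))

/-- The set where the flat metric is defined. -/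
def regular : Set S := {p | 0 < c.ratio ds p}

theorem isHomog_flatLen : IsHomog (c.flatLen ds) := by
  intro p a v
  rw [flatLen, ds.len_smul, mul_assoc, flatLen]

variable {c ds} {m : Fin n → ℕ} {η : HolomorphicOneForm S} {Φ Ψ : ℂ → S} {w : ℂ}

theorem Admissible.weight_pos (hc : c.Admissible ds m η) : 0 < c.weight :=
  Finset.sum_pos hc.k_pos hc.nonempty

theorem Admissible.prodDens_nonneg (hc : c.Admissible ds m η) (hΦ : HolAt Φ w) :
    0 ≤ c.prodDens Φ w := by
  refine Finset.prod_nonneg fun i _ => Real.rpow_nonneg ?_ _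
  obtain ⟨F, hF⟩ := (hc.hol_f i).exists_lift hΦ
  obtain ⟨G, hG⟩ := (hc.hol_g i).exists_lift hΦ
  exact dens_nonneg hF hG

theorem Admissible.prodDens_congr (hc : c.Admissible ds m η) (hΦ : HolAt Φ w)
    (he : Ψ =ᶠ[𝓝 w] Φ) : c.prodDens Ψ w = c.prodDens Φ w := by
  refine Finset.prod_congr rfl fun i _ => ?_
  obtain ⟨F, hF⟩ := (hc.hol_f i).exists_lift hΦ
  obtain ⟨G, hG⟩ := (hc.hol_g i).exists_lift hΦ
  rw [hF.dens_congr hG (he.fun_comp (c.f i)) (he.fun_comp (c.g i))]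

theorem Admissible.prodDens_comp (hc : c.Admissible ds m η) {h : ℂ → ℂ} (hΦ : HolAt Φ (h w))
    (hh : AnalyticAt ℂ h w) :
    c.prodDens (Φ ∘ h) w = c.prodDens Φ (h w) * ‖deriv h w‖ ^ c.weight := by
  have h1 : ‖deriv h w‖ ^ c.weight = ∏ i ∈ c.I, ‖deriv h w‖ ^ c.k i :=
    Real.rpow_sum_of_nonneg (norm_nonneg _) fun i hi => (hc.k_pos i hi).le
  rw [h1, prodDens, prodDens, ← Finset.prod_mul_distrib]
  refine Finset.prod_congr rfl fun i hi => ?_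
  obtain ⟨F, hF⟩ := (hc.hol_f i).exists_lift hΦ
  obtain ⟨G, hG⟩ := (hc.hol_g i).exists_lift hΦ
  rw [← Real.mul_rpow (dens_nonneg hF hG) (norm_nonneg _),
    ← hF.dens_comp hG hh (hc.D_pos i hi) (by linarith [hc.D_le i hi])]
  rfl

variable [IsManifold 𝓘(ℂ) ω S]

theorem Admissible.ratio_nonneg (hc : c.Admissible ds m η) (p : S) : 0 ≤ c.ratio ds p :=
  div_nonneg (hc.prodDens_nonneg (holAt_chart_symm p (mem_chart_target ℂ p)))
    (Real.rpow_nonneg (ds.pull_chart_pos p (mem_chart_target ℂ p)).le _)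

/-- The quotient of `prodDens` by the metric does not depend on the parametrization. -/
theorem Admissible.prodDens_eq (hc : c.Admissible ds m η) (hΦ : HolAt Φ w) :
    c.prodDens Φ w = c.ratio ds (Φ w) * pull ds.len Φ w ^ c.weight := by
  have hp := mem_chart_source ℂ (Φ w)
  have ht := mem_chart_target ℂ (Φ w)
  have hpos := ds.pull_chart_pos (Φ w) ht
  have hψ := holAt_chart_symm (Φ w) ht
  rw [hΦ.pull_eq_chart ds.isHomog hp, Real.mul_rpow hpos.le (norm_nonneg _), ratio, ← mul_assoc,
    div_mul_cancel₀ _ (Real.rpow_pos_of_pos hpos _).ne',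
    ← hc.prodDens_congr hΦ ((hΦ.eventually_eq_chart hp).mono fun z h => h.2.symm)]
  exact hc.prodDens_comp (h := chartAt ℂ (Φ w) ∘ Φ) hψ (hΦ.analyticAt_chart hp)

/-- The factor `N`, common to the metric `x` and to `prodDens = y N`, cancels in the flat metric. -/
theorem pull_flatLen_eq {x r N a y κ : ℝ} (hκ : κ < 1) (hN : 0 < N) (ha : 0 < a) (hy : 0 ≤ y)
    (hx : x = a * N) (hr : r = y * N / x ^ κ) :
    x * r ^ (-(1 / (1 - κ))) = a ^ (1 / (1 - κ)) * y ^ (-(1 / (1 - κ))) := by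
  have h1 : (1 - κ) ≠ 0 := by linarith
  set s := 1 / (1 - κ) with hs
  have hs0 : s = 1 + κ * s := by rw [hs]; field_simp; ring
  have hx0 : 0 < x := hx ▸ mul_pos ha hN
  rw [hr, Real.div_rpow (by positivity) (by positivity), ← Real.rpow_mul hx0.le,
    mul_neg, Real.rpow_neg hx0.le, div_inv_eq_mul, mul_comm, mul_assoc]
  have h2 : x ^ (κ * s) * x = x ^ s := by
    conv_rhs => rw [hs0, add_comm, Real.rpow_add hx0, Real.rpow_one]
  rw [h2, hx, Real.mul_rpow hy hN.le, Real.mul_rpow ha.le hN.le, Real.rpow_neg hN.le]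
  have := (Real.rpow_pos_of_pos hN s).ne'
  field_simp

/-- At each point the flat metric is either regular, or singular with a singularity at infinite
distance. -/
theorem Admissible.regular_or_singular [ConnectedSpace S] (hc : c.Admissible ds m η) (p : S) :
    (0 < c.ratio ds p ∧ LogHol (pull (c.flatLen ds) (chartAt ℂ p).symm) (chartAt ℂ p p)) ∨
    (c.ratio ds p = 0 ∧ ∃ b : ℝ, 0 < b ∧ ∀ᶠ z in 𝓝[≠] (chartAt ℂ p p),
      0 < c.ratio ds ((chartAt ℂ p).symm z) ∧
      b / ‖z - chartAt ℂ p p‖ ≤ pull (c.flatLen ds) (chartAt ℂ p).symm z) := by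
  set ψ := (chartAt ℂ p).symm with hψdef
  set z₀ := chartAt ℂ p p with hz₀
  have ht : z₀ ∈ (chartAt ℂ p).target := mem_chart_target ℂ p
  have hψp : ψ z₀ = p := (chartAt ℂ p).left_inv (mem_chart_source ℂ p)
  have hmap : map ψ (𝓝 z₀) = 𝓝 (ψ z₀) := by rw [hψp]; exact map_chart_symm p
  have hψ : HolAt ψ z₀ := holAt_chart_symm p ht
  choose F hF using fun i => (hc.hol_f i).exists_lift hψ
  choose G hG using fun i => (hc.hol_g i).exists_lift hψ
  set s := 1 / (1 - c.weight) with hs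
  have hs0 : 0 < s := one_div_pos.2 (by linarith [hc.weight_lt])
  set N : ℂ → ℝ := fun z => ∏ i ∈ c.I, nsq (F i z) ^ ((m i : ℝ) / 2)
  set Y : ℂ → ℝ := fun z =>
    ∏ i ∈ c.I, densHol (c.A i) (c.e i) (c.D i) (F i) (G i) z ^ c.k i
  set a : ℂ → ℝ := fun z => pull ds.len ψ z / N z with ha
  have hYnn : ∀ z, 0 ≤ Y z := fun z => Finset.prod_nonneg fun i _ =>
    Real.rpow_nonneg densHol_nonneg _
  have hev : ∀ᶠ z in 𝓝 z₀, (∀ i, LiftAt (F i) (c.f i ∘ ψ) z) ∧ (∀ i, LiftAt (G i) (c.g i ∘ ψ) z) ∧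
      z ∈ (chartAt ℂ p).target :=
    (eventually_all.2 fun i => (hF i).eventually).and
      ((eventually_all.2 fun i => (hG i).eventually).and
        ((chartAt ℂ p).open_target.mem_nhds ht))
  have hN : ∀ z, (∀ i, LiftAt (F i) (c.f i ∘ ψ) z) → 0 < N z := fun z hz =>
    Finset.prod_pos fun i _ => Real.rpow_pos_of_pos (hz i).nsq_pos _
  have haL : LogHol a z₀ := by
    have h1 := hc.given.logHol hc.hol_f p hF
    -- the coordinates of a constant map are a multiple of a constant vector
    have h2 : ∀ i ∈ c.Iᶜ, LogHol (fun z => nsq (F i z)) z₀ := by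
      intro i hi
      obtain ⟨b, hb⟩ := hc.const_f i (by simpa using hi)
      have hbz : ∀ z, LiftAt (F i) (c.f i ∘ ψ) z → F i z = herm (F i z) (rep b) • rep b := by
        intro z hz
        refine eq_smul_of_wedge_eq_zero (nsq_rep b) ?_
        have := hz.wedge_eq_zero
        rwa [Function.comp_apply, hb] at this
      have hH : AnalyticAt ℂ (fun z => herm (F i z) (rep b)) z₀ := by
        have h1 := (hF i).analyticAt
        exact ((analyticAt_fst.comp h1).mul analyticAt_const).add
          ((analyticAt_snd.comp h1).mul analyticAt_const)
      have hH0 : herm (F i z₀) (rep b) ≠ 0 := by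
        intro h'
        have := hbz z₀ (hF i)
        rw [h', zero_smul] at this
        exact (hF i).ne_zero this
      refine ((LogHol.norm hH hH0).rpow 2).congr ?_
      filter_upwards [(hF i).eventually] with z hz
      rw [hbz z hz, nsq_smul, nsq_rep, mul_one, ← hbz z hz]
      norm_cast
    have h3 := h1.mul (LogHol.prod c.Iᶜ fun i hi => (h2 i hi).rpow ((m i : ℝ) / 2))
    refine h3.congr ?_
    filter_upwards [hev] with z hz
    have h4 : 0 < ∏ i ∈ c.Iᶜ, nsq (F i z) ^ ((m i : ℝ) / 2) :=
      Finset.prod_pos fun i _ => Real.rpow_pos_of_pos (hz.1 i).nsq_pos _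
    have h5 := hN z hz.1
    rw [ha, ← Finset.prod_mul_prod_compl c.I]
    simp only [N] at h5 ⊢
    field_simp
    rfl
  have hX : ∀ᶠ z in 𝓝 z₀, c.prodDens ψ z = Y z * N z := by
    filter_upwards [hev] with z hz
    rw [prodDens, ← Finset.prod_mul_distrib]
    refine Finset.prod_congr rfl fun i hi => ?_
    have hpos := (hz.1 i).nsq_pos
    rw [(hz.1 i).dens_eq (hz.2.1 i), hc.exp_g i hi, Real.rpow_zero, mul_one,
      Real.mul_rpow densHol_nonneg (Real.rpow_nonneg hpos.le _), ← Real.rpow_mul hpos.le,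
      mul_comm (densExp _ _ _), hc.exp_f i hi]
  have hloc : ∀ᶠ z in 𝓝 z₀, 0 < N z ∧ 0 < a z ∧ pull ds.len ψ z = a z * N z ∧
      c.ratio ds (ψ z) = Y z * N z / pull ds.len ψ z ^ c.weight := by
    filter_upwards [hev, hX, hψ.eventually] with z hz h1 h2
    have h3 := hN z hz.1
    have h4 : 0 < pull ds.len ψ z := ds.pull_chart_pos p hz.2.2
    refine ⟨h3, div_pos h4 h3, (div_mul_cancel₀ _ h3.ne').symm, ?_⟩
    rw [← h1, hc.prodDens_eq h2, mul_div_cancel_right₀ _ (Real.rpow_pos_of_pos h4 _).ne']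
  have hratio_pos : ∀ᶠ z in 𝓝 z₀, 0 < Y z → 0 < c.ratio ds (ψ z) := by
    filter_upwards [hloc] with z hz hY
    rw [hz.2.2.2, hz.2.2.1]
    have := mul_pos hz.2.1 hz.1
    exact div_pos (mul_pos hY hz.1) (Real.rpow_pos_of_pos this _)
  have hL : ∀ᶠ z in 𝓝 z₀, pull (c.flatLen ds) ψ z = a z ^ s * Y z ^ (-s) := by
    filter_upwards [hloc] with z hz
    exact pull_flatLen_eq hc.weight_lt hz.1 hz.2.1 (hYnn z) hz.2.2.1 hz.2.2.2
  have hdich := fun i hi => (generic_of_sharesValue (hc.hol_f i) (hc.hol_g i) (hc.nonconst_f i hi)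
    (hc.nonconst_g i hi) (hc.ne i hi) (hc.share i hi) hmap (hF i) (hG i)).logHol_or_hasOrd
      (hc.e_pos i hi) (hc.e_lt i hi) (hc.D_pos i hi) (hc.D_le i hi)
  by_cases hall : ∀ i ∈ c.I, LogHol (densHol (c.A i) (c.e i) (c.D i) (F i) (G i)) z₀
  · left
    have hY : LogHol Y z₀ := LogHol.prod _ fun i hi => (hall i hi).rpow _
    refine ⟨?_, ((haL.rpow s).mul (hY.rpow (-s))).congr hL⟩
    have := hratio_pos.self_of_nhds hY.pos.self_of_nhds
    rwa [hψp] at this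
  · right
    push Not at hall
    obtain ⟨i₀, hi₀, hi₀'⟩ := hall
    have hz : Y z₀ = 0 := by
      refine Finset.prod_eq_zero hi₀ ?_
      rw [((hdich i₀ hi₀).resolve_left fun h => hi₀' h.1).1, Real.zero_rpow (hc.k_pos i₀ hi₀).ne']
    have hord : ∀ i, ∃ ν : ℝ, i ∈ c.I → 0 ≤ ν ∧ (i = i₀ → min (c.e i) (c.D i) ≤ ν) ∧
        HasOrd (densHol (c.A i) (c.e i) (c.D i) (F i) (G i)) z₀ ν := by
      intro i
      by_cases hi : i ∈ c.I
      · rcases hdich i hi with h | ⟨-, ν, hν, h⟩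
        · exact ⟨0, fun _ => ⟨le_rfl, fun h' => absurd h.1 (h' ▸ hi₀'), h.1.hasOrd⟩⟩
        · exact ⟨ν, fun _ => ⟨(le_min (hc.e_pos i hi).le (hc.D_pos i hi).le).trans hν,
            fun _ => hν, h⟩⟩
      · exact ⟨0, fun h => absurd h hi⟩
    choose ν hν using hord
    have hY := HasOrd.prod c.I fun i hi => (hν i hi).2.2.rpow (c.k i)
    have hsum : 1 - c.weight ≤ ∑ i ∈ c.I, ν i * c.k i := by
      refine (hc.le_order i₀ hi₀).trans ?_
      rw [mul_comm]
      refine (mul_le_mul_of_nonneg_right ((hν i₀ hi₀).2.1 rfl) (hc.k_pos i₀ hi₀).le).trans ?_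
      exact Finset.single_le_sum (f := fun i => ν i * c.k i)
        (fun i hi => mul_nonneg (hν i hi).1 (hc.k_pos i hi).le) hi₀
    have hfl : HasOrd (pull (c.flatLen ds) ψ) z₀ (0 + (∑ i ∈ c.I, ν i * c.k i) * (-s)) :=
      ((haL.rpow s).hasOrd.mul (hY.rpow (-s))).congr (hL.filter_mono nhdsWithin_le_nhds)
    obtain ⟨b, hb, hbz⟩ := hfl.exists_div_le (by
      have h1 : (1 - c.weight) * s = 1 := by
        rw [hs, mul_one_div_cancel]; linarith [hc.weight_lt]
      have := mul_le_mul_of_nonneg_right hsum hs0.le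
      linarith)
    refine ⟨?_, b, hb, ?_⟩
    · have := hloc.self_of_nhds.2.2.2
      rwa [hψp, hz, zero_mul, zero_div] at this
    · filter_upwards [hbz, nhdsWithin_le_nhds hL, nhdsWithin_le_nhds hratio_pos,
        self_mem_nhdsWithin] with z h1 h2 h3 hne
      refine ⟨h3 ((hYnn z).lt_of_ne' fun h' => ?_), h1⟩
      rw [h2, h', Real.zero_rpow (by linarith), mul_zero] at h1
      exact absurd h1 (not_le.2 (div_pos hb (norm_pos_iff.2 (sub_ne_zero.2 hne))))

theorem Admissible.isFlatOn [ConnectedSpace S] (hc : c.Admissible ds m η) :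
    IsFlatOn (c.flatLen ds) (c.regular ds) where
  homog := c.isHomog_flatLen ds
  isOpen := by
    rw [isOpen_iff_mem_nhds]
    intro p hp
    have h1 := ((hc.regular_or_singular p).resolve_right fun h => hp.ne' h.1).2.pos
    rw [← map_chart_symm p, mem_map]
    filter_upwards [h1] with z hz
    refine (hc.ratio_nonneg _).lt_of_ne' fun h' => ?_
    have h2 : -(1 / (1 - c.weight)) ≠ 0 :=
      neg_ne_zero.2 (one_div_pos.2 (by linarith [hc.weight_lt])).ne'
    rw [pull, flatLen, h', Real.zero_rpow h2, mul_zero] at hz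
    exact lt_irrefl _ hz
  flat p hp := ((hc.regular_or_singular p).resolve_right fun h => hp.ne' h.1).2
  sing p hp := ((hc.regular_or_singular p).resolve_left fun h => hp h.1).2

theorem Admissible.exists_mem_regular [ConnectedSpace S] (hc : c.Admissible ds m η) :
    ∃ p, p ∈ c.regular ds := by
  obtain ⟨p⟩ := ‹ConnectedSpace S›.toNonempty
  rcases hc.regular_or_singular p with h | ⟨-, b, -, h⟩
  · exact ⟨p, h.1⟩
  · obtain ⟨z, hz, -⟩ := h.exists
    exact ⟨_, hz⟩

/-- Along a local isometry from the Euclidean plane, `prodDens` is the original metric. -/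
theorem Admissible.pull_eq_prodDens (hc : c.Admissible ds m η)
    (h : IsoAt (c.flatLen ds) (c.regular ds) Φ w) :
    0 < pull ds.len Φ w ∧ pull ds.len Φ w = c.prodDens Φ w := by
  have h1 : pull ds.len Φ w * c.ratio ds (Φ w) ^ (-(1 / (1 - c.weight))) = 1 := h.pull_eq
  have h2 : 0 < c.ratio ds (Φ w) := h.mem
  have hw : 1 - c.weight ≠ 0 := by linarith [hc.weight_lt]
  rw [Real.rpow_neg h2.le, mul_inv_eq_one₀ (Real.rpow_pos_of_pos h2 _).ne'] at h1
  refine ⟨h1 ▸ Real.rpow_pos_of_pos h2 _, ?_⟩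
  rw [hc.prodDens_eq h.1, h1, ← Real.rpow_mul h2.le]
  nth_rw 2 [← Real.rpow_one (c.ratio ds (Φ w))]
  rw [← Real.rpow_add h2]
  congr 1
  field_simp
  ring

theorem Admissible.map_nhds (h : IsoAt (c.flatLen ds) (c.regular ds) Φ w) :
    map Φ (𝓝 w) = 𝓝 (Φ w) := by
  refine h.1.map_nhds (mem_chart_source ℂ _) fun h0 => ?_
  have := h.pull_eq
  rw [h.1.pull_eq_chart (c.isHomog_flatLen ds) (mem_chart_source ℂ _), h0, norm_zero,
    mul_zero] at this
  exact zero_ne_one this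

/-- On discs mapped isometrically with respect to the flat metric, the original metric is dominated
by a power of the Poincaré density. -/
theorem Admissible.exists_pull_le [ConnectedSpace S] (hc : c.Admissible ds m η) :
    ∃ K : ℝ, 0 < K ∧ ∀ (R : ℝ) (Φ : ℂ → S),
      (∀ z ∈ Metric.ball (0 : ℂ) R, IsoAt (c.flatLen ds) (c.regular ds) Φ z) →
      ∀ z ∈ Metric.ball (0 : ℂ) R, pull ds.len Φ z ≤ K * (R / (R ^ 2 - ‖z‖ ^ 2)) ^ c.weight := by
  have hex : ∀ i, ∃ K : ℝ, i ∈ c.I → 0 < K ∧ ∀ (R : ℝ) (f g : ℂ → OnePoint ℂ),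
      (∀ w ∈ Metric.ball (0 : ℂ) R, ∃ F G, Generic (c.A i) F G f g w) →
        ∀ w ∈ Metric.ball (0 : ℂ) R,
          dens (c.A i) (c.e i) (c.D i) f g w ≤ K * (R / (R ^ 2 - ‖w‖ ^ 2)) := by
    intro i
    by_cases hi : i ∈ c.I
    · have hP : 0 ≤ densExp (c.A i) (c.e i) (1 - c.D i) := by
        refine nonneg_of_mul_nonneg_right ?_ (hc.k_pos i hi)
        rw [hc.exp_f i hi]; positivity
      obtain ⟨K, h1, h2⟩ := exists_dens_le (c.A i) (hc.e_pos i hi) (hc.e_lt i hi) (hc.D_pos i hi)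
        (hc.D_le i hi) (hc.A_nonempty i hi) hP (hc.exp_g i hi).ge
      exact ⟨K, fun _ => ⟨h1, h2⟩⟩
    · exact ⟨0, fun h => absurd h hi⟩
  choose K hK using hex
  refine ⟨∏ i ∈ c.I, K i ^ c.k i, Finset.prod_pos fun i hi =>
    Real.rpow_pos_of_pos (hK i hi).1 _, fun R Φ hΦ z hz => ?_⟩
  rw [(hc.pull_eq_prodDens (hΦ z hz)).2]
  have hzR : ‖z‖ < R := by simpa using hz
  have hρ : 0 ≤ R / (R ^ 2 - ‖z‖ ^ 2) := by
    have := norm_nonneg z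
    exact div_nonneg (by linarith) (by nlinarith)
  have h1 : (R / (R ^ 2 - ‖z‖ ^ 2)) ^ c.weight = ∏ i ∈ c.I, (R / (R ^ 2 - ‖z‖ ^ 2)) ^ c.k i :=
    Real.rpow_sum_of_nonneg hρ fun i hi => (hc.k_pos i hi).le
  rw [h1, ← Finset.prod_mul_distrib]
  have hnn : ∀ i, 0 ≤ dens (c.A i) (c.e i) (c.D i) (c.f i ∘ Φ) (c.g i ∘ Φ) z := by
    intro i
    obtain ⟨F, hF⟩ := (hc.hol_f i).exists_lift (hΦ z hz).1
    obtain ⟨G, hG⟩ := (hc.hol_g i).exists_lift (hΦ z hz).1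
    exact dens_nonneg hF hG
  refine Finset.prod_le_prod (fun i _ => Real.rpow_nonneg (hnn i) _) fun i hi => ?_
  rw [← Real.mul_rpow (hK i hi).1.le hρ]
  refine Real.rpow_le_rpow (hnn i) ((hK i hi).2 R _ _ (fun w hw => ?_) z hz) (hc.k_pos i hi).le
  obtain ⟨F, hF⟩ := (hc.hol_f i).exists_lift (hΦ w hw).1
  obtain ⟨G, hG⟩ := (hc.hol_g i).exists_lift (hΦ w hw).1
  exact ⟨F, G, generic_of_sharesValue (hc.hol_f i) (hc.hol_g i) (hc.nonconst_f i hi)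
    (hc.nonconst_g i hi) (hc.ne i hi) (hc.share i hi) (map_nhds (hΦ w hw)) hF hG⟩

/-- The metric is not complete: the divergent radius of a maximal flat disc of radius `R` has length
at most a multiple of `∫ (R (1 - t))^{-weight} dt`. -/
theorem Admissible.not_isComplete [T2Space S] [ConnectedSpace S] (hc : c.Admissible ds m η) :
    ¬ ds.IsComplete := by
  intro hcomp
  obtain ⟨K, hK, hle⟩ := hc.exists_pull_le
  obtain ⟨p₀, hp₀⟩ := hc.exists_mem_regular
  have hκ := hc.weight_pos
  obtain ⟨R, hR, Φ, hΦ, a, ha, hdiv⟩ := hc.isFlatOn.exists_divergent_ray hp₀ (by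
    intro Φ₀ hΦ₀
    have hx := (hc.pull_eq_prodDens hΦ₀).1
    set x := pull ds.len Φ₀ 0
    refine ⟨(K / x) ^ (c.weight⁻¹), fun r Φ hΦ hΦ' => ?_⟩
    rcases le_or_gt r 0 with hr | hr
    · exact hr.trans (by positivity)
    have h1 := hle r Φ hΦ 0 (Metric.mem_ball_self hr)
    rw [pull_congr hΦ'] at h1
    have h2 : r / (r ^ 2 - ‖(0 : ℂ)‖ ^ 2) = r⁻¹ := by
      rw [norm_zero]; field_simp; ring
    rw [h2, Real.inv_rpow hr.le, ← div_eq_mul_inv, le_div_iff₀ (by positivity)] at h1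
    rw [Real.le_rpow_inv_iff_of_pos hr.le (by positivity) hκ, le_div_iff₀ hx, mul_comm]
    exact h1)
  have hmem : ∀ t : ℝ, t ∈ Set.Ico (0 : ℝ) 1 → (t : ℂ) * a ∈ Metric.ball (0 : ℂ) R := by
    intro t ht
    rw [mem_ball_zero_iff, norm_mul, Complex.norm_real, Real.norm_of_nonneg ht.1, ha]
    nlinarith [ht.2]
  have hlen := hcomp (fun t : ℝ => Φ (t * a))
    (fun t ht => ((hΦ _ (hmem t ht)).1.contMDiffAt_ray).contMDiffWithinAt) hdiv
  have hint : IntegrableOn (fun t : ℝ => R * K * R ^ (-c.weight) * (1 - t) ^ (-c.weight))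
      (Set.Ioo 0 1) := by
    have h1 := intervalIntegral.intervalIntegrable_rpow' (a := 1) (b := 0) (r := -c.weight)
      (by linarith [hc.weight_lt])
    have h2 := (h1.comp_sub_left 1).const_mul (R * K * R ^ (-c.weight))
    rw [sub_self, sub_zero, intervalIntegrable_iff_integrableOn_Ioo_of_le zero_le_one] at h2
    exact h2
  refine (lt_of_le_of_lt ?_ hint.lintegral_lt_top).ne hlen
  rw [ConformalMetric.curveLength]
  refine setLIntegral_mono' measurableSet_Ioo fun t ht => ENNReal.ofReal_le_ofReal ?_
  have htm := hmem t ⟨ht.1.le, ht.2⟩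
  have h1 : ds.len (Φ (t * a)) (mfderiv 𝓘(ℝ) 𝓘(ℝ, ℂ) (fun t : ℝ => Φ (t * a)) t (1 : ℝ))
      = R * pull ds.len Φ (t * a) := by
    rw [(hΦ _ htm).1.mfderiv_ray, ← ha]
    exact ds.len_smul _ _ _
  rw [h1]
  have h2 := hle R Φ hΦ _ htm
  have h3 : ‖(t : ℂ) * a‖ = t * R := by
    rw [norm_mul, Complex.norm_real, Real.norm_of_nonneg ht.1.le, ha]
  rw [h3] at h2
  have ht1 : 0 < 1 - t := by linarith [ht.2]
  have h4 : R / (R ^ 2 - (t * R) ^ 2) ≤ (R * (1 - t))⁻¹ := by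
    have : R ^ 2 - (t * R) ^ 2 = R * (R * (1 - t)) * (1 + t) := by ring
    rw [this, div_le_iff₀ (by have := ht.1; positivity)]
    have h5 : (R * (1 - t))⁻¹ * (R * (R * (1 - t)) * (1 + t)) = R * (1 + t) := by
      field_simp
    rw [h5]
    nlinarith [ht.1]
  have h5 : 0 ≤ R / (R ^ 2 - (t * R) ^ 2) := by
    have : R ^ 2 - (t * R) ^ 2 = R * (R * (1 - t)) * (1 + t) := by ring
    have h0 := ht.1
    rw [this]; positivity
  have h6 := Real.rpow_le_rpow h5 h4 hκ.le
  rw [Real.inv_rpow (by positivity), ← Real.rpow_neg (by positivity),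
    Real.mul_rpow hR.le ht1.le] at h6
  calc R * pull ds.len Φ (t * a) ≤ R * (K * (R ^ (-c.weight) * (1 - t) ^ (-c.weight))) := by
        gcongr
        exact h2.trans (mul_le_mul_of_nonneg_left h6 hK.le)
    _ = _ := by ring

end SharingFamily

/-! ### The inequality -/

/-- Holomorphic maps to the sphere can be composed with holomorphic maps of surfaces. -/
theorem IsHolomorphicToSphere.comp {S S' : Type*} [TopologicalSpace S] [ChartedSpace ℂ S]
    [TopologicalSpace S'] [ChartedSpace ℂ S'] {g : S' → OnePoint ℂ} (hg : IsHolomorphicToSphere g)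
    {Ψ : S → S'} (hΨ : MDifferentiable 𝓘(ℂ) 𝓘(ℂ) Ψ) : IsHolomorphicToSphere (g ∘ Ψ) := by
  intro p
  obtain ⟨f, hf, h⟩ := hg (Ψ p)
  have hc := (hΨ p).continuousAt
  refine ⟨f ∘ Ψ, ?_, h.imp hc.eventually hc.eventually⟩
  filter_upwards [hc.eventually hf] with x hx using hx.comp x (hΨ x)

/-- The parameters of the density. They are all determined by the total weight `κ < 1`, which has to
be close to `1`. -/
theorem exists_weight {ι : Type*} (I : Finset ι) {m q : ι → ℝ} {σ : ℝ} (hm : ∀ i ∈ I, 0 < m i)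
    (hq : ∀ i ∈ I, 4 < q i) (h0 : 0 < σ) (h1 : σ < 1) :
    ∃ κ : ℝ, σ < κ ∧ κ < 1 ∧ ∀ i ∈ I, 1 - κ ≤ m i / (σ / κ * (q i - 4)) *
      min (1 - (σ / κ * (q i - 4) + 4) / q i) (1 / (σ / κ * (q i - 4) + 2)) := by
  have hev : ∀ᶠ κ in 𝓝 (1 : ℝ), ∀ i ∈ I, 1 - κ < m i / (σ / κ * (q i - 4)) *
      min (1 - (σ / κ * (q i - 4) + 4) / q i) (1 / (σ / κ * (q i - 4) + 2)) := by
    rw [Finset.eventually_all]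
    intro i hi
    have hq4 : 0 < q i - 4 := by linarith [hq i hi]
    have hq0 : 0 < q i := by linarith
    have hmi := hm i hi
    have hs : ContinuousAt (fun κ : ℝ => σ / κ * (q i - 4)) 1 :=
      (continuousAt_const.div continuousAt_id one_ne_zero).mul continuousAt_const
    have hpos : 0 < σ / 1 * (q i - 4) := by positivity
    have hr : ContinuousAt (fun κ : ℝ => m i / (σ / κ * (q i - 4)) *
      min (1 - (σ / κ * (q i - 4) + 4) / q i) (1 / (σ / κ * (q i - 4) + 2))) 1 :=
      (continuousAt_const.div hs hpos.ne').mul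
        ((continuousAt_const.sub ((hs.add continuousAt_const).div_const _)).min
          (continuousAt_const.div (hs.add continuousAt_const) (by positivity)))
    refine (continuousAt_const.sub continuousAt_id).eventually_lt hr ?_
    change (1 : ℝ) - 1 < m i / (σ / 1 * (q i - 4)) *
      min (1 - (σ / 1 * (q i - 4) + 4) / q i) (1 / (σ / 1 * (q i - 4) + 2))
    rw [sub_self]
    refine mul_pos (by positivity) (lt_min ?_ (by positivity))
    rw [sub_pos, div_lt_one hq0, div_one]
    nlinarith
  obtain ⟨κ, h2, h3⟩ := ((hev.filter_mono nhdsWithin_le_nhds).and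
    (Ioo_mem_nhdsLT h1)).exists
  exact ⟨κ, h3.1, h3.2, fun i hi => (h2 i hi).le⟩

/-- The inequality for two families of maps on the same surface. -/
theorem one_le_sum_of_isComplete {S : Type*} [TopologicalSpace S] [T2Space S] [ConnectedSpace S]
    [ChartedSpace ℂ S] [IsManifold 𝓘(ℂ) ω S] {n : ℕ} {m : Fin n → ℕ} (hm : ∀ i, 0 < m i)
    {f g : Fin n → S → OnePoint ℂ} (hf : ∀ i, IsHolomorphicToSphere (f i))
    (hg : ∀ i, IsHolomorphicToSphere (g i)) {η : HolomorphicOneForm S} {ds : ConformalMetric S}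
    (hds : ds.IsGivenBy f m η) {I : Finset (Fin n)} (hI : I.Nonempty)
    (hnf : ∀ i ∈ I, ¬ IsConstantMap (f i)) (hng : ∀ i ∈ I, ¬ IsConstantMap (g i))
    (hcf : ∀ i ∉ I, IsConstantMap (f i)) {q : Fin n → ℕ} (hq : ∀ i ∈ I, 4 < q i)
    (hshare : ∀ i ∈ I, ∃ A : Finset (OnePoint ℂ), A.card = q i ∧
      ∀ α ∈ A, SharesValue (f i) (g i) α)
    (hne : ∀ i ∈ I, f i ≠ g i) (hcomplete : ds.IsComplete) :
    1 ≤ ∑ i ∈ I, (m i : ℝ) / ((q i : ℝ) - 4) := by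
  by_contra! hlt
  have hex : ∀ i, ∃ A : Finset (OnePoint ℂ), i ∈ I → A.card = q i ∧
      ∀ α ∈ A, SharesValue (f i) (g i) α := by
    intro i
    by_cases hi : i ∈ I
    · obtain ⟨A, hA⟩ := hshare i hi
      exact ⟨A, fun _ => hA⟩
    · exact ⟨∅, fun h => absurd h hi⟩
  choose A hA using hex
  have hq' : ∀ i ∈ I, (4 : ℝ) < q i := fun i hi => by exact_mod_cast hq i hi
  have hm' : ∀ i, (0 : ℝ) < m i := fun i => by exact_mod_cast hm i
  set σ := ∑ i ∈ I, (m i : ℝ) / ((q i : ℝ) - 4) with hσ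
  have hσ0 : 0 < σ := Finset.sum_pos (fun i hi => div_pos (hm' i) (by linarith [hq' i hi])) hI
  obtain ⟨κ, hσκ, hκ1, hκ⟩ := exists_weight I (m := fun i => (m i : ℝ)) (q := fun i => (q i : ℝ))
    (fun i _ => hm' i) hq' hσ0 hlt
  have hκ0 : 0 < κ := hσ0.trans hσκ
  have hs0 : 0 < σ / κ := by positivity
  have hs1 : σ / κ < 1 := (div_lt_one hκ0).2 hσκ
  set s := σ / κ with hs
  have hweight : ∑ i ∈ I, (m i : ℝ) / (s * ((q i : ℝ) - 4)) = κ := by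
    have h1 : ∀ i ∈ I, (m i : ℝ) / (s * ((q i : ℝ) - 4)) = s⁻¹ * (m i / ((q i : ℝ) - 4)) := by
      intro i hi
      have : (q i : ℝ) - 4 ≠ 0 := by linarith [hq' i hi]
      field_simp
    rw [Finset.sum_congr rfl h1, ← Finset.mul_sum, ← hσ, hs]
    field_simp
  have hμ : ∀ i ∈ I, 0 < s * ((q i : ℝ) - 4) := fun i hi => mul_pos hs0 (by linarith [hq' i hi])
  let c : SharingFamily S n :=
    { f := f, g := g, I := I, A := A
      e := fun i => 1 - (s * ((q i : ℝ) - 4) + 4) / q i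
      D := fun i => 1 / (s * ((q i : ℝ) - 4) + 2)
      k := fun i => m i / (s * ((q i : ℝ) - 4)) }
  have hcw : c.weight = κ := hweight
  have hc : c.Admissible ds m η :=
    { given := hds
      hol_f := hf
      hol_g := hg
      nonempty := hI
      nonconst_f := hnf
      nonconst_g := hng
      const_f := hcf
      ne := hne
      A_nonempty := fun i hi => by
        have := (hA i hi).1
        have := hq i hi
        exact Finset.card_pos.1 (by simp only [c]; omega)
      share := fun i hi => (hA i hi).2
      e_pos := fun i hi => by
        have h1 := hq' i hi
        have h2 : s * ((q i : ℝ) - 4) < 1 * ((q i : ℝ) - 4) :=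
          mul_lt_mul_of_pos_right hs1 (by linarith)
        simp only [c]
        rw [sub_pos, div_lt_one (by linarith)]
        linarith
      e_lt := fun i hi => by
        have h1 := hq' i hi
        have h2 := hμ i hi
        have : 0 < (s * ((q i : ℝ) - 4) + 4) / q i := div_pos (by linarith) (by linarith)
        simp only [c]
        linarith
      D_pos := fun i hi => by
        have h2 := hμ i hi
        simp only [c]
        positivity
      D_le := fun i hi => by
        have h2 := hμ i hi
        simp only [c]
        exact one_div_le_one_div_of_le two_pos (by linarith)
      k_pos := fun i hi => div_pos (hm' i) (hμ i hi)
      weight_lt := hcw ▸ hκ1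
      exp_f := fun i hi => by
        have h1 : (q i : ℝ) ≠ 0 := by linarith [hq' i hi]
        have h2 := hμ i hi
        have h3 : (q i : ℝ) - 4 ≠ 0 := by linarith [hq' i hi]
        have h4 : s * ((q i : ℝ) - 4) + 2 ≠ 0 := by positivity
        simp only [c, densExp, (hA i hi).1]
        field_simp
        ring
      exp_g := fun i hi => by
        have h1 : (q i : ℝ) ≠ 0 := by linarith [hq' i hi]
        have h2 := hμ i hi
        have h4 : s * ((q i : ℝ) - 4) + 2 ≠ 0 := by positivity
        simp only [c, densExp, (hA i hi).1]
        field_simp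
        ring
      le_order := fun i hi => by
        rw [hcw]
        exact hκ i hi }
  exact hc.not_isComplete hcomplete

end

theorem theorem2p1
    {S : Type*} [TopologicalSpace S] [T2Space S] [ConnectedSpace S] [NoncompactSpace S]
    [ChartedSpace ℂ S] [IsManifold 𝓘(ℂ) ω S]
    {S' : Type*} [TopologicalSpace S'] [T2Space S'] [ConnectedSpace S'] [NoncompactSpace S']
    [ChartedSpace ℂ S'] [IsManifold 𝓘(ℂ) ω S']
    (n : ℕ) (m : Fin n → ℕ) (hm : ∀ i, 0 < m i)
    (g : Fin n → S → OnePoint ℂ) (hg : ∀ i, IsHolomorphicToSphere (g i))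
    (g' : Fin n → S' → OnePoint ℂ) (hg' : ∀ i, IsHolomorphicToSphere (g' i))
    (η : HolomorphicOneForm S) (η' : HolomorphicOneForm S')
    (ds : ConformalMetric S) (hds : ds.IsGivenBy g m η)
    (ds' : ConformalMetric S') (hds' : ds'.IsGivenBy g' m η')
    (Ψ : S ≃ₘ^ω⟮𝓘(ℂ), 𝓘(ℂ)⟯ S')
    (I : Finset (Fin n)) (hI : I.Nonempty)
    (hnonconst : ∀ i ∈ I, ¬ IsConstantMap (g i) ∧ ¬ IsConstantMap (g' i))
    (hconst : ∀ i ∉ I, IsConstantMap (g i) ∧ IsConstantMap (g' i))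
    (q : Fin n → ℕ) (hq : ∀ i ∈ I, 4 < q i)
    (hshare : ∀ i ∈ I, ∃ A : Finset (OnePoint ℂ), A.card = q i ∧
      ∀ α ∈ A, SharesValue (g i) (g' i ∘ Ψ) α)
    (hne : ∀ i ∈ I, g i ≠ g' i ∘ Ψ)
    (hcomplete : ds.IsComplete ∨ ds'.IsComplete) :
    1 ≤ ∑ i ∈ I, (m i : ℝ) / ((q i : ℝ) - 4) := by
  rcases hcomplete with hcomplete | hcomplete
  · refine one_le_sum_of_isComplete hm hg
      (fun i => (hg' i).comp (Ψ.contMDiff.mdifferentiable (by simp))) hds hI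
      (fun i hi => (hnonconst i hi).1) (fun i hi => ?_) (fun i hi => (hconst i hi).1) hq hshare hne
      hcomplete
    rintro ⟨c, hc⟩
    refine (hnonconst i hi).2 ⟨c, fun p => ?_⟩
    rw [← hc (Ψ.symm p), Function.comp_apply, Ψ.apply_symm_apply]
  · refine one_le_sum_of_isComplete (g := fun i => g i ∘ Ψ.symm) hm hg'
      (fun i => (hg i).comp (Ψ.symm.contMDiff.mdifferentiable (by simp))) hds' hI
      (fun i hi => (hnonconst i hi).2) (fun i hi => ?_) (fun i hi => (hconst i hi).2) hq
      (fun i hi => ?_) (fun i hi h => ?_) hcomplete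
    · rintro ⟨c, hc⟩
      refine (hnonconst i hi).1 ⟨c, fun p => ?_⟩
      rw [← hc (Ψ p), Function.comp_apply, Ψ.symm_apply_apply]
    · obtain ⟨A, hA, h⟩ := hshare i hi
      refine ⟨A, hA, fun α hα => ?_⟩
      ext p
      have := Set.ext_iff.1 (h α hα) (Ψ.symm p)
      simpa using this.symm
    · refine hne i hi ?_
      rw [h]
      funext p
      simp
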